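/- Let $D$ be the unit disk with normalized area measure $dA$, let $L_a^2$ and $L_h^2$ be the spaces of holomorphic and of (complex-valued) harmonic functions in $L^2(D,dA)$, and let $P$, $Q$ be the orthogonal projections of $L^2(D,dA)$ onto $L_a^2$, $L_h^2$, extended to $L^1(D,dA)$ by the integral formulas $$Pf(z)=\int_D \frac{f(w)}{(1-z\bar w)^2}\,dA(w),\qquad Qf(z)=\int_D\Big(\frac1{(1-z\bar w)^2}+\frac1{(1-\bar z w)^2}-1\Big)f(w)\,dA(w).$$ A function $u\in L^1(D,dA)$ is a T-function if $h\mapsto Q(uh)$, defined on harmonic polynomials $h$, extends to a bounded operator on $L_h^2$. On $L_a^2$, $T_u$ denotes the continuous extension of $p\mapsto P(up)$, $p$ an analytic polynomial. For a radial function $\varphi$ put $\widehat\varphi(z)=\int_0^1\varphi(r)r^{z-1}\,dr$, $\operatorname{Re}z\ge 2$. An operator has finite rank if the closure of its range has finite dimension; its rank is the dimension of its range, and $(f\otimes g)h=\langle h,g\rangle f$. **Theorem.** Let $k_1,k_2\in\mathbb Z$, let $m\in\mathbb R$ with $m\ge -1$, and let $\varphi$ be a radial T-function that is not a.e. zero.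 Then $T_{e^{ik_1\theta}r^m}$ and $T_{e^{ik_2\theta}\varphi}$ are well-defined bounded operators on $L_a^2$, and the commutator $K=[T_{e^{ik_1\theta}r^m},T_{e^{ik_2\theta}\varphi}]$ on $L_a^2$ has finite rank if and only if one of the following conditions holds for some constant $C\in\mathbb C$ (equalities for $\varphi$ hold for a.e. $r\in(0,1)$, those for $\widehat\varphi$ for all $z$ with $\operatorname{Re}z\ge2$, where $1/\Gamma=0$ at the poles of $\Gamma$): 1. $k_1=m=0$. 2. $k_2=0$ and $\varphi=C$. 3. $k_1=k_2=0$. 4. $k_1k_2>0$, $|k_2|<m+|k_1|+2$ and $$\widehat\varphi(z)=C\,\frac{\Gamma\left(\frac{z+|k_2|}{2|k_1|}\right)\Gamma\left(\frac{z+m+|k_1|-|k_2|}{2|k_1|}\right)}{\Gamma\left(\frac{z+2|k_1|-|k_2|}{2|k_1|}\right)\Gamma\left(\frac{z+m+|k_1|+|k_2|}{2|k_1|}\right)}.$$ 5. $k_1k_2>0$, $|k_2|\ge m+|k_1|+2$, $m=(2n+1)|k_1|$ for some integer $n\ge0$ and $$\widehat\varphi(z)=C\,\frac{\prod_{j=1}^{n}\left(\frac{z-|k_2|}{2|k_1|}+j\right)}{\prod_{j=0}^{n}\left(\frac{z+|k_2|}{2|k_1|}+j\right)}.$$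 6. $k_1k_2<0$, $|k_2|\ge2$, $m+|k_1|=0$ and $\varphi(r)=Cr^{|k_2|}$. 7. $k_1k_2<0$, $|k_2|=1$ and $$\widehat\varphi(z)=C\,\frac{\Gamma\left(\frac{z-1}{2|k_1|}\right)\Gamma\left(\frac{z+m+|k_1|+1}{2|k_1|}\right)}{\Gamma\left(\frac{z+2|k_1|+1}{2|k_1|}\right)\Gamma\left(\frac{z+m+|k_1|-1}{2|k_1|}\right)}.$$ Under each of (1)-(5), $K=0$, that is, $K$ has rank $0$. Under each of (6)-(7), the range of $K$ is $\operatorname{span}\{z^{\max\{k_1,k_2\}-1}\}$, $$K=C'\,z^{\max\{k_1,k_2\}-1}\otimes z^{\max\{-k_1,-k_2\}-1}$$ for some nonzero constant $C'$, and $K$ has rank $1$. -/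

import Mathlib

open MeasureTheory Set Filter Topology Polynomial
open scoped ComplexConjugate Real ENNReal

noncomputable section

namespace BergmanToeplitz

/-- The area measure `dA` on the unit disk, normalized to total mass one. -/
def diskMeasure : Measure ℂ :=
  (ENNReal.ofReal π)⁻¹ • volume.restrict (Metric.ball (0 : ℂ) 1)

instance instIsFiniteMeasureDisk : IsFiniteMeasure diskMeasure := by
  have h : IsFiniteMeasure (volume.restrict (Metric.ball (0 : ℂ) 1)) :=
    ⟨by simp⟩
  exact Measure.smul_finite _ (by simp [Real.pi_pos])

/-- The Bergman space `L_a^2`: the classes in `L^2(D, dA)` that have a representative which is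
holomorphic on the disk. -/
def bergmanSpace : Submodule ℂ (Lp ℂ 2 diskMeasure) where
  carrier := {f | ∃ g : ℂ → ℂ, DifferentiableOn ℂ g (Metric.ball 0 1) ∧ f =ᵐ[diskMeasure] g}
  zero_mem' := ⟨fun _ => 0, differentiableOn_const _, Lp.coeFn_zero _ _ _⟩
  add_mem' := by
    rintro f₁ f₂ ⟨g₁, hg₁, h₁⟩ ⟨g₂, hg₂, h₂⟩
    exact ⟨g₁ + g₂, hg₁.add hg₂, (Lp.coeFn_add f₁ f₂).trans (h₁.add h₂)⟩
  smul_mem' := by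
    rintro c f ⟨g, hg, h⟩
    exact ⟨c • g, hg.const_smul c, (Lp.coeFn_smul c f).trans (h.const_smul c)⟩

/-- The harmonic Bergman space `L_h^2`: the classes in `L^2(D, dA)` that have a (complex-valued)
representative which is harmonic on the disk. -/
def harmonicBergmanSpace : Submodule ℂ (Lp ℂ 2 diskMeasure) where
  carrier := {f | ∃ g : ℂ → ℂ,
    InnerProductSpace.HarmonicOnNhd g (Metric.ball 0 1) ∧ f =ᵐ[diskMeasure] g}
  zero_mem' := ⟨fun _ => 0, InnerProductSpace.harmonicOnNhd_const 0, Lp.coeFn_zero _ _ _⟩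
  add_mem' := by
    rintro f₁ f₂ ⟨g₁, hg₁, h₁⟩ ⟨g₂, hg₂, h₂⟩
    exact ⟨g₁ + g₂, hg₁.add hg₂, (Lp.coeFn_add f₁ f₂).trans (h₁.add h₂)⟩
  smul_mem' := by
    rintro c f ⟨g, hg, h⟩
    refine ⟨c • g, ?_, (Lp.coeFn_smul c f).trans (h.const_smul c)⟩
    exact hg.comp_CLM ((c • ContinuousLinearMap.id ℂ ℂ).restrictScalars ℝ)

/-- The integral formula of the Bergman projection `P`, which makes sense on `L^1(D, dA)`. -/
def bergmanProj (f : ℂ → ℂ) (z : ℂ) : ℂ :=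
  ∫ w, (1 / (1 - z * conj w) ^ 2) * f w ∂diskMeasure

/-- The integral formula of the projection `Q` onto the harmonic Bergman space, which makes sense
on `L^1(D, dA)`. -/
def harmonicProj (f : ℂ → ℂ) (z : ℂ) : ℂ :=
  ∫ w, (1 / (1 - z * conj w) ^ 2 + 1 / (1 - conj z * w) ^ 2 - 1) * f w ∂diskMeasure

/-- `S` is the continuous extension to `L_h^2` of the operator `h ↦ Q (u h)`, defined on the
harmonic polynomials `h = p + conj q`. -/
def IsHarmonicToeplitz (u : ℂ → ℂ) (S : harmonicBergmanSpace →L[ℂ] harmonicBergmanSpace) : Prop :=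
  ∀ (p q : ℂ[X]) (h : harmonicBergmanSpace),
    ((h : Lp ℂ 2 diskMeasure) =ᵐ[diskMeasure] fun w => p.eval w + conj (q.eval w)) →
    ((S h : Lp ℂ 2 diskMeasure) =ᵐ[diskMeasure]
      harmonicProj fun w => u w * (p.eval w + conj (q.eval w)))

/-- `u` is a T-function: it is in `L^1(D, dA)`, and `h ↦ Q (u h)` defines a bounded operator
on `L_h^2`. -/
def IsTFunction (u : ℂ → ℂ) : Prop :=
  Integrable u diskMeasure ∧
    ∃ S : harmonicBergmanSpace →L[ℂ] harmonicBergmanSpace, IsHarmonicToeplitz u S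

/-- `T` is the continuous extension to `L_a^2` of the operator `p ↦ P (u p)`, defined on the
analytic polynomials. -/
def IsBergmanToeplitz (u : ℂ → ℂ) (T : bergmanSpace →L[ℂ] bergmanSpace) : Prop :=
  ∀ (p : ℂ[X]) (h : bergmanSpace),
    ((h : Lp ℂ 2 diskMeasure) =ᵐ[diskMeasure] fun w => p.eval w) →
    ((T h : Lp ℂ 2 diskMeasure) =ᵐ[diskMeasure] bergmanProj fun w => u w * p.eval w)

open Classical in
/-- The Toeplitz operator `T_u` on `L_a^2` (zero if `p ↦ P (u p)` has no continuous extension). -/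
def bergmanToeplitz (u : ℂ → ℂ) : bergmanSpace →L[ℂ] bergmanSpace :=
  if h : ∃ T, IsBergmanToeplitz u T then h.choose else 0

/-- The radial function on the disk with profile `φ`. -/
def radial (φ : ℝ → ℂ) (w : ℂ) : ℂ := φ ‖w‖

/-- The quasihomogeneous function `r e^{iθ} ↦ e^{ikθ} φ(r)`. -/
def quasihomogeneous (k : ℤ) (φ : ℝ → ℂ) (w : ℂ) : ℂ :=
  Complex.exp (Complex.I * k * Complex.arg w) * φ ‖w‖

/-- The Mellin transform `∫₀¹ φ(r) r^(z-1) dr` of a radial function on the disk. -/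
def mellinDisk (φ : ℝ → ℂ) (z : ℂ) : ℂ :=
  ∫ r in Ioo (0 : ℝ) 1, φ r * (r : ℂ) ^ (z - 1)

/-- The commutator `[A, B] = A B - B A` of two operators on `L_a^2`. -/
def commutator (A B : bergmanSpace →L[ℂ] bergmanSpace) : bergmanSpace →L[ℂ] bergmanSpace :=
  A ∘L B - B ∘L A

/-- `A` has finite rank: the closure of its range has finite dimension. -/
def IsFiniteRank (A : bergmanSpace →L[ℂ] bergmanSpace) : Prop :=
  FiniteDimensional ℂ (LinearMap.range (A : bergmanSpace →ₗ[ℂ] bergmanSpace)).topologicalClosure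

theorem memLp_pow (n : ℕ) : MemLp (fun z : ℂ => z ^ n) 2 diskMeasure := by
  refine MemLp.of_bound (by fun_prop) 1 ?_
  have h : ∀ᵐ z ∂(volume.restrict (Metric.ball (0 : ℂ) 1)), ‖z ^ n‖ ≤ 1 := by
    filter_upwards [ae_restrict_mem measurableSet_ball] with z hz
    rw [norm_pow]
    exact pow_le_one₀ (norm_nonneg z) (by simpa using (mem_ball_zero_iff.mp hz).le)
  exact Measure.ae_smul_measure h _

/-- The monomial `z ^ n` as an element of `L_a^2`. -/
def bergmanPow (n : ℕ) : bergmanSpace :=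
  ⟨(memLp_pow n).toLp _, fun z => z ^ n, by fun_prop, (memLp_pow n).coeFn_toLp⟩

/-- The conditions under which the commutator vanishes, on `k₁`, `k₂`, `m` and the radial function `φ`. -/
def ZeroCondition (k₁ k₂ : ℤ) (m : ℝ) (φ : ℝ → ℂ) : Prop :=
  (k₁ = 0 ∧ m = 0) ∨
  (k₂ = 0 ∧ ∃ C : ℂ, ∀ᵐ r ∂(volume.restrict (Ioo (0 : ℝ) 1)), φ r = C) ∨
  (k₁ = 0 ∧ k₂ = 0) ∨
  (0 < k₁ * k₂ ∧ (|k₂| : ℝ) < m + |k₁| + 2 ∧ ∃ C : ℂ, ∀ z : ℂ, 2 ≤ z.re →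
    mellinDisk φ z = C *
      (Complex.Gamma ((z + |k₂|) / (2 * |k₁|)) *
        Complex.Gamma ((z + m + |k₁| - |k₂|) / (2 * |k₁|))) /
      (Complex.Gamma ((z + 2 * |k₁| - |k₂|) / (2 * |k₁|)) *
        Complex.Gamma ((z + m + |k₁| + |k₂|) / (2 * |k₁|)))) ∨
  (0 < k₁ * k₂ ∧ m + |k₁| + 2 ≤ (|k₂| : ℝ) ∧ ∃ n : ℕ, m = (2 * n + 1) * |k₁| ∧
    ∃ C : ℂ, ∀ z : ℂ, 2 ≤ z.re →
      mellinDisk φ z = C *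
        (∏ j ∈ Finset.Icc 1 n, ((z - |k₂|) / (2 * |k₁|) + j)) /
        (∏ j ∈ Finset.Icc 0 n, ((z + |k₂|) / (2 * |k₁|) + j)))

/-- The conditions under which the commutator has rank one, on `k₁`, `k₂`, `m` and the radial function `φ`. -/
def RankOneCondition (k₁ k₂ : ℤ) (m : ℝ) (φ : ℝ → ℂ) : Prop :=
  (k₁ * k₂ < 0 ∧ 2 ≤ |k₂| ∧ m + |k₁| = 0 ∧
    ∃ C : ℂ, ∀ᵐ r ∂(volume.restrict (Ioo (0 : ℝ) 1)), φ r = C * (r : ℂ) ^ |k₂|) ∨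
  (k₁ * k₂ < 0 ∧ |k₂| = 1 ∧ ∃ C : ℂ, ∀ z : ℂ, 2 ≤ z.re →
    mellinDisk φ z = C *
      (Complex.Gamma ((z - 1) / (2 * |k₁|)) *
        Complex.Gamma ((z + m + |k₁| + 1) / (2 * |k₁|))) /
      (Complex.Gamma ((z + 2 * |k₁| + 1) / (2 * |k₁|)) *
        Complex.Gamma ((z + m + |k₁| - 1) / (2 * |k₁|))))

end BergmanToeplitz

end

open BergmanToeplitz

noncomputable section

namespace BergmanToeplitz

/-! The monomials form an orthogonal basis of the Bergman space, and a Toeplitz operator with symbol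
`e^{ikθ}φ` is a weighted shift on it: `z^n` goes to `2(n+k+1) φ̂(2n+k+2) z^(n+k)`, or to `0` when `n
+ k < 0`. The weights are bounded because the radial operator on harmonic functions has the even
moments of `φ` in its eigenvalues, and consecutive moments differ by `O(1/n)`
(`IsTFunction.exists_norm_moment_le`).

The commutator is then a weighted shift of degree `k₁ + k₂`. Its nonzero images of distinct
monomials are independent, so finite rank forces its weights to vanish eventually
(`eventually_eq_zero_of_isFiniteRank`). The Mellin transform of `r^m` is `1/(z+m)`. Hence, once all
degrees are nonnegative and `k₁ ≠ 0`, a vanishing weight is a first-order recurrence for `φ̂` with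
step `2|k₁|` and quadratic polynomial coefficients (`CommRecurrence`). A quotient of four Gamma
functions solves the same recurrence. The difference between `φ̂` and a multiple of that quotient
has polynomial growth on a half-plane and vanishes along an arithmetic progression. The Blaschke
product over such a progression diverges to zero, so the difference vanishes identically
(`exists_mellinDisk_eq_gammaQuotient`).

The case distinction comes from poles. `φ̂` is holomorphic for `Re z > 2` and continuous for `Re z ≥
2`, so every pole of a numerator Gamma factor in that closed half-plane must be cancelled
(`pole_cancellation`). For degrees of the same sign this forces `m` to be an odd multiple of `|k₁|`
when `|k₂|` is large. For opposite signs with `|k₂| ≥ 2` it forces `m + |k₁| = 0`. In both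
situations the quotient becomes rational.

Conversely, each formula for `φ̂` gives the recurrence. For same signs all weights of the commutator
vanish. For opposite signs there is one exceptional monomial: one order of the two operators passes
through degree `-1` and gives zero, the other does not. This produces the rank one operator. -/

/-! ### Polar coordinates and integrals of quasihomogeneous functions -/

theorem integrableOn_polarCoord_symm_iff (f : ℂ → ℂ) :
    Integrable f ↔
      IntegrableOn (fun p : ℝ × ℝ => p.1 • f (Complex.polarCoord.symm p)) polarCoord.target := by
  have h1 : Integrable f ↔ Integrable (f ∘ Complex.measurableEquivRealProd.symm) :=
    (Complex.volume_preserving_equiv_real_prod.symm.integrable_comp_emb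
      Complex.measurableEquivRealProd.symm.measurableEmbedding).symm
  set g := f ∘ Complex.measurableEquivRealProd.symm
  have h2 : Integrable g ↔ IntegrableOn g polarCoord.source := by
    rw [← integrableOn_univ]
    exact integrableOn_congr_set_ae polarCoord_source_ae_eq_univ.symm
  rw [h1, h2, ← polarCoord.symm_image_target_eq_source,
    integrableOn_image_iff_integrableOn_abs_det_fderiv_smul volume
      polarCoord.open_target.measurableSet
      (fun p _ => (hasFDerivAt_polarCoord_symm p).hasFDerivWithinAt) polarCoord.symm.injOn]
  refine integrableOn_congr_fun (fun p hp => ?_) polarCoord.open_target.measurableSet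
  rw [det_fderivPolarCoordSymm, abs_of_pos hp.1]
  rfl

theorem arg_polarCoord_symm {p : ℝ × ℝ} (hp : p ∈ polarCoord.target) :
    Complex.arg (Complex.polarCoord.symm p) = p.2 := by
  have := Complex.polarCoord.right_inv (x := p) hp
  rw [Complex.polarCoord_apply] at this
  exact (Prod.ext_iff.mp this).2

theorem norm_polarCoord_symm_of_mem {p : ℝ × ℝ} (hp : p ∈ polarCoord.target) :
    ‖Complex.polarCoord.symm p‖ = p.1 := by
  rw [Complex.norm_polarCoord_symm, abs_of_pos hp.1]

theorem quasihomogeneous_polarCoord_symm (k : ℤ) (φ : ℝ → ℂ) {p : ℝ × ℝ}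
    (hp : p ∈ polarCoord.target) :
    quasihomogeneous k φ (Complex.polarCoord.symm p) =
      Complex.exp (Complex.I * k * p.2) * φ p.1 := by
  rw [quasihomogeneous, arg_polarCoord_symm hp, norm_polarCoord_symm_of_mem hp]

theorem polarCoord_symm_mem_ball_iff {p : ℝ × ℝ} (hp : p ∈ polarCoord.target) :
    Complex.polarCoord.symm p ∈ Metric.ball (0 : ℂ) 1 ↔ p ∈ Ioo (0 : ℝ) 1 ×ˢ Ioo (-π) π := by
  rw [mem_ball_zero_iff, norm_polarCoord_symm_of_mem hp]
  have h1 : 0 < p.1 := hp.1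
  have h2 : p.2 ∈ Ioo (-π) π := hp.2
  simp only [mem_prod, h2, and_true, mem_Ioo, h1, true_and]

theorem Ioo_prod_subset_target : Ioo (0 : ℝ) 1 ×ˢ Ioo (-π) π ⊆ polarCoord.target :=
  prod_mono (fun _ h => h.1) subset_rfl

theorem inv_ofReal_pi_ne_top : (ENNReal.ofReal π)⁻¹ ≠ ∞ := by
  simp [Real.pi_pos]

theorem inv_ofReal_pi_ne_zero : (ENNReal.ofReal π)⁻¹ ≠ 0 := by
  simp

theorem integrable_diskMeasure_iff (f : ℂ → ℂ) :
    Integrable f diskMeasure ↔ IntegrableOn f (Metric.ball 0 1) := by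
  rw [diskMeasure, integrable_smul_measure inv_ofReal_pi_ne_zero inv_ofReal_pi_ne_top]
  rfl

theorem integrable_quasihomogeneous_iff (k : ℤ) (φ : ℝ → ℂ) :
    Integrable (quasihomogeneous k φ) diskMeasure ↔
      IntegrableOn (fun r => φ r * (r : ℂ)) (Ioo (0 : ℝ) 1) := by
  rw [integrable_diskMeasure_iff, ← integrable_indicator_iff measurableSet_ball,
    integrableOn_polarCoord_symm_iff]
  have h1 : IntegrableOn (fun p : ℝ × ℝ => p.1 • (Metric.ball (0 : ℂ) 1).indicator
        (quasihomogeneous k φ) (Complex.polarCoord.symm p)) polarCoord.target ↔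
      IntegrableOn ((Ioo (0 : ℝ) 1 ×ˢ Ioo (-π) π).indicator (fun p : ℝ × ℝ =>
        (φ p.1 * (p.1 : ℂ)) * Complex.exp (Complex.I * k * p.2))) polarCoord.target := by
    refine integrableOn_congr_fun (fun p hp => ?_) polarCoord.open_target.measurableSet
    by_cases hb : p ∈ Ioo (0 : ℝ) 1 ×ˢ Ioo (-π) π
    · rw [indicator_of_mem hb, indicator_of_mem ((polarCoord_symm_mem_ball_iff hp).2 hb),
        quasihomogeneous_polarCoord_symm k φ hp, Complex.real_smul]
      ring
    · rw [indicator_of_notMem hb,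
        indicator_of_notMem (mt (polarCoord_symm_mem_ball_iff hp).1 hb), smul_zero]
  have hms : MeasurableSet (Ioo (0 : ℝ) 1 ×ˢ Ioo (-π) π) := measurableSet_Ioo.prod measurableSet_Ioo
  rw [h1, integrableOn_indicator_iff hms, inter_eq_left.mpr Ioo_prod_subset_target, IntegrableOn,
    Measure.volume_eq_prod, ← Measure.prod_restrict]
  constructor
  · intro h
    -- By Fubini almost every slice `θ = const` is integrable in `r`; one such slice suffices, since
    -- its phase is a constant that can be divided out.
    have h2 := h.prod_left_ae
    have : (ae (volume.restrict (Ioo (-π) π))).NeBot := by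
      rw [ae_restrict_neBot]
      simp [Real.pi_pos]
    obtain ⟨θ, hθ⟩ := h2.exists
    refine (hθ.mul_const (Complex.exp (-(Complex.I * k * θ)))).congr (ae_of_all _ fun r => ?_)
    simp only [mul_assoc]
    rw [← Complex.exp_add, add_neg_cancel, Complex.exp_zero, mul_one]
  · intro h
    refine Integrable.mul_prod (f := fun r : ℝ => φ r * (r : ℂ))
      (g := fun θ : ℝ => Complex.exp (Complex.I * k * θ)) h ?_
    exact (Continuous.integrableOn_Icc (by fun_prop)).mono_set Ioo_subset_Icc_self

theorem integral_exp_int_mul (k : ℤ) :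
    ∫ θ in Ioo (-π) π, Complex.exp (Complex.I * k * θ) = if k = 0 then (2 * π : ℂ) else 0 := by
  rw [← integral_Ioc_eq_integral_Ioo, ← intervalIntegral.integral_of_le (by linarith [Real.pi_pos])]
  split_ifs with hk
  · subst hk
    simp
    ring
  · rw [integral_exp_mul_complex (by simp [hk])]
    have : Complex.exp (Complex.I * k * (π : ℂ)) = Complex.exp (Complex.I * k * ((-π : ℝ) : ℂ)) := by
      rw [Complex.exp_eq_exp_iff_exists_int]
      exact ⟨k, by push_cast; ring⟩
    rw [this]; simp

theorem integral_diskMeasure (f : ℂ → ℂ) :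
    ∫ w, f w ∂diskMeasure = (π : ℂ)⁻¹ * ∫ w in Metric.ball 0 1, f w := by
  rw [diskMeasure, integral_smul_measure, ENNReal.toReal_inv,
    ENNReal.toReal_ofReal Real.pi_pos.le, Complex.real_smul]
  simp

theorem integral_quasihomogeneous (k : ℤ) (φ : ℝ → ℂ) :
    ∫ w, quasihomogeneous k φ w ∂diskMeasure =
      if k = 0 then 2 * ∫ r in Ioo (0 : ℝ) 1, φ r * (r : ℂ) else 0 := by
  have hms : MeasurableSet (Ioo (0 : ℝ) 1 ×ˢ Ioo (-π) π) := measurableSet_Ioo.prod measurableSet_Ioo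
  have key : ∫ w in Metric.ball 0 1, quasihomogeneous k φ w =
      (∫ r in Ioo (0 : ℝ) 1, φ r * (r : ℂ)) *
        ∫ θ in Ioo (-π) π, Complex.exp (Complex.I * k * θ) := by
    rw [← integral_indicator measurableSet_ball, ← Complex.integral_comp_polarCoord_symm,
      ← setIntegral_prod_mul, ← Measure.volume_eq_prod,
      ← inter_eq_left.mpr Ioo_prod_subset_target, inter_comm, ← setIntegral_indicator hms]
    refine setIntegral_congr_fun polarCoord.open_target.measurableSet (fun p hp => ?_)
    by_cases hb : p ∈ Ioo (0 : ℝ) 1 ×ˢ Ioo (-π) π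
    · rw [indicator_of_mem hb, indicator_of_mem ((polarCoord_symm_mem_ball_iff hp).2 hb),
        quasihomogeneous_polarCoord_symm k φ hp, Complex.real_smul]
      ring
    · rw [indicator_of_notMem hb,
        indicator_of_notMem (mt (polarCoord_symm_mem_ball_iff hp).1 hb), smul_zero]
  have hpi : (π : ℂ) ≠ 0 := by exact_mod_cast Real.pi_ne_zero
  rw [integral_diskMeasure, key, integral_exp_int_mul]
  split_ifs
  · field_simp
  · simp

theorem ae_mem_ball : ∀ᵐ w ∂diskMeasure, w ∈ Metric.ball (0 : ℂ) 1 :=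
  Measure.ae_smul_measure (ae_restrict_mem measurableSet_ball) _

theorem norm_mul_exp_I_mul_arg (w : ℂ) : (‖w‖ : ℂ) * Complex.exp (Complex.I * w.arg) = w := by
  rw [mul_comm Complex.I]
  exact Complex.norm_mul_exp_arg_mul_I w

theorem pow_eq_quasihomogeneous (n : ℕ) (w : ℂ) :
    w ^ n = quasihomogeneous n (fun r => (r : ℂ) ^ n) w := by
  conv_lhs => rw [← norm_mul_exp_I_mul_arg w, mul_pow, ← Complex.exp_nat_mul]
  simp only [quasihomogeneous, Int.cast_natCast]
  ring_nf

theorem conj_pow_eq_quasihomogeneous (n : ℕ) (w : ℂ) :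
    conj w ^ n = quasihomogeneous (-n) (fun r => (r : ℂ) ^ n) w := by
  rw [← map_pow, pow_eq_quasihomogeneous]
  simp only [quasihomogeneous, Int.cast_natCast, map_mul, ← Complex.exp_conj, map_pow,
    Complex.conj_ofReal, Complex.conj_I, map_natCast]
  push_cast
  ring_nf

theorem quasihomogeneous_mul (k l : ℤ) (φ ψ : ℝ → ℂ) (w : ℂ) :
    quasihomogeneous k φ w * quasihomogeneous l ψ w =
      quasihomogeneous (k + l) (fun r => φ r * ψ r) w := by
  simp only [quasihomogeneous]
  rw [mul_mul_mul_comm, ← Complex.exp_add]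
  push_cast
  ring_nf

theorem radial_eq_quasihomogeneous (φ : ℝ → ℂ) : radial φ = quasihomogeneous 0 φ := by
  ext w
  simp [radial, quasihomogeneous]

/-- A radial profile is integrable for the area measure of the disk. -/
def IntegrableProfile (φ : ℝ → ℂ) : Prop :=
  IntegrableOn (fun r => φ r * (r : ℂ)) (Ioo (0 : ℝ) 1)

theorem IntegrableProfile.integrable {φ : ℝ → ℂ} (h : IntegrableProfile φ) (k : ℤ) :
    Integrable (quasihomogeneous k φ) diskMeasure :=
  (integrable_quasihomogeneous_iff k φ).2 h

theorem integrableProfile_of_integrable_radial {φ : ℝ → ℂ} (h : Integrable (radial φ) diskMeasure) :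
    IntegrableProfile φ := by
  rw [radial_eq_quasihomogeneous] at h
  exact (integrable_quasihomogeneous_iff 0 φ).1 h

/-- The polar formula applied to `|φ|` gives integral zero over the disk. This moves the hypothesis
that the symbol is nonzero from the disk to the profile. -/
theorem radial_ae_eq_zero {φ : ℝ → ℂ} (h : ∀ᵐ r ∂(volume.restrict (Ioo (0 : ℝ) 1)), φ r = 0) :
    radial φ =ᵐ[diskMeasure] 0 := by
  have hφ : IntegrableProfile fun r => (‖φ r‖ : ℂ) := by
    refine (integrable_zero ℝ ℂ _).congr ?_
    filter_upwards [h] with r hr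
    simp [hr]
  have h1 : Integrable (fun w => ‖radial φ w‖) diskMeasure := by
    have := (hφ.integrable 0).norm
    rw [← radial_eq_quasihomogeneous] at this
    simpa [radial] using this
  have h2 : ∫ w, ‖radial φ w‖ ∂diskMeasure = 0 := by
    have := integral_quasihomogeneous 0 fun r => (‖φ r‖ : ℂ)
    have h0 : ∫ r in Ioo (0 : ℝ) 1, (‖φ r‖ : ℂ) * (r : ℂ) = 0 := by
      refine integral_eq_zero_of_ae ?_
      filter_upwards [h] with r hr
      simp [hr]
    rw [← radial_eq_quasihomogeneous, if_pos rfl, h0, mul_zero] at this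
    have h3 := integral_ofReal (𝕜 := ℂ) (μ := diskMeasure) (f := fun w => ‖radial φ w‖)
    rw [← Complex.ofReal_inj, Complex.ofReal_zero]
    exact h3.symm.trans this
  have h3 := (integral_eq_zero_iff_of_nonneg (fun w => norm_nonneg _) h1).1 h2
  filter_upwards [h3] with w hw
  simpa using hw

theorem IntegrableProfile.mul_pow {φ : ℝ → ℂ} (h : IntegrableProfile φ) (n : ℕ) :
    IntegrableProfile fun r => φ r * (r : ℂ) ^ n := by
  have h1 : IntegrableOn (fun r : ℝ => (r : ℂ) ^ n * (φ r * (r : ℂ))) (Ioo (0 : ℝ) 1) := by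
    refine Integrable.bdd_mul (c := 1) h (by fun_prop) ?_
    filter_upwards [ae_restrict_mem measurableSet_Ioo] with r hr
    rw [norm_pow, Complex.norm_real, Real.norm_of_nonneg hr.1.le]
    exact pow_le_one₀ hr.1.le hr.2.le
  refine h1.congr (ae_of_all _ fun r => ?_)
  simp only
  ring

/-! ### Projections of quasihomogeneous functions -/

theorem hasSum_bergmanKernel {z w : ℂ} (hz : ‖z‖ < 1) (hw : ‖w‖ < 1) :
    HasSum (fun j : ℕ => ((j : ℂ) + 1) * z ^ j * conj w ^ j) (1 / (1 - z * conj w) ^ 2) := by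
  have h1 : ‖z * conj w‖ < 1 := by
    rw [norm_mul, RCLike.norm_conj]
    nlinarith [norm_nonneg z, norm_nonneg w]
  have := hasSum_choose_mul_geometric_of_norm_lt_one 1 h1
  simpa [mul_pow, mul_assoc] using this

theorem integral_conj_pow_mul_quasihomogeneous (j : ℕ) (l : ℤ) (φ : ℝ → ℂ) :
    ∫ w, conj w ^ j * quasihomogeneous l φ w ∂diskMeasure =
      if l = j then 2 * ∫ r in Ioo (0 : ℝ) 1, φ r * (r : ℂ) ^ (j + 1) else 0 := by
  simp only [conj_pow_eq_quasihomogeneous, quasihomogeneous_mul]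
  rw [integral_quasihomogeneous]
  have : (-(j : ℤ) + l = 0) ↔ l = j := by omega
  simp only [this, pow_succ]
  congr 3
  ext r
  ring

/-- Expand the kernel in powers of `z * conj w`. The `L¹` norms of the terms are dominated by a
convergent series in `(j+1)|z|^j`, so sum and integral commute, and integration over the angle keeps
only the term `j = l`. -/
theorem bergmanProj_quasihomogeneous {φ : ℝ → ℂ} (h : IntegrableProfile φ) (l : ℤ) {z : ℂ}
    (hz : ‖z‖ < 1) :
    bergmanProj (quasihomogeneous l φ) z =
      if 0 ≤ l then 2 * (l + 1) * (∫ r in Ioo (0 : ℝ) 1, φ r * (r : ℂ) ^ (l.toNat + 1)) *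
        z ^ l.toNat else 0 := by
  set F : ℕ → ℂ → ℂ := fun j w => ((j : ℂ) + 1) * z ^ j * (conj w ^ j * quasihomogeneous l φ w)
  have hint : ∀ j, Integrable (F j) diskMeasure := by
    intro j
    refine Integrable.const_mul ?_ _
    simp only [conj_pow_eq_quasihomogeneous, quasihomogeneous_mul]
    refine IntegrableProfile.integrable ?_ _
    simpa only [mul_comm] using h.mul_pow j
  have hbd : ∀ j, ∫ w, ‖F j w‖ ∂diskMeasure ≤
      ((j : ℝ) + 1) * ‖z‖ ^ j * ∫ w, ‖quasihomogeneous l φ w‖ ∂diskMeasure := by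
    intro j
    rw [← integral_const_mul]
    refine integral_mono_ae (hint j).norm ((h.integrable l).norm.const_mul _) ?_
    filter_upwards [ae_mem_ball] with w hw
    have hw1 : ‖w‖ ^ j ≤ 1 := pow_le_one₀ (norm_nonneg w) (mem_ball_zero_iff.1 hw).le
    have hj : ‖(j : ℂ) + 1‖ = (j : ℝ) + 1 := by
      exact_mod_cast Complex.norm_natCast (j + 1)
    simp only [F, norm_mul, norm_pow, RCLike.norm_conj, hj]
    gcongr
    exact mul_le_of_le_one_left (norm_nonneg _) hw1
  have hsum : Summable fun j => ∫ w, ‖F j w‖ ∂diskMeasure := by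
    refine Summable.of_nonneg_of_le (fun j => integral_nonneg fun w => norm_nonneg _) hbd ?_
    refine Summable.mul_right _ ?_
    have := (hasSum_choose_mul_geometric_of_norm_lt_one (𝕜 := ℝ) 1 (r := ‖z‖)
      (by simpa using hz)).summable
    simpa using this
  have h1 := hasSum_integral_of_summable_integral_norm hint hsum
  have h2 : ∫ w, ∑' j, F j w ∂diskMeasure = bergmanProj (quasihomogeneous l φ) z := by
    refine integral_congr_ae ?_
    filter_upwards [ae_mem_ball] with w hw
    have := (hasSum_bergmanKernel hz (mem_ball_zero_iff.1 hw)).mul_right (quasihomogeneous l φ w)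
    rw [← this.tsum_eq]
    simp only [F, mul_assoc]
  rw [h2] at h1
  have h3 : ∀ j, ∫ w, F j w ∂diskMeasure = if l = j then
      ((j : ℂ) + 1) * z ^ j * (2 * ∫ r in Ioo (0 : ℝ) 1, φ r * (r : ℂ) ^ (j + 1)) else 0 := by
    intro j
    simp only [F, integral_const_mul, integral_conj_pow_mul_quasihomogeneous, mul_ite, mul_zero]
  simp only [h3] at h1
  split_ifs with hl
  · lift l to ℕ using hl
    refine h1.unique ?_
    have h4 := hasSum_single (f := fun j : ℕ => if (l : ℤ) = j then ((j : ℂ) + 1) * z ^ j *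
      (2 * ∫ r in Ioo (0 : ℝ) 1, φ r * (r : ℂ) ^ (j + 1)) else 0) l
      (fun j hj => if_neg (by exact_mod_cast Ne.symm hj))
    rw [if_pos rfl] at h4
    rw [Int.toNat_natCast, Int.cast_natCast]
    have h5 : 2 * ((l : ℂ) + 1) * (∫ r in Ioo (0 : ℝ) 1, φ r * (r : ℂ) ^ (l + 1)) * z ^ l =
        ((l : ℂ) + 1) * z ^ l * (2 * ∫ r in Ioo (0 : ℝ) 1, φ r * (r : ℂ) ^ (l + 1)) := by ring
    rw [h5]
    exact h4
  · refine h1.unique ?_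
    have h4 : ∀ j : ℕ, l ≠ j := fun j => by omega
    simp only [h4, if_false]
    exact hasSum_zero

theorem mellinDisk_natCast_add_one (φ : ℝ → ℂ) (n : ℕ) :
    mellinDisk φ ((n : ℂ) + 1) = ∫ r in Ioo (0 : ℝ) 1, φ r * (r : ℂ) ^ n := by
  simp [mellinDisk]

/-- The coefficient of `z ^ (n + k)` in the image of `z ^ n` under the Toeplitz operator with
symbol `e^{ikθ} φ`. -/
def toeplitzCoeff (k : ℤ) (φ : ℝ → ℂ) (n : ℕ) : ℂ :=
  if 0 ≤ n + k then 2 * (n + k + 1) * mellinDisk φ (2 * n + k + 2) else 0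

theorem quasihomogeneous_mul_pow (k : ℤ) (φ : ℝ → ℂ) (n : ℕ) (w : ℂ) :
    quasihomogeneous k φ w * w ^ n =
      quasihomogeneous (n + k) (fun r => φ r * (r : ℂ) ^ n) w := by
  rw [pow_eq_quasihomogeneous, quasihomogeneous_mul, add_comm]

theorem bergmanProj_quasihomogeneous_mul_pow {φ : ℝ → ℂ} (h : IntegrableProfile φ) (k : ℤ) (n : ℕ)
    {z : ℂ} (hz : ‖z‖ < 1) :
    bergmanProj (fun w => quasihomogeneous k φ w * w ^ n) z =
      toeplitzCoeff k φ n * z ^ (n + k).toNat := by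
  simp only [quasihomogeneous_mul_pow]
  rw [bergmanProj_quasihomogeneous (h.mul_pow n) _ hz, toeplitzCoeff]
  split_ifs with hk
  · obtain ⟨m, hm⟩ := Int.eq_ofNat_of_zero_le hk
    have hc : ((n : ℂ) + k) = m := by exact_mod_cast congrArg (Int.cast : ℤ → ℂ) hm
    have : (2 * n + k + 2 : ℂ) = ((n + m + 1 : ℕ) : ℂ) + 1 := by
      push_cast
      linear_combination hc
    rw [this, mellinDisk_natCast_add_one, hm]
    have h4 : ∀ r : ℝ, φ r * (r : ℂ) ^ n * (r : ℂ) ^ (m + 1) = φ r * (r : ℂ) ^ (n + m + 1) := by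
      intro r
      ring
    simp only [Int.toNat_natCast, h4, Int.cast_natCast, hc]
  · simp

theorem bergmanProj_conj (f : ℂ → ℂ) (z : ℂ) :
    ∫ w, (1 / (1 - conj z * w) ^ 2) * f w ∂diskMeasure =
      conj (bergmanProj (fun w => conj (f w)) z) := by
  rw [bergmanProj, ← integral_conj]
  simp

theorem conj_quasihomogeneous (k : ℤ) (φ : ℝ → ℂ) (w : ℂ) :
    conj (quasihomogeneous k φ w) = quasihomogeneous (-k) (fun r => conj (φ r)) w := by
  simp only [quasihomogeneous, map_mul, ← Complex.exp_conj, Complex.conj_ofReal, Complex.conj_I,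
    map_intCast]
  push_cast
  ring_nf

theorem integrable_bergmanKernel_mul {f : ℂ → ℂ} (hf : Integrable f diskMeasure) {z : ℂ}
    (hz : ‖z‖ < 1) : Integrable (fun w => (1 / (1 - z * conj w) ^ 2) * f w) diskMeasure := by
  refine Integrable.bdd_mul (c := 1 / (1 - ‖z‖) ^ 2) hf ?_ ?_
  · refine Measurable.aestronglyMeasurable ?_
    fun_prop
  · filter_upwards [ae_mem_ball] with w hw
    rw [norm_div, norm_one, norm_pow]
    have h1 : 1 - ‖z‖ ≤ ‖1 - z * conj w‖ := by
      have := norm_sub_norm_le (1 : ℂ) (z * conj w)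
      rw [norm_one, norm_mul, RCLike.norm_conj] at this
      nlinarith [norm_nonneg z, (mem_ball_zero_iff.1 hw).le]
    have : 0 < 1 - ‖z‖ := by linarith
    gcongr

/-! ### Taylor coefficients as inner products with monomials -/

/-- On the smaller disk of radius `ρ` the power series is dominated by its absolutely convergent
value at `ρ`, so it may be integrated term by term. This domination need not persist up to the unit
circle; the full integral is recovered by dominated convergence as `ρ → 1`. -/
theorem integral_conj_pow_mul_of_norm_lt {g : ℂ → ℂ} {c : ℕ → ℂ}
    (hc : ∀ z ∈ Metric.ball (0 : ℂ) 1, HasSum (fun j => c j * z ^ j) (g z)) (n : ℕ) {ρ : ℝ}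
    (hρ : ρ ∈ Ioo (0 : ℝ) 1) :
    ∫ w, (if ‖w‖ < ρ then conj w ^ n * g w else 0) ∂diskMeasure =
      c n * (ρ : ℂ) ^ (2 * n + 2) / (n + 1) := by
  set ψ : ℕ → ℝ → ℂ := fun j r => if r < ρ then (r : ℂ) ^ (j + n) else 0
  set F : ℕ → ℂ → ℂ := fun j w => c j * quasihomogeneous (j - n) (ψ j) w with hF
  have hFeq : ∀ j w, F j w = if ‖w‖ < ρ then conj w ^ n * (c j * w ^ j) else 0 := by
    intro j w
    rw [mul_left_comm, conj_pow_eq_quasihomogeneous, pow_eq_quasihomogeneous,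
      quasihomogeneous_mul, hF]
    simp only [quasihomogeneous, ψ]
    split_ifs
    · push_cast
      ring_nf
    · simp
  have hψ : ∀ j, ∫ r in Ioo (0 : ℝ) 1, ψ j r * (r : ℂ) =
      (ρ : ℂ) ^ (j + n + 2) / (j + n + 2) := by
    intro j
    have h1 : ∀ r : ℝ, ψ j r * (r : ℂ) = (Iio ρ).indicator (fun r : ℝ => (r : ℂ) ^ (j + n + 1)) r := by
      intro r
      simp only [ψ, indicator, mem_Iio]
      split_ifs <;> ring
    simp only [h1]
    rw [setIntegral_indicator measurableSet_Iio, Ioo_inter_Iio, min_eq_right hρ.2.le,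
      ← integral_Ioc_eq_integral_Ioo, ← intervalIntegral.integral_of_le hρ.1.le]
    have h2 : ∀ r : ℝ, (r : ℂ) ^ (j + n + 1) = ((r ^ (j + n + 1) : ℝ) : ℂ) := by simp
    simp only [h2]
    rw [intervalIntegral.integral_ofReal, integral_pow]
    push_cast
    simp
    ring_nf
  have hsummable : Summable fun j => ‖c j‖ * ρ ^ j := by
    have := (hc ρ (by simpa [abs_of_pos hρ.1] using hρ.2)).summable.norm
    simpa [abs_of_pos hρ.1] using this
  have hle : ∀ j, ∀ᵐ w ∂diskMeasure, ‖F j w‖ ≤ ‖c j‖ * ρ ^ j := by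
    intro j
    filter_upwards [ae_mem_ball] with w hw
    rw [hFeq]
    split_ifs with h
    · have hw1 : ‖w‖ ^ n ≤ 1 := pow_le_one₀ (norm_nonneg w) (mem_ball_zero_iff.1 hw).le
      rw [norm_mul, norm_mul, norm_pow, norm_pow, RCLike.norm_conj]
      calc _ ≤ 1 * (‖c j‖ * ‖w‖ ^ j) := by gcongr
        _ ≤ _ := by rw [one_mul]; gcongr
    · rw [norm_zero]
      have := hρ.1
      positivity
  have hmeas : ∀ j, AEStronglyMeasurable (F j) diskMeasure := by
    intro j
    rw [funext (hFeq j)]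
    refine Measurable.aestronglyMeasurable (Measurable.ite ?_ ?_ ?_)
    · exact measurableSet_lt (by fun_prop) (by fun_prop)
    · fun_prop
    · fun_prop
  have hint : ∀ j, Integrable (F j) diskMeasure := fun j =>
    Integrable.of_bound (hmeas j) _ (hle j)
  have hsum : Summable fun j => ∫ w, ‖F j w‖ ∂diskMeasure := by
    refine Summable.of_nonneg_of_le (fun j => integral_nonneg fun w => norm_nonneg _) (fun j => ?_)
      (hsummable.mul_left (diskMeasure.real univ))
    calc _ ≤ ∫ w, ‖c j‖ * ρ ^ j ∂diskMeasure :=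
          integral_mono_ae (hint j).norm (integrable_const _) (hle j)
      _ = _ := by rw [integral_const, smul_eq_mul]
  have h1 := hasSum_integral_of_summable_integral_norm hint hsum
  have h2 : ∫ w, ∑' j, F j w ∂diskMeasure =
      ∫ w, (if ‖w‖ < ρ then conj w ^ n * g w else 0) ∂diskMeasure := by
    refine integral_congr_ae ?_
    filter_upwards [ae_mem_ball] with w hw
    simp only [hFeq]
    split_ifs
    · exact ((hc w hw).mul_left _).tsum_eq
    · exact tsum_zero
  rw [h2] at h1
  have h3 : ∀ j ≠ n, ∫ w, F j w ∂diskMeasure = 0 := by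
    intro j hj
    simp only [F]
    rw [integral_const_mul, integral_quasihomogeneous, if_neg (by omega), mul_zero]
  rw [← (hasSum_single n h3).unique h1]
  simp only [F]
  rw [integral_const_mul, integral_quasihomogeneous, if_pos (by ring), hψ]
  have : (n : ℂ) + 1 ≠ 0 := by exact_mod_cast Nat.succ_ne_zero n
  have h4 : (n : ℂ) + n + 2 ≠ 0 := by
    have : (n : ℂ) + n + 2 = 2 * (n + 1) := by ring
    rw [this]
    exact mul_ne_zero two_ne_zero ‹_›
  rw [mul_div_assoc, show (n : ℂ) + n + 2 = 2 * (n + 1) by ring]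
  field_simp
  ring

theorem integral_conj_pow_mul_eq {g : ℂ → ℂ} {c : ℕ → ℂ}
    (hc : ∀ z ∈ Metric.ball (0 : ℂ) 1, HasSum (fun j => c j * z ^ j) (g z))
    (hg : Integrable g diskMeasure) (n : ℕ) :
    ∫ w, conj w ^ n * g w ∂diskMeasure = c n / (n + 1) := by
  have hgn : Integrable (fun w => conj w ^ n * g w) diskMeasure := by
    refine Integrable.bdd_mul (c := 1) hg ?_ ?_
    · exact Measurable.aestronglyMeasurable (by fun_prop)
    · filter_upwards [ae_mem_ball] with w hw
      rw [norm_pow, RCLike.norm_conj]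
      exact pow_le_one₀ (norm_nonneg w) (mem_ball_zero_iff.1 hw).le
  have h1 : Tendsto (fun ρ : ℝ => ∫ w, (if ‖w‖ < ρ then conj w ^ n * g w else 0) ∂diskMeasure)
      (𝓝[<] 1) (𝓝 (∫ w, conj w ^ n * g w ∂diskMeasure)) := by
    refine tendsto_integral_filter_of_dominated_convergence _ ?_ ?_ hgn.norm ?_
    · refine Eventually.of_forall fun ρ => ?_
      have hm : MeasurableSet {w : ℂ | ‖w‖ < ρ} := measurableSet_lt (by fun_prop) (by fun_prop)
      exact (hgn.aestronglyMeasurable.indicator hm).congr (ae_of_all _ fun w => by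
        simp [indicator])
    · refine Eventually.of_forall fun ρ => ae_of_all _ fun w => ?_
      split_ifs
      · exact le_rfl
      · rw [norm_zero]
        exact norm_nonneg _
    · filter_upwards [ae_mem_ball] with w hw
      refine tendsto_const_nhds.congr' ?_
      have : Ioo ‖w‖ 1 ∈ 𝓝[<] (1 : ℝ) := Ioo_mem_nhdsLT (mem_ball_zero_iff.1 hw)
      filter_upwards [this] with ρ hρ
      rw [if_pos hρ.1]
  have h2 : Tendsto (fun ρ : ℝ => c n * (ρ : ℂ) ^ (2 * n + 2) / (n + 1)) (𝓝[<] 1)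
      (𝓝 (c n / (n + 1))) := by
    have : Continuous fun ρ : ℝ => c n * (ρ : ℂ) ^ (2 * n + 2) / (n + 1) := by fun_prop
    have := this.tendsto 1
    simp only [Complex.ofReal_one, one_pow, mul_one] at this
    exact this.mono_left nhdsWithin_le_nhds
  refine tendsto_nhds_unique h1 (h2.congr' ?_)
  filter_upwards [Ioo_mem_nhdsLT (zero_lt_one' ℝ)] with ρ hρ
  rw [integral_conj_pow_mul_of_norm_lt hc n hρ]

theorem exists_hasSum_of_differentiableOn {g : ℂ → ℂ}
    (hg : DifferentiableOn ℂ g (Metric.ball 0 1)) :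
    ∃ c : ℕ → ℂ, ∀ z ∈ Metric.ball (0 : ℂ) 1, HasSum (fun j => c j * z ^ j) (g z) := by
  refine ⟨fun j => (j.factorial : ℂ)⁻¹ * iteratedDeriv j g 0, fun z hz => ?_⟩
  have := Complex.hasSum_taylorSeries_on_ball (r := 1) (c := 0) hg hz
  simpa [mul_assoc, mul_comm, mul_left_comm] using this

theorem inner_bergmanPow (n : ℕ) (f : bergmanSpace) {c : ℕ → ℂ} {g : ℂ → ℂ}
    (hc : ∀ z ∈ Metric.ball (0 : ℂ) 1, HasSum (fun j => c j * z ^ j) (g z))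
    (hf : (f : Lp ℂ 2 diskMeasure) =ᵐ[diskMeasure] g) :
    inner ℂ (bergmanPow n) f = c n / (n + 1) := by
  have hg : Integrable g diskMeasure :=
    ((Lp.memLp (f : Lp ℂ 2 diskMeasure)).integrable (by norm_num)).congr hf
  rw [← integral_conj_pow_mul_eq hc hg n, Submodule.coe_inner, L2.inner_def]
  refine integral_congr_ae ?_
  filter_upwards [hf, (memLp_pow n).coeFn_toLp] with w h1 h2
  rw [h1, RCLike.inner_apply', bergmanPow, h2, map_pow]

theorem coe_bergmanPow_ae (n : ℕ) :
    (bergmanPow n : Lp ℂ 2 diskMeasure) =ᵐ[diskMeasure] fun z => z ^ n :=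
  (memLp_pow n).coeFn_toLp

theorem inner_bergmanPow_bergmanPow (n m : ℕ) :
    inner ℂ (bergmanPow n) (bergmanPow m) = if n = m then 1 / ((n : ℂ) + 1) else 0 := by
  rw [inner_bergmanPow n (bergmanPow m) (c := fun j => if j = m then 1 else 0)
    (g := fun z => z ^ m) ?_ (coe_bergmanPow_ae m)]
  · split_ifs <;> simp
  · intro z _
    have := hasSum_single (f := fun j => (if j = m then (1 : ℂ) else 0) * z ^ j) m
      (fun j hj => by simp [hj])
    simpa using this

theorem eq_zero_of_inner_bergmanPow_eq_zero {f : bergmanSpace}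
    (h : ∀ n, inner ℂ (bergmanPow n) f = 0) : f = 0 := by
  obtain ⟨g, hg, hfg⟩ := f.2
  obtain ⟨c, hc⟩ := exists_hasSum_of_differentiableOn hg
  have hc0 : ∀ n, c n = 0 := by
    intro n
    have h1 := h n
    rw [inner_bergmanPow n f hc hfg, div_eq_zero_iff] at h1
    exact h1.resolve_right (by exact_mod_cast Nat.succ_ne_zero n)
  refine Subtype.ext (Lp.ext ?_)
  refine (hfg.trans ?_).trans (Lp.coeFn_zero ℂ 2 diskMeasure).symm
  filter_upwards [ae_mem_ball] with z hz
  have := hc z hz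
  simp only [hc0, zero_mul] at this
  exact this.unique hasSum_zero

/-! ### Orthonormal basis and completeness of the Bergman space -/

/-- The normalized monomial `√(n + 1) z ^ n`. -/
def bergmanUnit (n : ℕ) : bergmanSpace := (√(n + 1 : ℝ) : ℂ) • bergmanPow n

theorem inner_bergmanUnit_left (n : ℕ) (f : bergmanSpace) :
    inner ℂ (bergmanUnit n) f = (√(n + 1 : ℝ) : ℂ) * inner ℂ (bergmanPow n) f := by
  rw [Submodule.coe_inner, bergmanUnit, Submodule.coe_smul, inner_smul_left, Complex.conj_ofReal,
    Submodule.coe_inner]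

theorem inner_bergmanUnit_right (n : ℕ) (f : bergmanSpace) :
    inner ℂ f (bergmanUnit n) = (√(n + 1 : ℝ) : ℂ) * inner ℂ f (bergmanPow n) := by
  rw [Submodule.coe_inner, bergmanUnit, Submodule.coe_smul, inner_smul_right, Submodule.coe_inner]

theorem ofReal_sqrt_add_one_ne_zero (n : ℕ) : (√(n + 1 : ℝ) : ℂ) ≠ 0 := by
  rw [Complex.ofReal_ne_zero]
  positivity

theorem inner_bergmanPow_eq_zero_of_inner_bergmanUnit {n : ℕ} {f : bergmanSpace}
    (h : inner ℂ (bergmanUnit n) f = 0) : inner ℂ (bergmanPow n) f = 0 := by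
  rw [inner_bergmanUnit_left, mul_eq_zero] at h
  exact h.resolve_left (ofReal_sqrt_add_one_ne_zero n)

theorem orthonormal_bergmanUnit : Orthonormal ℂ bergmanUnit := by
  rw [orthonormal_iff_ite]
  intro n m
  rw [inner_bergmanUnit_left, inner_bergmanUnit_right, inner_bergmanPow_bergmanPow]
  split_ifs with h
  · subst h
    rw [← mul_assoc, ← Complex.ofReal_mul, Real.mul_self_sqrt (by positivity)]
    have : (n : ℂ) + 1 ≠ 0 := by exact_mod_cast Nat.succ_ne_zero n
    push_cast
    field_simp
  · simp

theorem differentiableOn_tsum_mul_pow {c : ℕ → ℂ} {C : ℝ} (hc : ∀ n, ‖c n‖ ≤ C * (n + 1)) :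
    (∀ z ∈ Metric.ball (0 : ℂ) 1, Summable fun n => c n * z ^ n) ∧
      DifferentiableOn ℂ (fun z => ∑' n, c n * z ^ n) (Metric.ball 0 1) := by
  have hs : ∀ r ∈ Ioo (0 : ℝ) 1, Summable fun n : ℕ => C * (n + 1) * r ^ n := by
    intro r hr
    have := (hasSum_choose_mul_geometric_of_norm_lt_one (𝕜 := ℝ) 1 (r := r)
      (by simpa [abs_of_pos hr.1] using hr.2)).summable.mul_left C
    simpa [mul_assoc] using this
  have hb : ∀ r ∈ Ioo (0 : ℝ) 1, ∀ n, ∀ z ∈ Metric.ball (0 : ℂ) r,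
      ‖c n * z ^ n‖ ≤ C * (n + 1) * r ^ n := by
    intro r hr n z hz
    rw [norm_mul, norm_pow]
    have h1 := hc n
    have h2 := (norm_nonneg _).trans h1
    gcongr
    exact (mem_ball_zero_iff.1 hz).le
  have hex : ∀ z ∈ Metric.ball (0 : ℂ) 1, ∃ r ∈ Ioo (0 : ℝ) 1, z ∈ Metric.ball (0 : ℂ) r := by
    intro z hz
    rw [mem_ball_zero_iff] at hz
    obtain ⟨r, h1, h2⟩ := exists_between hz
    exact ⟨r, ⟨(norm_nonneg z).trans_lt h1, h2⟩, mem_ball_zero_iff.2 h1⟩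
  constructor
  · intro z hz
    obtain ⟨r, hr, hzr⟩ := hex z hz
    exact Summable.of_norm_bounded (hs r hr) fun n => hb r hr n z hzr
  · intro z hz
    obtain ⟨r, hr, hzr⟩ := hex z hz
    have := Complex.differentiableOn_tsum_of_summable_norm (hs r hr)
      (F := fun n z => c n * z ^ n) (fun n => by fun_prop) Metric.isOpen_ball (hb r hr)
    exact (this.differentiableAt (Metric.isOpen_ball.mem_nhds hzr)).differentiableWithinAt

/-- The partial sums converge to `S` almost everywhere along a subsequence. They also converge
pointwise to a holomorphic power series, whose coefficients `x n * √(n+1)` grow at most linearly.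
The two limits agree. -/
theorem mem_bergmanSpace_of_hasSum {x : ℕ → ℂ} {C : ℝ} (hx : ∀ n, ‖x n‖ ≤ C)
    {S : Lp ℂ 2 diskMeasure}
    (hS : HasSum (fun n => x n • (bergmanUnit n : Lp ℂ 2 diskMeasure)) S) :
    S ∈ bergmanSpace := by
  set c : ℕ → ℂ := fun n => x n * √(n + 1 : ℝ)
  have hc : ∀ n, ‖c n‖ ≤ C * (n + 1) := by
    intro n
    have h1 := hx n
    have h2 := (norm_nonneg _).trans h1
    have h3 : √(n + 1 : ℝ) ≤ n + 1 := by
      rw [Real.sqrt_le_left (by positivity)]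
      nlinarith [(Nat.cast_nonneg n : (0 : ℝ) ≤ n)]
    rw [norm_mul, Complex.norm_real, Real.norm_of_nonneg (Real.sqrt_nonneg _)]
    gcongr
  obtain ⟨hsum, hdiff⟩ := differentiableOn_tsum_mul_pow hc
  refine ⟨_, hdiff, ?_⟩
  obtain ⟨ns, hns, hae⟩ := (tendstoInMeasure_of_tendsto_Lp hS.tendsto_sum_nat).exists_seq_tendsto_ae
  have hpart : ∀ N : ℕ, ((∑ n ∈ Finset.range N, x n • (bergmanUnit n : Lp ℂ 2 diskMeasure) :
      Lp ℂ 2 diskMeasure) : ℂ → ℂ) =ᵐ[diskMeasure] fun z => ∑ n ∈ Finset.range N, c n * z ^ n := by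
    intro N
    induction N with
    | zero =>
      simp only [Finset.range_zero, Finset.sum_empty]
      exact Lp.coeFn_zero ℂ 2 diskMeasure
    | succ N ih =>
      rw [Finset.sum_range_succ]
      have h1 : (x N • (bergmanUnit N : Lp ℂ 2 diskMeasure)) =
          c N • (bergmanPow N : Lp ℂ 2 diskMeasure) := by
        rw [bergmanUnit, Submodule.coe_smul, smul_smul]
      rw [h1]
      filter_upwards [ih, Lp.coeFn_add (∑ n ∈ Finset.range N,
        x n • (bergmanUnit n : Lp ℂ 2 diskMeasure)) (c N • (bergmanPow N : Lp ℂ 2 diskMeasure)),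
        Lp.coeFn_smul (c N) (bergmanPow N : Lp ℂ 2 diskMeasure), coe_bergmanPow_ae N]
        with z h1 h2 h3 h4
      rw [h2, Pi.add_apply, h1, h3, Pi.smul_apply, h4, Finset.sum_range_succ, smul_eq_mul]
  filter_upwards [hae, ae_all_iff.2 hpart, ae_mem_ball] with z h1 h2 h3
  simp only [h2] at h1
  exact tendsto_nhds_unique h1 ((hsum z h3).hasSum.tendsto_sum_nat.comp hns.tendsto_atTop)

/-- The Hilbert sums of the normalized monomials are the isometric image of `ℓ²`, hence closed, and
they lie in the Bergman space. A Bergman function orthogonal to them has zero Taylor series, so the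
two spaces coincide. -/
instance : CompleteSpace bergmanSpace := by
  have ho : Orthonormal ℂ fun n => (bergmanUnit n : Lp ℂ 2 diskMeasure) :=
    orthonormal_bergmanUnit.comp_linearIsometry bergmanSpace.subtypeₗᵢ
  set V := ho.orthogonalFamily.linearIsometry
  have hV : IsClosed (LinearMap.range V.toLinearMap : Set (Lp ℂ 2 diskMeasure)) :=
    V.isometry.isClosedEmbedding.isClosed_range
  suffices bergmanSpace = LinearMap.range V.toLinearMap by
    have hcl : IsClosed (bergmanSpace : Set (Lp ℂ 2 diskMeasure)) := by rw [this]; exact hV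
    exact hcl.completeSpace_coe
  have hle : LinearMap.range V.toLinearMap ≤ bergmanSpace := by
    rintro _ ⟨x, rfl⟩
    have h1 := ho.orthogonalFamily.hasSum_linearIsometry x
    refine mem_bergmanSpace_of_hasSum (x := fun n => x n) (C := ‖x‖)
      (fun n => lp.norm_apply_le_norm (by simp) x n) ?_
    simpa using h1
  refine le_antisymm (fun f hf => ?_) hle
  have : CompleteSpace (LinearMap.range V.toLinearMap) := hV.completeSpace_coe
  obtain ⟨y, hy, z, hz, hyz⟩ := (LinearMap.range V.toLinearMap).exists_add_mem_mem_orthogonal f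
  have hzb : z ∈ bergmanSpace := by
    have : z = f - y := by rw [hyz]; abel
    rw [this]
    exact sub_mem hf (hle hy)
  have hz0 : (⟨z, hzb⟩ : bergmanSpace) = 0 := by
    refine eq_zero_of_inner_bergmanPow_eq_zero fun n => ?_
    have h1 : (bergmanUnit n : Lp ℂ 2 diskMeasure) ∈ LinearMap.range V.toLinearMap :=
      ⟨lp.single 2 n 1, (ho.orthogonalFamily.linearIsometry_apply_single (i := n) (1 : ℂ)).trans
        (by rw [LinearIsometry.toSpanSingleton_apply, one_smul])⟩
    exact inner_bergmanPow_eq_zero_of_inner_bergmanUnit (hz _ h1)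
  have : z = 0 := congrArg Subtype.val hz0
  rw [hyz, this, add_zero]
  exact hy

/-- The normalized monomials form a Hilbert basis of the Bergman space. -/
def bergmanBasis : HilbertBasis ℕ ℂ bergmanSpace :=
  HilbertBasis.mkOfOrthogonalEqBot orthonormal_bergmanUnit (by
    rw [Submodule.eq_bot_iff]
    intro f hf
    refine eq_zero_of_inner_bergmanPow_eq_zero fun n => ?_
    exact inner_bergmanPow_eq_zero_of_inner_bergmanUnit
      (hf _ (Submodule.subset_span (mem_range_self n))))

theorem bergmanBasis_apply (n : ℕ) : bergmanBasis n = bergmanUnit n := by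
  rw [bergmanBasis, HilbertBasis.coe_mkOfOrthogonalEqBot]

/-! ### Weighted shifts with bounded weights -/

theorem sum_norm_sq_shift_le (k : ℤ) {a : ℕ → ℂ} {C : ℝ} (ha : ∀ n, ‖a n‖ ≤ C)
    (x : lp (fun _ : ℕ => ℂ) 2) (s : Finset ℕ) :
    ∑ j ∈ s, ‖(if 0 ≤ (j : ℤ) - k then a (j - k : ℤ).toNat * x (j - k : ℤ).toNat else 0 : ℂ)‖ ^ 2 ≤
      (C * ‖x‖) ^ 2 := by
  have hC : 0 ≤ C := (norm_nonneg _).trans (ha 0)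
  calc _ ≤ ∑ j ∈ s.filter fun j : ℕ => 0 ≤ (j : ℤ) - k, C ^ 2 * ‖x ((j : ℤ) - k).toNat‖ ^ 2 := by
        rw [Finset.sum_filter]
        refine Finset.sum_le_sum fun j _ => ?_
        split_ifs
        · rw [norm_mul, mul_pow]
          gcongr
          exact ha _
        · simp
    _ = ∑ n ∈ (s.filter fun j : ℕ => 0 ≤ (j : ℤ) - k).image fun j : ℕ => ((j : ℤ) - k).toNat,
          C ^ 2 * ‖x n‖ ^ 2 := by
        -- The truncation `toNat` is harmless: `j ↦ j - k` is injective on the indices with `j - k ≥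
        -- 0`.
        rw [Finset.sum_image]
        intro i hi j hj h
        simp only [Finset.coe_filter, mem_ofPred_eq] at hi hj
        simp only at h
        omega
    _ ≤ C ^ 2 * ‖x‖ ^ 2 := by
        rw [← Finset.mul_sum]
        gcongr
        have := lp.sum_rpow_le_norm_rpow (p := 2) (by simp) x
          ((s.filter fun j : ℕ => 0 ≤ (j : ℤ) - k).image fun j : ℕ => ((j : ℤ) - k).toNat)
        simpa using this
    _ = _ := by ring

/-- The weighted shift on `ℓ²` which maps the `n`-th basis vector to a multiple of the
`(n + k)`-th one. -/
def weightedShift (k : ℤ) {a : ℕ → ℂ} {C : ℝ} (ha : ∀ n, ‖a n‖ ≤ C) :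
    lp (fun _ : ℕ => ℂ) 2 →L[ℂ] lp (fun _ : ℕ => ℂ) 2 :=
  LinearMap.mkContinuous
    { toFun := fun x => ⟨fun j => if 0 ≤ (j : ℤ) - k then
          a (j - k : ℤ).toNat * x (j - k : ℤ).toNat else 0,
        memℓp_gen' (C := (C * ‖x‖) ^ 2) fun s => by
          simpa using sum_norm_sq_shift_le k ha x s⟩
      map_add' := fun x y => by
        ext j
        simp only [lp.coeFn_add, Pi.add_apply]
        split_ifs <;> ring
      map_smul' := fun c x => by
        ext j
        simp only [lp.coeFn_smul, Pi.smul_apply, smul_eq_mul, RingHom.id_apply]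
        split_ifs <;> ring }
    C fun x => lp.norm_le_of_forall_sum_le (by simp)
      (mul_nonneg ((norm_nonneg _).trans (ha 0)) (norm_nonneg _)) fun s => by
        simpa using sum_norm_sq_shift_le k ha x s

theorem weightedShift_apply (k : ℤ) {a : ℕ → ℂ} {C : ℝ} (ha : ∀ n, ‖a n‖ ≤ C)
    (x : lp (fun _ : ℕ => ℂ) 2) (j : ℕ) : weightedShift k ha x j =
      if 0 ≤ (j : ℤ) - k then a (j - k : ℤ).toNat * x (j - k : ℤ).toNat else 0 := rfl

theorem weightedShift_single (k : ℤ) {a : ℕ → ℂ} {C : ℝ} (ha : ∀ n, ‖a n‖ ≤ C) (n : ℕ) :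
    weightedShift k ha (lp.single 2 n 1) =
      if 0 ≤ (n : ℤ) + k then a n • lp.single 2 (n + k : ℤ).toNat 1 else 0 := by
  ext j
  rw [weightedShift_apply]
  split_ifs with h1 h2 h2
  · by_cases h : j = (n + k : ℤ).toNat
    · have h3 : ((j : ℤ) - k).toNat = n := by omega
      rw [h3, h]
      simp
    · have h3 : ((j : ℤ) - k).toNat ≠ n := by omega
      rw [lp.coeFn_smul, Pi.smul_apply]
      simp [lp.single_apply, h, h3]
  · have h3 : ((j : ℤ) - k).toNat ≠ n := by omega
    simp [lp.single_apply, h3]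
  · have h3 : j ≠ (n + k : ℤ).toNat := by omega
    rw [lp.coeFn_smul, Pi.smul_apply]
    simp [lp.single_apply, h3]
  · rfl

theorem exists_weightedShift_bergmanUnit (k : ℤ) {a : ℕ → ℂ} {C : ℝ} (ha : ∀ n, ‖a n‖ ≤ C) :
    ∃ T : bergmanSpace →L[ℂ] bergmanSpace, ∀ n, T (bergmanUnit n) =
      if 0 ≤ (n : ℤ) + k then a n • bergmanUnit (n + k : ℤ).toNat else 0 := by
  refine ⟨(bergmanBasis.repr.symm.toContinuousLinearEquiv : _ →L[ℂ] bergmanSpace) ∘L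
    weightedShift k ha ∘L (bergmanBasis.repr.toContinuousLinearEquiv : bergmanSpace →L[ℂ] _),
    fun n => ?_⟩
  have h1 : bergmanBasis.repr (bergmanUnit n) = lp.single 2 n 1 := by
    rw [← bergmanBasis_apply, bergmanBasis.repr_self]
  have h2 : ∀ m, bergmanBasis.repr.symm (lp.single 2 m 1) = bergmanUnit m := fun m => by
    rw [bergmanBasis.repr_symm_single, bergmanBasis_apply]
  change bergmanBasis.repr.symm (weightedShift k ha (bergmanBasis.repr (bergmanUnit n))) = _
  rw [h1, weightedShift_single]
  split_ifs
  · rw [map_smul, h2]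
  · exact map_zero _

theorem bergmanUnit_eq (n : ℕ) : bergmanUnit n = (√(n + 1 : ℝ) : ℂ) • bergmanPow n := rfl

theorem bergmanPow_eq (n : ℕ) : bergmanPow n = (√(n + 1 : ℝ) : ℂ)⁻¹ • bergmanUnit n := by
  rw [bergmanUnit_eq, smul_smul, inv_mul_cancel₀ (ofReal_sqrt_add_one_ne_zero n), one_smul]

/-- Normalizing the monomials multiplies the weight by `√((n+1)/(n+k+1))`, which is at most
`√(1+|k|)` when `n + k ≥ 0`. For `n + k < 0` the exponent is truncated to `0`, so the weight itself
has to vanish there. -/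
theorem exists_weightedShift_bergmanPow (k : ℤ) {a : ℕ → ℂ} {C : ℝ}
    (ha : ∀ n : ℕ, 0 ≤ (n : ℤ) + k → ‖a n‖ ≤ C) (ha0 : ∀ n : ℕ, (n : ℤ) + k < 0 → a n = 0) :
    ∃ T : bergmanSpace →L[ℂ] bergmanSpace, ∀ n,
      T (bergmanPow n) = a n • bergmanPow (n + k : ℤ).toNat := by
  set b : ℕ → ℂ := fun n => if 0 ≤ (n : ℤ) + k then
    a n * √(n + 1 : ℝ) / √(((n + k : ℤ).toNat : ℝ) + 1) else 0 with hb
  have hbC : ∀ n, ‖b n‖ ≤ |C| * √(1 + |(k : ℝ)|) := by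
    intro n
    simp only [hb]
    split_ifs with h
    · have h1 := (ha n h).trans (le_abs_self C)
      rw [mul_div_assoc, norm_mul, norm_div, Complex.norm_real, Complex.norm_real,
        Real.norm_of_nonneg (Real.sqrt_nonneg _), Real.norm_of_nonneg (Real.sqrt_nonneg _),
        ← Real.sqrt_div (by positivity)]
      gcongr
      rw [div_le_iff₀ (by positivity)]
      have h2 : (((n + k : ℤ).toNat : ℕ) : ℝ) = n + k := by
        have := Int.toNat_of_nonneg h
        exact_mod_cast congrArg (Int.cast : ℤ → ℝ) this
      have h3 : (0 : ℝ) ≤ n + k := by exact_mod_cast h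
      rw [h2]
      nlinarith [neg_abs_le (k : ℝ), abs_nonneg (k : ℝ)]
    · rw [norm_zero]
      positivity
  obtain ⟨T, hT⟩ := exists_weightedShift_bergmanUnit k hbC
  refine ⟨T, fun n => ?_⟩
  rw [bergmanPow_eq, map_smul, hT]
  split_ifs with h
  · simp only [hb]
    rw [if_pos h, bergmanUnit_eq, smul_smul, smul_smul]
    congr 1
    have h1 := ofReal_sqrt_add_one_ne_zero n
    have h2 := ofReal_sqrt_add_one_ne_zero (n + k : ℤ).toNat
    field_simp
  · rw [ha0 n (by omega), zero_smul, smul_zero]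

/-! ### Toeplitz operators on monomials -/

theorem bergman_clm_ext {A B : bergmanSpace →L[ℂ] bergmanSpace}
    (h : ∀ n, A (bergmanPow n) = B (bergmanPow n)) : A = B := by
  refine ContinuousLinearMap.ext_on (s := range bergmanUnit) ?_ ?_
  · have := bergmanBasis.dense_span
    rw [show (bergmanBasis : ℕ → bergmanSpace) = bergmanUnit from funext bergmanBasis_apply] at this
    rw [dense_iff_closure_eq, ← Submodule.topologicalClosure_coe, this, Submodule.top_coe]
  · rintro _ ⟨n, rfl⟩
    rw [bergmanUnit_eq, map_smul, map_smul, h]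

/-- The integral formula is linear in the polynomial because the kernel times an integrable function
is integrable for `|z| < 1`; monomials therefore determine everything. -/
theorem isBergmanToeplitz_iff {φ : ℝ → ℂ} (hφ : IntegrableProfile φ) (k : ℤ)
    (T : bergmanSpace →L[ℂ] bergmanSpace) :
    IsBergmanToeplitz (quasihomogeneous k φ) T ↔
      ∀ n, T (bergmanPow n) = toeplitzCoeff k φ n • bergmanPow (n + k).toNat := by
  have hcoe : ∀ n, ((toeplitzCoeff k φ n • bergmanPow (n + k).toNat : bergmanSpace) :
      Lp ℂ 2 diskMeasure) =ᵐ[diskMeasure] bergmanProj fun w => quasihomogeneous k φ w * w ^ n := by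
    intro n
    rw [Submodule.coe_smul]
    filter_upwards [ae_mem_ball, Lp.coeFn_smul (toeplitzCoeff k φ n)
      (bergmanPow (n + k).toNat : Lp ℂ 2 diskMeasure), coe_bergmanPow_ae (n + k).toNat]
      with z h1 h2 h3
    rw [h2, Pi.smul_apply, h3, bergmanProj_quasihomogeneous_mul_pow hφ k n (mem_ball_zero_iff.1 h1),
      smul_eq_mul]
  constructor
  · intro h n
    have h1 := h (X ^ n) (bergmanPow n) (by simpa using coe_bergmanPow_ae n)
    refine Subtype.ext (Lp.ext (h1.trans ?_))
    simpa using (hcoe n).symm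
  · intro h p f hf
    have hsum : ∀ (s : Finset ℕ) (c : ℕ → ℂ) (v : ℕ → bergmanSpace) (g : ℕ → ℂ → ℂ),
        (∀ n, (v n : Lp ℂ 2 diskMeasure) =ᵐ[diskMeasure] g n) →
        ((∑ n ∈ s, c n • v n : bergmanSpace) : Lp ℂ 2 diskMeasure) =ᵐ[diskMeasure]
          fun z => ∑ n ∈ s, c n * g n z := by
      intro s c v g hv
      induction s using Finset.induction_on with
      | empty =>
        simp only [Finset.sum_empty, Submodule.coe_zero]
        exact Lp.coeFn_zero ℂ 2 diskMeasure
      | insert i s hi ih =>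
        rw [Finset.sum_insert hi, Submodule.coe_add, Submodule.coe_smul]
        filter_upwards [ih, Lp.coeFn_add (c i • (v i : Lp ℂ 2 diskMeasure))
          ((∑ n ∈ s, c n • v n : bergmanSpace) : Lp ℂ 2 diskMeasure),
          Lp.coeFn_smul (c i) (v i : Lp ℂ 2 diskMeasure), hv i] with z h1 h2 h3 h4
        rw [h2, Pi.add_apply, h1, h3, Pi.smul_apply, h4, Finset.sum_insert hi, smul_eq_mul]
    have hf' : f = ∑ n ∈ p.support, p.coeff n • bergmanPow n := by
      refine Subtype.ext (Lp.ext (hf.trans ?_))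
      refine EventuallyEq.symm ((hsum _ _ _ _ coe_bergmanPow_ae).trans (ae_of_all _ fun z => ?_))
      simp only [Polynomial.eval_eq_sum, Polynomial.sum]
    rw [hf', map_sum]
    simp only [map_smul, h]
    refine (hsum _ _ _ _ hcoe).trans ?_
    filter_upwards [ae_mem_ball] with z hz
    have hint : ∀ n, Integrable (fun w => (1 / (1 - z * conj w) ^ 2) *
        (quasihomogeneous k φ w * w ^ n)) diskMeasure := by
      intro n
      refine integrable_bergmanKernel_mul ?_ (mem_ball_zero_iff.1 hz)
      simp only [quasihomogeneous_mul_pow]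
      exact (hφ.mul_pow n).integrable _
    simp only [bergmanProj]
    simp only [← integral_const_mul]
    rw [← integral_finsetSum _ fun n _ => (hint n).const_mul _]
    refine integral_congr_ae (ae_of_all _ fun w => ?_)
    simp only [Polynomial.eval_eq_sum, Polynomial.sum, Finset.mul_sum]
    refine Finset.sum_congr rfl fun n _ => ?_
    ring

/-- With `p = n + k` the weight is `2(p+1) φ̂((n+p)+2)`, and `p + 1` is at most a constant times `n
+ p + 1`, which is the factor in the moment bound. -/
theorem existsUnique_isBergmanToeplitz {φ : ℝ → ℂ} (hφ : IntegrableProfile φ) (k : ℤ) {C : ℝ}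
    (hC : ∀ n : ℕ, ‖((n : ℂ) + 1) * mellinDisk φ (n + 2)‖ ≤ C) :
    ∃! T, IsBergmanToeplitz (quasihomogeneous k φ) T := by
  have hb : ∀ n : ℕ, 0 ≤ (n : ℤ) + k → ‖toeplitzCoeff k φ n‖ ≤ (2 + |(k : ℝ)|) * C := by
    intro n hn
    obtain ⟨m, hm⟩ := Int.eq_ofNat_of_zero_le hn
    have hc : ((n : ℂ) + k) = m := by exact_mod_cast congrArg (Int.cast : ℤ → ℂ) hm
    have hr : ((n : ℝ) + k) = m := by exact_mod_cast congrArg (Int.cast : ℤ → ℝ) hm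
    rw [toeplitzCoeff, if_pos hn, hc, show (2 * n + k + 2 : ℂ) = ((n + m : ℕ) : ℂ) + 2 by
      push_cast; linear_combination hc]
    have h1 := hC (n + m)
    rw [norm_mul] at h1 ⊢
    have h2 : ‖(((n + m : ℕ) : ℂ) + 1)‖ = ((n + m : ℕ) : ℝ) + 1 := by
      exact_mod_cast Complex.norm_natCast (n + m + 1)
    have h3 : ‖(2 * ((m : ℂ) + 1))‖ = 2 * ((m : ℝ) + 1) := by
      exact_mod_cast Complex.norm_natCast (2 * (m + 1))
    rw [h2] at h1
    rw [h3]
    have h4 : 2 * ((m : ℝ) + 1) ≤ (2 + |(k : ℝ)|) * (((n + m : ℕ) : ℝ) + 1) := by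
      push_cast
      nlinarith [le_abs_self (k : ℝ), abs_nonneg (k : ℝ), (Nat.cast_nonneg n : (0 : ℝ) ≤ n),
        (Nat.cast_nonneg m : (0 : ℝ) ≤ m)]
    calc _ ≤ (2 + |(k : ℝ)|) * (((n + m : ℕ) : ℝ) + 1) *
          ‖mellinDisk φ (((n + m : ℕ) : ℂ) + 2)‖ := by gcongr
      _ ≤ _ := by
        rw [mul_assoc]
        gcongr
  obtain ⟨T, hT⟩ := exists_weightedShift_bergmanPow k hb fun n hn => if_neg (by omega)
  refine ⟨T, (isBergmanToeplitz_iff hφ k T).2 hT, fun T' hT' => bergman_clm_ext fun n => ?_⟩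
  rw [(isBergmanToeplitz_iff hφ k T').1 hT' n, hT n]

theorem bergmanToeplitz_bergmanPow {φ : ℝ → ℂ} (hφ : IntegrableProfile φ) {k : ℤ}
    (h : ∃! T, IsBergmanToeplitz (quasihomogeneous k φ) T) (n : ℕ) :
    bergmanToeplitz (quasihomogeneous k φ) (bergmanPow n) =
      toeplitzCoeff k φ n • bergmanPow (n + k).toNat := by
  rw [bergmanToeplitz, dif_pos h.exists]
  exact (isBergmanToeplitz_iff hφ k _).1 h.exists.choose_spec n

/-! ### Moment bounds for T-functions and powers -/

/-- The conjugate kernel sees only degrees at most `0`. For `n > 0` both sides vanish, and for `n =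
0` both are the mean. Consequently the last two terms in the kernel of `Q` cancel on nonnegative
degrees, where `Q` agrees with `P`. -/
theorem integral_quasihomogeneous_mul_bergmanKernel_conj {φ : ℝ → ℂ} (hφ : IntegrableProfile φ)
    (n : ℕ) {z : ℂ} (hz : ‖z‖ < 1) :
    ∫ w, (1 / (1 - conj z * w) ^ 2) * quasihomogeneous n φ w ∂diskMeasure =
      ∫ w, quasihomogeneous n φ w ∂diskMeasure := by
  have hconj : IntegrableProfile fun r => conj (φ r) := by
    refine (Complex.conjCLE.toContinuousLinearMap.integrable_comp hφ).congr (ae_of_all _ fun r => ?_)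
    simp
  rw [bergmanProj_conj]
  simp only [conj_quasihomogeneous]
  rw [bergmanProj_quasihomogeneous hconj _ hz, integral_quasihomogeneous]
  by_cases hn : n = 0
  · subst hn
    have h1 : ∫ r in Ioo (0 : ℝ) 1, conj (φ r) * (r : ℂ) =
        conj (∫ r in Ioo (0 : ℝ) 1, φ r * (r : ℂ)) := by
      rw [← integral_conj]
      simp
    have h2 : conj (2 : ℂ) = 2 := map_ofNat _ 2
    simp [h1, h2]
  · rw [if_neg (by omega), if_neg (by omega), map_zero]

theorem harmonicProj_quasihomogeneous {φ : ℝ → ℂ} (hφ : IntegrableProfile φ) (n : ℕ) {z : ℂ}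
    (hz : ‖z‖ < 1) :
    harmonicProj (quasihomogeneous n φ) z = bergmanProj (quasihomogeneous n φ) z := by
  have h1 := integrable_bergmanKernel_mul (hφ.integrable n) hz
  have h2 : Integrable (fun w => (1 / (1 - conj z * w) ^ 2) * quasihomogeneous n φ w)
      diskMeasure := by
    have hconj : Integrable (fun w => conj (quasihomogeneous n φ w)) diskMeasure := by
      refine (Complex.conjCLE.toContinuousLinearMap.integrable_comp (hφ.integrable n)).congr
        (ae_of_all _ fun r => ?_)
      simp
    have := integrable_bergmanKernel_mul hconj hz
    refine (Complex.conjCLE.toContinuousLinearMap.integrable_comp this).congr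
        (ae_of_all _ fun r => ?_)
    simp
  rw [harmonicProj]
  have h3 : ∀ w, (1 / (1 - z * conj w) ^ 2 + 1 / (1 - conj z * w) ^ 2 - 1) *
      quasihomogeneous n φ w = (1 / (1 - z * conj w) ^ 2) * quasihomogeneous n φ w +
        (1 / (1 - conj z * w) ^ 2) * quasihomogeneous n φ w - quasihomogeneous n φ w := fun w => by
    ring
  simp only [h3]
  rw [integral_sub (f := fun w => (1 / (1 - z * conj w) ^ 2) * quasihomogeneous n φ w +
    (1 / (1 - conj z * w) ^ 2) * quasihomogeneous n φ w) (h1.add h2) (hφ.integrable n),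
    integral_add h1 h2,
    integral_quasihomogeneous_mul_bergmanKernel_conj hφ n hz, add_sub_cancel_right]
  rfl

theorem harmonicOnNhd_pow (n : ℕ) :
    InnerProductSpace.HarmonicOnNhd (fun z : ℂ => z ^ n) (Metric.ball 0 1) := fun z _ =>
  AnalyticAt.harmonicAt (by fun_prop)

/-- `z^n` is an eigenvector of the harmonic Toeplitz operator with radial symbol, and eigenvalues
are bounded by the operator norm. -/
theorem norm_even_moment_le {φ : ℝ → ℂ} (hφ : IntegrableProfile φ)
    {S : harmonicBergmanSpace →L[ℂ] harmonicBergmanSpace}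
    (hS : IsHarmonicToeplitz (radial φ) S) (n : ℕ) :
    ‖2 * ((n : ℂ) + 1) * mellinDisk φ (2 * n + 2)‖ ≤ ‖S‖ := by
  set h : harmonicBergmanSpace :=
    ⟨bergmanPow n, fun z => z ^ n, harmonicOnNhd_pow n, coe_bergmanPow_ae n⟩ with hh
  have h1 := hS (X ^ n) 0 h (by simpa using coe_bergmanPow_ae n)
  have h2 : S h = (2 * ((n : ℂ) + 1) * mellinDisk φ (2 * n + 2)) • h := by
    refine Subtype.ext (Lp.ext (h1.trans ?_))
    rw [Submodule.coe_smul]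
    filter_upwards [ae_mem_ball, Lp.coeFn_smul (2 * ((n : ℂ) + 1) * mellinDisk φ (2 * n + 2))
      (h : Lp ℂ 2 diskMeasure), coe_bergmanPow_ae n] with z hz h3 h4
    rw [h3, Pi.smul_apply, hh, h4]
    have h5 : (fun w => radial φ w * (eval w (X ^ n : ℂ[X]) + conj (eval w (0 : ℂ[X])))) =
        quasihomogeneous n fun r => φ r * (r : ℂ) ^ n := by
      ext w
      have := quasihomogeneous_mul_pow 0 φ n w
      rw [← radial_eq_quasihomogeneous, add_zero] at this
      simpa using this
    have h6 := bergmanProj_quasihomogeneous_mul_pow hφ 0 n (mem_ball_zero_iff.1 hz)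
    simp only [quasihomogeneous_mul_pow, add_zero] at h6
    rw [h5, harmonicProj_quasihomogeneous (hφ.mul_pow n) n (mem_ball_zero_iff.1 hz), h6]
    simp [toeplitzCoeff]
  have h3 : h ≠ 0 := by
    intro h0
    have h4 : bergmanPow n = 0 := Subtype.ext (congrArg (fun f : harmonicBergmanSpace => (f : Lp ℂ 2 diskMeasure)) h0)
    have h5 := inner_bergmanPow_bergmanPow n n
    rw [h4, inner_zero_left, if_pos rfl, eq_comm, div_eq_zero_iff] at h5
    have : (n : ℂ) + 1 ≠ 0 := by exact_mod_cast Nat.succ_ne_zero n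
    simp [this] at h5
  have h4 := S.le_opNorm h
  rw [h2, norm_smul] at h4
  exact le_of_mul_le_mul_right h4 (norm_pos_iff.2 h3)

theorem pow_mul_one_sub_le {r : ℝ} (h0 : 0 ≤ r) (h1 : r ≤ 1) (n : ℕ) :
    r ^ n * (1 - r) ≤ 1 / ((n : ℝ) + 1) := by
  have h2 := geom_sum_mul_neg r (n + 1)
  have h3 : ∑ i ∈ Finset.range (n + 1), r ^ n ≤ ∑ i ∈ Finset.range (n + 1), r ^ i :=
    Finset.sum_le_sum fun i hi => pow_le_pow_of_le_one h0 h1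
      (Nat.lt_succ_iff.1 (Finset.mem_range.1 hi))
  rw [Finset.sum_const, Finset.card_range, nsmul_eq_mul] at h3
  rw [le_div_iff₀ (by positivity)]
  have h4 : 0 ≤ r ^ (n + 1) := by positivity
  push_cast at h3
  nlinarith [mul_le_mul_of_nonneg_right h3 (sub_nonneg.2 h1)]

theorem mellinDisk_natCast_add_two (φ : ℝ → ℂ) (n : ℕ) :
    mellinDisk φ ((n : ℂ) + 2) = ∫ r in Ioo (0 : ℝ) 1, φ r * (r : ℂ) * (r : ℂ) ^ n := by
  have := mellinDisk_natCast_add_one φ (n + 1)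
  rw [show ((n + 1 : ℕ) : ℂ) + 1 = n + 2 by push_cast; ring] at this
  rw [this]
  simp only [pow_succ', mul_assoc]

/-- The difference integrates `φ(r) r` against `-r^n(1-r)`, which is at most `1/(n+1)` in modulus.
-/
theorem norm_mul_moment_sub_le {φ : ℝ → ℂ} (hφ : IntegrableProfile φ) (n : ℕ) :
    ((n : ℝ) + 1) * ‖mellinDisk φ (n + 3) - mellinDisk φ (n + 2)‖ ≤
      ∫ r in Ioo (0 : ℝ) 1, ‖φ r * (r : ℂ)‖ := by
  have hint : ∀ m : ℕ, IntegrableOn (fun r : ℝ => φ r * (r : ℂ) * (r : ℂ) ^ m) (Ioo 0 1) := by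
    intro m
    refine (hφ.mul_pow m).congr (ae_of_all _ fun r => ?_)
    simp only
    ring
  have h1 := mellinDisk_natCast_add_two φ (n + 1)
  rw [show ((n + 1 : ℕ) : ℂ) + 2 = n + 3 by push_cast; ring] at h1
  rw [h1, mellinDisk_natCast_add_two φ n, ← integral_sub (hint _) (hint _), mul_comm,
    ← le_div_iff₀ (by positivity), div_eq_inv_mul, ← integral_const_mul]
  refine norm_integral_le_of_norm_le (hφ.norm.const_mul _) ?_
  filter_upwards [ae_restrict_mem measurableSet_Ioo] with r hr
  have h2 : φ r * (r : ℂ) * (r : ℂ) ^ (n + 1) - φ r * (r : ℂ) * (r : ℂ) ^ n =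
      ((-(r ^ n * (1 - r)) : ℝ) : ℂ) * (φ r * r) := by
    push_cast
    ring
  rw [h2, norm_mul, Complex.norm_real, norm_neg, Real.norm_of_nonneg
    (mul_nonneg (pow_nonneg hr.1.le _) (sub_nonneg.2 hr.2.le)), ← one_div]
  gcongr
  exact pow_mul_one_sub_le hr.1.le hr.2.le n

theorem IsTFunction.integrableProfile {φ : ℝ → ℂ} (h : IsTFunction (radial φ)) :
    IntegrableProfile φ :=
  integrableProfile_of_integrable_radial h.1

/-- These eigenvalues on the `z^n` contain `φ̂` only at even integers, whereas odd `k` needs odd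
integers. An odd moment is compared with the even one just before it. -/
theorem IsTFunction.exists_norm_moment_le {φ : ℝ → ℂ} (h : IsTFunction (radial φ)) :
    ∃ C : ℝ, ∀ n : ℕ, ‖((n : ℂ) + 1) * mellinDisk φ (n + 2)‖ ≤ C := by
  have hφ := h.integrableProfile
  obtain ⟨-, S, hS⟩ := h
  set I := ∫ r in Ioo (0 : ℝ) 1, ‖φ r * (r : ℂ)‖
  have hI : 0 ≤ I := integral_nonneg fun r => norm_nonneg _
  have hn : ∀ n : ℕ, ‖(n : ℂ) + 1‖ = (n : ℝ) + 1 := fun n => by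
    exact_mod_cast Complex.norm_natCast (n + 1)
  have heven : ∀ j : ℕ, 2 * ((j : ℝ) + 1) * ‖mellinDisk φ (2 * j + 2)‖ ≤ ‖S‖ := by
    intro j
    have := norm_even_moment_le hφ hS j
    rwa [norm_mul, norm_mul, hn, Complex.norm_two] at this
  refine ⟨2 * ‖S‖ + 2 * I, fun n => ?_⟩
  rw [norm_mul, hn]
  obtain ⟨j, rfl | rfl⟩ := n.even_or_odd'
  · have h1 := heven j
    push_cast
    nlinarith [norm_nonneg (mellinDisk φ (2 * j + 2)), norm_nonneg S]
  · have h1 := heven j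
    have h2 := norm_mul_moment_sub_le hφ (2 * j)
    have h3 := norm_le_norm_add_norm_sub' (mellinDisk φ (((2 * j : ℕ) : ℂ) + 3))
      (mellinDisk φ (((2 * j : ℕ) : ℂ) + 2))
    rw [show (((2 * j + 1 : ℕ) : ℂ) + 2) = ((2 * j : ℕ) : ℂ) + 3 by push_cast; ring]
    push_cast at h2 h3 ⊢
    have h4 : (0 : ℝ) ≤ j := Nat.cast_nonneg j
    nlinarith [norm_nonneg (mellinDisk φ (2 * j + 2)), norm_nonneg S,
      norm_nonneg (mellinDisk φ (2 * j + 3) - mellinDisk φ (2 * j + 2)),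
      mul_le_mul_of_nonneg_left h3 (by positivity : (0 : ℝ) ≤ 2 * j + 1 + 1)]

theorem mellinDisk_rpow {m : ℝ} {z : ℂ} (hz : 0 < z.re + m) :
    mellinDisk (fun r => ((r ^ m : ℝ) : ℂ)) z = 1 / (z + m) := by
  have h1 : ∫ r in Ioo (0 : ℝ) 1, (((r ^ m : ℝ) : ℂ) * (r : ℂ) ^ (z - 1)) =
      ∫ r in Ioo (0 : ℝ) 1, (r : ℂ) ^ (z + m - 1) := by
    refine setIntegral_congr_fun measurableSet_Ioo fun r hr => ?_
    rw [Complex.ofReal_cpow hr.1.le, ← Complex.cpow_add _ _ (Complex.ofReal_ne_zero.2 hr.1.ne')]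
    ring_nf
  have hre : -1 < (z + m - 1).re := by simp; linarith
  have hne : z + m ≠ 0 := by
    intro h0
    have := congrArg Complex.re h0
    simp at this
    linarith
  rw [mellinDisk, h1, ← integral_Ioc_eq_integral_Ioo, ← intervalIntegral.integral_of_le zero_le_one,
    integral_cpow (Or.inl hre)]
  simp [Complex.zero_cpow, hne]

theorem integrableProfile_rpow {m : ℝ} (hm : -2 < m) :
    IntegrableProfile fun r => ((r ^ m : ℝ) : ℂ) := by
  have h1 : IntegrableOn (fun r : ℝ => r ^ (m + 1)) (Ioo 0 1) := by
    have := (intervalIntegral.intervalIntegrable_rpow' (a := 0) (b := 1) (r := m + 1)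
      (by linarith))
    rw [intervalIntegrable_iff_integrableOn_Ioo_of_le zero_le_one] at this
    exact this
  refine (integrableOn_congr_fun (fun r hr => ?_) measurableSet_Ioo).1 h1.ofReal
  simp only
  rw [Real.rpow_add hr.1, Real.rpow_one]
  simp

theorem norm_moment_rpow_le {m : ℝ} (hm : -1 ≤ m) (n : ℕ) :
    ‖((n : ℂ) + 1) * mellinDisk (fun r => ((r ^ m : ℝ) : ℂ)) (n + 2)‖ ≤ 1 := by
  have hn : (0 : ℝ) ≤ n := Nat.cast_nonneg n
  rw [mellinDisk_rpow (by simp; linarith)]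
  have h1 : ((n : ℂ) + 1) * (1 / (n + 2 + m)) = (((n : ℝ) + 1) / (n + 2 + m) : ℝ) := by
    push_cast
    ring
  rw [h1, Complex.norm_real, Real.norm_of_nonneg (div_nonneg (by linarith) (by linarith)),
    div_le_one (by linarith)]
  linarith

/-! ### Zeros of holomorphic functions on a half-plane -/

theorem isOpen_re_gt (R : ℝ) : IsOpen {z : ℂ | R < z.re} :=
  isOpen_lt continuous_const Complex.continuous_re

theorem add_ofReal_ne_zero {z : ℂ} {a : ℝ} (h : 0 < z.re + a) : z + a ≠ 0 := by
  intro h0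
  have := congrArg Complex.re h0
  simp at this
  linarith

theorem norm_sub_div_add_lt_one {z : ℂ} {a : ℝ} (hz : 0 < z.re) (ha : 0 < a) :
    ‖(z - a) / (z + a)‖ < 1 := by
  have h1 : 0 < ‖z + a‖ := norm_pos_iff.2 (add_ofReal_ne_zero (by linarith))
  rw [norm_div, div_lt_one h1, ← sq_lt_sq₀ (norm_nonneg _) (norm_nonneg _), Complex.sq_norm,
    Complex.sq_norm, Complex.normSq_apply, Complex.normSq_apply]
  simp
  nlinarith [mul_pos hz ha]

/-- This is the Schwarz lemma transported by the Cayley map `z ↦ (z-a)/(z+a)`, whose inverse is `ψ`.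
The cofactor is the divided slope at `0` of `f ∘ ψ`, and it obeys the same bound `M`. -/
theorem exists_eq_blaschke_mul {f : ℂ → ℂ} {M : ℝ}
    (hf : DifferentiableOn ℂ f {z | 0 < z.re}) (hfM : ∀ z : ℂ, 0 < z.re → ‖f z‖ ≤ M) {a : ℝ}
    (ha : 0 < a) (hfa : f a = 0) :
    ∃ f₁ : ℂ → ℂ, DifferentiableOn ℂ f₁ {z | 0 < z.re} ∧ (∀ z : ℂ, 0 < z.re → ‖f₁ z‖ ≤ M) ∧
      ∀ z : ℂ, 0 < z.re → f z = (z - a) / (z + a) * f₁ z := by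
  set ψ : ℂ → ℂ := fun w => a * (1 + w) / (1 - w) with hψ
  have hne : ∀ w ∈ Metric.ball (0 : ℂ) 1, 1 - w ≠ 0 := by
    intro w hw h0
    rw [mem_ball_zero_iff, ← sub_eq_zero.1 h0, norm_one] at hw
    exact lt_irrefl _ hw
  have hψm : ∀ w ∈ Metric.ball (0 : ℂ) 1, 0 < (ψ w).re := by
    intro w hw
    have h1 : 0 < Complex.normSq (1 - w) := Complex.normSq_pos.2 (hne w hw)
    have h2 : ‖w‖ ^ 2 < 1 := by
      have := mem_ball_zero_iff.1 hw
      nlinarith [norm_nonneg w]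
    rw [Complex.sq_norm, Complex.normSq_apply] at h2
    simp only [hψ]
    rw [Complex.div_re, ← add_div]
    refine div_pos ?_ h1
    simp
    nlinarith
  set g : ℂ → ℂ := fun w => f (ψ w) with hg
  have hgd : DifferentiableOn ℂ g (Metric.ball 0 1) := by
    refine hf.comp ?_ hψm
    exact DifferentiableOn.div (by fun_prop) (by fun_prop) hne
  have hg0 : g 0 = 0 := by simp [hg, hψ, hfa]
  have hgm : MapsTo g (Metric.ball 0 1) (Metric.closedBall (g 0) M) := by
    intro w hw
    rw [hg0, mem_closedBall_zero_iff]
    exact hfM _ (hψm w hw)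
  refine ⟨fun z => dslope g 0 ((z - a) / (z + a)), ?_, ?_, ?_⟩
  · have h1 : DifferentiableOn ℂ (dslope g 0) (Metric.ball 0 1) :=
      (Complex.differentiableOn_dslope (Metric.ball_mem_nhds 0 one_pos)).2 hgd
    refine h1.comp ?_ fun z hz => mem_ball_zero_iff.2 (norm_sub_div_add_lt_one hz ha)
    refine DifferentiableOn.div (by fun_prop) (by fun_prop) fun z hz => ?_
    have : 0 < z.re := hz
    exact add_ofReal_ne_zero (by linarith)
  · intro z hz
    have := Complex.norm_dslope_le_div_of_mapsTo_ball hgd hgm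
      (mem_ball_zero_iff.2 (norm_sub_div_add_lt_one hz ha))
    simpa using this
  · intro z hz
    have h1 : z + a ≠ 0 := add_ofReal_ne_zero (by linarith)
    have h2 : ψ ((z - a) / (z + a)) = z := by
      have ha' : (a : ℂ) ≠ 0 := Complex.ofReal_ne_zero.2 ha.ne'
      have h3 : 1 - (z - a) / (z + a) = 2 * a / (z + a) := by
        field_simp
        ring
      simp only [hψ, h3]
      field_simp
      ring
    have h3 := sub_smul_dslope g 0 ((z - a) / (z + a))
    rw [hg0, sub_zero, sub_zero, smul_eq_mul] at h3
    rw [h3, hg]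
    simp only [h2]

/-- Zeros are divided out one at a time. The bound `M` does not deteriorate, and the cofactor still
vanishes at the remaining zeros because they are distinct from the removed one. -/
theorem norm_le_mul_prod_blaschke {M : ℝ} (N : ℕ) :
    ∀ (f : ℂ → ℂ) (a : ℕ → ℝ), DifferentiableOn ℂ f {z | 0 < z.re} →
      (∀ z : ℂ, 0 < z.re → ‖f z‖ ≤ M) → (∀ j, 0 < a j) → Function.Injective a →
      (∀ j, f (a j) = 0) → ∀ z : ℂ, 0 < z.re →
        ‖f z‖ ≤ M * ∏ j ∈ Finset.range N, ‖(z - a j) / (z + a j)‖ := by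
  induction N with
  | zero =>
    intro f a _ hfM _ _ _ z hz
    simpa using hfM z hz
  | succ N ih =>
    intro f a hf hfM ha hinj h0 z hz
    obtain ⟨f₁, hd, hM₁, heq⟩ := exists_eq_blaschke_mul hf hfM (ha 0) (h0 0)
    have h1 : ∀ j, f₁ (a (j + 1)) = 0 := by
      intro j
      have h2 := heq (a (j + 1)) (by simpa using ha (j + 1))
      rw [h0 (j + 1), eq_comm, mul_eq_zero] at h2
      refine h2.resolve_left (div_ne_zero ?_ ?_)
      · rw [sub_ne_zero]
        intro h
        exact absurd (hinj (Complex.ofReal_injective h)) (Nat.succ_ne_zero j)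
      · exact add_ofReal_ne_zero (by simpa using add_pos (ha (j + 1)) (ha 0))
    have h3 := ih f₁ (fun j => a (j + 1)) hd hM₁ (fun j => ha _)
      (fun i j h => Nat.succ_injective (hinj h)) h1 z hz
    rw [heq z hz, norm_mul, Finset.prod_range_succ', mul_comm, ← mul_assoc]
    gcongr

theorem norm_sub_div_add_le_exp {z : ℂ} {a : ℝ} (hz : 0 < z.re) (ha : 0 < a) :
    ‖(z - a) / (z + a)‖ ≤ Real.exp (-(2 * a * z.re / ‖z + a‖ ^ 2)) := by
  have h1 : 0 < ‖z + a‖ := norm_pos_iff.2 (add_ofReal_ne_zero (by linarith))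
  have h2 : ‖(z - a) / (z + a)‖ ^ 2 = 1 - 4 * a * z.re / ‖z + a‖ ^ 2 := by
    rw [norm_div, div_pow, eq_sub_iff_add_eq, ← add_div, div_eq_one_iff_eq (by positivity),
      Complex.sq_norm, Complex.sq_norm, Complex.normSq_apply, Complex.normSq_apply]
    simp
    ring
  rw [← sq_le_sq₀ (norm_nonneg _) (Real.exp_pos _).le, h2, ← Real.exp_nat_mul]
  have h3 := Real.add_one_le_exp (-(4 * a * z.re / ‖z + a‖ ^ 2))
  have h4 : ((2 : ℕ) : ℝ) * -(2 * a * z.re / ‖z + a‖ ^ 2) = -(4 * a * z.re / ‖z + a‖ ^ 2) := by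
    push_cast
    ring
  rw [h4]
  linarith

theorem tendsto_prod_blaschke {b d : ℝ} (hb : 0 < b) (hd : 0 < d) {z : ℂ} (hz : 0 < z.re) :
    Tendsto (fun N => ∏ j ∈ Finset.range N, ‖(z - (b + d * j : ℝ)) / (z + (b + d * j : ℝ))‖) atTop
      (𝓝 0) := by
  -- `K` is chosen so that `‖z + (b + d j)‖ ≤ K (j+1)`, while `b + d j ≥ min b d * (j+1)`. Each
  -- factor is then at most `exp(-c/(j+1))`, and the divergence of the harmonic series sends the
  -- product to `0`.
  set K := ‖z‖ + b + d
  have hK : 0 < K := by positivity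
  have hm : 0 < min b d := lt_min hb hd
  set c := 2 * min b d * z.re / K ^ 2
  have hc : 0 < c := by positivity
  have h1 : ∀ j : ℕ, ‖(z - (b + d * j : ℝ)) / (z + (b + d * j : ℝ))‖ ≤
      Real.exp (-(c * (1 / ((j : ℝ) + 1)))) := by
    intro j
    have hj : (0 : ℝ) ≤ j := Nat.cast_nonneg j
    have hpos : 0 < b + d * j := by positivity
    refine (norm_sub_div_add_le_exp hz hpos).trans ?_
    rw [Real.exp_le_exp, neg_le_neg_iff]
    have h2 : ‖z + (b + d * j : ℝ)‖ ≤ K * (j + 1) := by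
      refine (norm_add_le _ _).trans ?_
      rw [Complex.norm_real, Real.norm_of_nonneg hpos.le]
      simp only [K]
      nlinarith [norm_nonneg z, mul_nonneg (norm_nonneg z) hj, mul_nonneg hb.le hj]
    have h3 : min b d * (j + 1) ≤ b + d * j := by
      nlinarith [min_le_left b d, min_le_right b d]
    have h4 : 0 < ‖z + (b + d * j : ℝ)‖ :=
      norm_pos_iff.2 (add_ofReal_ne_zero (by linarith))
    calc c * (1 / ((j : ℝ) + 1)) = 2 * (min b d * (j + 1)) * z.re / (K * (j + 1)) ^ 2 := by
          simp only [c]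
          field_simp
      _ ≤ _ := by gcongr
  refine squeeze_zero (fun N => Finset.prod_nonneg fun j _ => norm_nonneg _)
    (fun N => Finset.prod_le_prod (fun j _ => norm_nonneg _) fun j _ => h1 j) ?_
  have h5 : ∀ N : ℕ, ∏ j ∈ Finset.range N, Real.exp (-(c * (1 / ((j : ℝ) + 1)))) =
      Real.exp (-(c * ∑ j ∈ Finset.range N, 1 / ((j : ℝ) + 1))) := by
    intro N
    rw [← Real.exp_sum, Finset.sum_neg_distrib, Finset.mul_sum]
  simp only [h5]
  refine Real.tendsto_exp_neg_atTop_nhds_zero.comp ?_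
  exact Real.tendsto_sum_range_one_div_nat_succ_atTop.const_mul_atTop hc

theorem eq_zero_of_bounded_of_zeros {f : ℂ → ℂ} {M b d : ℝ} (hb : 0 < b) (hd : 0 < d)
    (hf : DifferentiableOn ℂ f {z | 0 < z.re}) (hfM : ∀ z : ℂ, 0 < z.re → ‖f z‖ ≤ M)
    (h0 : ∀ j : ℕ, f (b + d * j : ℝ) = 0) {z : ℂ} (hz : 0 < z.re) : f z = 0 := by
  have h1 := fun N => norm_le_mul_prod_blaschke N f (fun j => b + d * j) hf hfM
    (fun j => by positivity) (fun i j h => by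
      have : d * (i : ℝ) = d * j := add_left_cancel h
      exact_mod_cast mul_left_cancel₀ hd.ne' this) h0 z hz
  have h2 := (tendsto_prod_blaschke hb hd hz).const_mul M
  rw [mul_zero] at h2
  exact norm_le_zero_iff.1 (ge_of_tendsto' h2 h1)

/-- A holomorphic function of polynomial growth on a half-plane which vanishes along an arithmetic
progression is zero. -/
theorem eq_zero_of_polynomial_growth_of_zeros {f : ℂ → ℂ} {M R b d : ℝ} {N : ℕ} (hR : 0 < R)
    (hb : R < b) (hd : 0 < d) (hf : DifferentiableOn ℂ f {z | R < z.re})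
    (hfM : ∀ z : ℂ, R < z.re → ‖f z‖ ≤ M * ‖z‖ ^ N) (h0 : ∀ j : ℕ, f (b + d * j : ℝ) = 0)
    {z : ℂ} (hz : R < z.re) : f z = 0 := by
  have hne : ∀ z : ℂ, R < z.re → z ≠ 0 := by
    rintro z hz rfl
    rw [Complex.zero_re] at hz
    linarith
  have hre : ∀ z : ℂ, 0 < z.re → R < (z + R).re := fun z hz => by simpa using hz
  -- Translation by `R` moves the problem to the right half-plane, and division by `(z+R)^N`, which
  -- has no zero there, makes the function bounded.
  have h1 := eq_zero_of_bounded_of_zeros (f := fun z => f (z + R) / (z + R) ^ N) (M := M)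
    (sub_pos.2 hb) hd ?_ ?_ ?_ (z := z - R) (by simpa using hz)
  · rw [sub_add_cancel, div_eq_zero_iff] at h1
    exact h1.resolve_right (pow_ne_zero _ (hne z hz))
  · refine DifferentiableOn.div (hf.comp (by fun_prop) hre) (by fun_prop) fun z hz => ?_
    exact pow_ne_zero _ (hne _ (hre z hz))
  · intro z hz
    have := norm_pos_iff.2 (hne _ (hre z hz))
    rw [norm_div, norm_pow, div_le_iff₀ (by positivity)]
    exact hfM _ (hre z hz)
  · intro j
    have h2 : (((b - R + d * j : ℝ) : ℂ) + R) = ((b + d * j : ℝ) : ℂ) := by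
      push_cast
      ring
    rw [h2, h0, zero_div]

/-! ### Analyticity and injectivity of the Mellin transform -/

theorem norm_mellin_integrand_le (φ : ℝ → ℂ) {z : ℂ} (hz : 2 ≤ z.re) {r : ℝ}
    (hr : r ∈ Ioo (0 : ℝ) 1) : ‖φ r * (r : ℂ) ^ (z - 1)‖ ≤ ‖φ r * (r : ℂ)‖ := by
  rw [norm_mul, norm_mul, Complex.norm_cpow_eq_rpow_re_of_pos hr.1, Complex.norm_real,
    Real.norm_of_nonneg hr.1.le]
  gcongr
  calc r ^ (z - 1).re ≤ r ^ (1 : ℝ) :=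
        Real.rpow_le_rpow_of_exponent_ge hr.1 hr.2.le (by simp; linarith)
    _ = r := Real.rpow_one r

theorem IntegrableProfile.aestronglyMeasurable {φ : ℝ → ℂ} (hφ : IntegrableProfile φ) :
    AEStronglyMeasurable φ (volume.restrict (Ioo (0 : ℝ) 1)) := by
  have h1 : AEStronglyMeasurable (fun r : ℝ => (r : ℂ)⁻¹) (volume.restrict (Ioo (0 : ℝ) 1)) :=
    Measurable.aestronglyMeasurable (by fun_prop)
  refine ((Integrable.aestronglyMeasurable hφ).mul h1).congr ?_
  filter_upwards [ae_restrict_mem measurableSet_Ioo] with r hr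
  have : (r : ℂ) ≠ 0 := Complex.ofReal_ne_zero.2 hr.1.ne'
  simp only [Pi.mul_apply]
  field_simp

theorem IntegrableProfile.mellin_integrable {φ : ℝ → ℂ} (hφ : IntegrableProfile φ) {z : ℂ}
    (hz : 2 ≤ z.re) : IntegrableOn (fun r : ℝ => φ r * (r : ℂ) ^ (z - 1)) (Ioo 0 1) := by
  refine Integrable.mono hφ (hφ.aestronglyMeasurable.mul ?_) ?_
  · exact Measurable.aestronglyMeasurable (by fun_prop)
  · filter_upwards [ae_restrict_mem measurableSet_Ioo] with r hr
    exact norm_mellin_integrand_le φ hz hr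

theorem norm_mellinDisk_le {φ : ℝ → ℂ} (hφ : IntegrableProfile φ) {z : ℂ} (hz : 2 ≤ z.re) :
    ‖mellinDisk φ z‖ ≤ ∫ r in Ioo (0 : ℝ) 1, ‖φ r * (r : ℂ)‖ := by
  refine norm_integral_le_of_norm_le hφ.norm ?_
  filter_upwards [ae_restrict_mem measurableSet_Ioo] with r hr
  exact norm_mellin_integrand_le φ hz hr

theorem continuousOn_mellinDisk {φ : ℝ → ℂ} (hφ : IntegrableProfile φ) :
    ContinuousOn (mellinDisk φ) {z | 2 ≤ z.re} := by
  refine continuousOn_of_dominated (bound := fun r => ‖φ r * (r : ℂ)‖)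
    (fun z hz => (hφ.mellin_integrable hz).aestronglyMeasurable) ?_ hφ.norm ?_
  · intro z hz
    filter_upwards [ae_restrict_mem measurableSet_Ioo] with r hr
    exact norm_mellin_integrand_le φ hz hr
  · filter_upwards [ae_restrict_mem measurableSet_Ioo] with r hr
    have : (r : ℂ) ≠ 0 := Complex.ofReal_ne_zero.2 hr.1.ne'
    exact Continuous.continuousOn (by
      refine continuous_const.mul (Continuous.const_cpow (by fun_prop) (Or.inl this)))

theorem differentiableOn_mellinDisk {φ : ℝ → ℂ} (hφ : IntegrableProfile φ) :
    DifferentiableOn ℂ (mellinDisk φ) {z | 2 < z.re} := by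
  intro z₀ hz₀
  have hz₀' : 2 < z₀.re := hz₀
  -- The room between `2` and `s` absorbs the logarithm produced by differentiation: `|log r|
  -- r^(s-2) ≤ 1/(s-2)`.
  obtain ⟨s, h2s, hsz⟩ := exists_between hz₀'
  have hs : {z : ℂ | s < z.re} ∈ 𝓝 z₀ := (isOpen_re_gt s).mem_nhds hsz
  have := hasDerivAt_integral_of_dominated_loc_of_deriv_le (𝕜 := ℂ)
    (μ := volume.restrict (Ioo (0 : ℝ) 1)) (F := fun z (r : ℝ) => φ r * (r : ℂ) ^ (z - 1))
    (F' := fun z (r : ℝ) => φ r * ((r : ℂ) ^ (z - 1) * Complex.log r))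
    (bound := fun r => (1 / (s - 2)) * ‖φ r * (r : ℂ)‖) hs ?_ (hφ.mellin_integrable hz₀'.le)
    ?_ ?_ (hφ.norm.const_mul _) ?_
  · exact this.2.differentiableAt.differentiableWithinAt
  · filter_upwards [hs] with z hz
    have : s < z.re := hz
    exact (hφ.mellin_integrable (by linarith)).aestronglyMeasurable
  · refine hφ.aestronglyMeasurable.mul ?_
    exact Measurable.aestronglyMeasurable (by fun_prop)
  · filter_upwards [ae_restrict_mem measurableSet_Ioo] with r hr z hz
    have hz' : s < z.re := hz
    rw [norm_mul, norm_mul, norm_mul, Complex.norm_cpow_eq_rpow_re_of_pos hr.1,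
      ← Complex.ofReal_log hr.1.le, Complex.norm_real, Complex.norm_real,
      Real.norm_of_nonneg hr.1.le, Real.norm_eq_abs]
    have h1 := (Real.abs_log_mul_self_rpow_lt r (s - 2) hr.1 hr.2.le (by linarith)).le
    rw [abs_mul, abs_of_pos (Real.rpow_pos_of_pos hr.1 _)] at h1
    have h2 : r ^ (z - 1).re ≤ r ^ (s - 2) * r := by
      rw [← Real.rpow_add_one hr.1.ne']
      exact Real.rpow_le_rpow_of_exponent_ge hr.1 hr.2.le (by simp; linarith)
    calc ‖φ r‖ * (r ^ (z - 1).re * |Real.log r|)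
        ≤ ‖φ r‖ * (r ^ (s - 2) * r * |Real.log r|) := by gcongr
      _ = (|Real.log r| * r ^ (s - 2)) * (‖φ r‖ * r) := by ring
      _ ≤ _ := by
        have := hr.1.le
        gcongr
  · filter_upwards [ae_restrict_mem measurableSet_Ioo] with r hr z _
    have h0 : (r : ℂ) ≠ 0 := Complex.ofReal_ne_zero.2 hr.1.ne'
    have := ((hasDerivAt_id z).sub_const 1).const_cpow (c := (r : ℂ)) (Or.inl h0)
    simpa using this.const_mul (φ r)

/-- By Weierstrass approximation, vanishing moments annihilate every continuous function, in
particular all smooth test functions supported in the interval. -/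
theorem ae_eq_zero_of_integral_mul_pow_eq_zero {h : ℝ → ℂ} (hh : IntegrableOn h (Ioo 0 1))
    (h0 : ∀ n : ℕ, ∫ r in Ioo (0 : ℝ) 1, (r : ℂ) ^ n * h r = 0) :
    ∀ᵐ r ∂(volume.restrict (Ioo (0 : ℝ) 1)), h r = 0 := by
  have hmul : ∀ g : ℝ → ℝ, Continuous g → IntegrableOn (fun r => (g r : ℂ) * h r) (Ioo 0 1) := by
    intro g hg
    obtain ⟨K, hK⟩ := isCompact_Icc.exists_bound_of_continuousOn (s := Icc (0 : ℝ) 1) hg.continuousOn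
    refine Integrable.bdd_mul (c := K) hh (Continuous.aestronglyMeasurable (by fun_prop)) ?_
    filter_upwards [ae_restrict_mem measurableSet_Ioo] with r hr
    rw [Complex.norm_real]
    exact hK r (Ioo_subset_Icc_self hr)
  have hpoly : ∀ p : ℝ[X], ∫ r in Ioo (0 : ℝ) 1, ((p.eval r : ℝ) : ℂ) * h r = 0 := by
    intro p
    have h1 : ∀ r : ℝ, ((p.eval r : ℝ) : ℂ) * h r =
        ∑ n ∈ p.support, (p.coeff n : ℂ) * ((r : ℂ) ^ n * h r) := by
      intro r
      simp only [Polynomial.eval_eq_sum, Polynomial.sum]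
      push_cast
      rw [Finset.sum_mul]
      exact Finset.sum_congr rfl fun n _ => by ring
    simp only [h1]
    rw [integral_finsetSum]
    · exact Finset.sum_eq_zero fun n _ => by rw [integral_const_mul, h0, mul_zero]
    · intro n _
      have := hmul (fun r => r ^ n) (by fun_prop)
      simp only [Complex.ofReal_pow] at this
      exact Integrable.const_mul this _
  have hcont : ∀ g : ℝ → ℝ, Continuous g → ∫ r in Ioo (0 : ℝ) 1, (g r : ℂ) * h r = 0 := by
    intro g hg
    set I := ∫ r in Ioo (0 : ℝ) 1, ‖h r‖
    have hI : 0 ≤ I := integral_nonneg fun r => norm_nonneg _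
    rw [← norm_le_zero_iff]
    refine le_of_forall_pos_le_add fun ε hε => ?_
    obtain ⟨p, hp⟩ := exists_polynomial_near_of_continuousOn 0 1 g hg.continuousOn (ε / (I + 1))
      (by positivity)
    have h1 : ∫ r in Ioo (0 : ℝ) 1, (g r : ℂ) * h r =
        ∫ r in Ioo (0 : ℝ) 1, ((g r : ℂ) * h r - ((p.eval r : ℝ) : ℂ) * h r) := by
      rw [integral_sub (hmul g hg) (hmul (fun r => p.eval r) (by fun_prop)), hpoly, sub_zero]
    rw [h1]
    calc _ ≤ ∫ r in Ioo (0 : ℝ) 1, ε / (I + 1) * ‖h r‖ := by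
          refine norm_integral_le_of_norm_le (hh.norm.const_mul _) ?_
          filter_upwards [ae_restrict_mem measurableSet_Ioo] with r hr
          rw [← sub_mul, norm_mul, ← Complex.ofReal_sub, Complex.norm_real, Real.norm_eq_abs,
            abs_sub_comm]
          gcongr
          exact (hp r (Ioo_subset_Icc_self hr)).le
      _ = ε / (I + 1) * I := integral_const_mul _ _
      _ ≤ 0 + ε := by
        rw [zero_add, div_mul_eq_mul_div, div_le_iff₀ (by positivity)]
        nlinarith
  rw [ae_restrict_iff' measurableSet_Ioo]
  refine isOpen_Ioo.ae_eq_zero_of_integral_contDiff_smul_eq_zero hh.locallyIntegrableOn ?_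
  intro g hg _ hsupp
  rw [← hcont g hg.continuous, ← setIntegral_eq_integral_of_forall_compl_eq_zero (s := Ioo (0 : ℝ) 1)]
  · simp
  · intro x hx
    rw [image_eq_zero_of_notMem_tsupport fun h => hx (hsupp h), zero_smul]

/-- A radial profile is determined by its Mellin transform near infinity. -/
theorem ae_eq_zero_of_mellinDisk_eq_zero {φ : ℝ → ℂ} (hφ : IntegrableProfile φ) {R : ℝ}
    (h0 : ∀ z : ℂ, R < z.re → mellinDisk φ z = 0) :
    ∀ᵐ r ∂(volume.restrict (Ioo (0 : ℝ) 1)), φ r = 0 := by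
  -- Only the points `N + n + 2`, which exceed `R`, are used; the extra power `r^(N+1)` is absorbed
  -- into the function whose moments vanish.
  obtain ⟨N, hN⟩ := exists_nat_gt R
  have h1 : IntegrableOn (fun r : ℝ => φ r * (r : ℂ) ^ N * (r : ℂ)) (Ioo 0 1) := hφ.mul_pow N
  have h2 := ae_eq_zero_of_integral_mul_pow_eq_zero h1 fun n => by
    have h3 := mellinDisk_natCast_add_two φ (N + n)
    have hn : (0 : ℝ) ≤ n := Nat.cast_nonneg n
    rw [h0 _ (by simp; linarith)] at h3
    rw [h3]
    refine integral_congr_ae (ae_of_all _ fun r => ?_)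
    simp only
    ring
  filter_upwards [h2, ae_restrict_mem measurableSet_Ioo] with r hr hr0
  have : (r : ℂ) ≠ 0 := Complex.ofReal_ne_zero.2 hr0.1.ne'
  simpa [this] using hr

/-! ### Growth and recurrence of Gamma quotients -/

theorem norm_betaIntegral_le_one {s : ℂ} {t : ℝ} (hs : 1 ≤ s.re) (ht : 1 ≤ t) :
    ‖Complex.betaIntegral s t‖ ≤ 1 := by
  have := intervalIntegral.norm_integral_le_of_norm_le_const (a := 0) (b := 1) (C := 1)
    (f := fun x : ℝ => (x : ℂ) ^ (s - 1) * (1 - (x : ℂ)) ^ ((t : ℂ) - 1)) ?_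
  · simpa [Complex.betaIntegral] using this
  · intro x hx
    rw [uIoc_of_le zero_le_one] at hx
    rcases hx.2.eq_or_lt with rfl | hx1
    · by_cases ht1 : (t : ℂ) - 1 = 0
      · simp [ht1]
      · simp [Complex.zero_cpow ht1]
    · have h1 : ((1 : ℂ) - x) = ((1 - x : ℝ) : ℂ) := by push_cast; ring
      rw [norm_mul, h1, Complex.norm_cpow_eq_rpow_re_of_pos hx.1,
        Complex.norm_cpow_eq_rpow_re_of_pos (by linarith)]
      refine mul_le_one₀ (Real.rpow_le_one hx.1.le hx.2 (by simpa using hs))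
        (Real.rpow_nonneg (by linarith) _) (Real.rpow_le_one (by linarith) (by linarith [hx.1])
        (by simpa using ht))

theorem norm_Gamma_add_natCast_le (c : ℝ) (j : ℕ) {w : ℂ} (hw : 1 ≤ w.re) (hwc : 0 < w.re + c) :
    ‖Complex.Gamma (w + c + j)‖ ≤ (1 + |c| + j) ^ j * ‖w‖ ^ j * ‖Complex.Gamma (w + c)‖ := by
  have hw1 : 1 ≤ ‖w‖ := hw.trans (Complex.re_le_norm w)
  have key : ∀ i ≤ j, ‖Complex.Gamma (w + c + i)‖ ≤
      (1 + |c| + j) ^ i * ‖w‖ ^ i * ‖Complex.Gamma (w + c)‖ := by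
    intro i
    induction i with
    | zero => intro _; simp
    | succ i ih =>
      intro hi
      have h1 := ih (by omega)
      have hij : (i : ℝ) ≤ j := by exact_mod_cast (Nat.le_succ i).trans hi
      have h2 : w + c + i ≠ 0 := by
        have := add_ofReal_ne_zero (z := w) (a := c + i)
          (by linarith [(Nat.cast_nonneg i : (0 : ℝ) ≤ i)])
        push_cast at this
        rwa [← add_assoc] at this
      have h3 : ‖w + c + i‖ ≤ (1 + |c| + j) * ‖w‖ := by
        calc ‖w + c + i‖ ≤ ‖w‖ + |c| + i := by
              have := norm_add₃_le (a := w) (b := (c : ℂ)) (c := (i : ℂ))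
              rwa [Complex.norm_real, Complex.norm_natCast] at this
          _ ≤ _ := by nlinarith [abs_nonneg c, (Nat.cast_nonneg i : (0 : ℝ) ≤ i)]
      rw [Nat.cast_succ, ← add_assoc, Complex.Gamma_add_one _ h2, norm_mul, pow_succ, pow_succ]
      calc _ ≤ ((1 + |c| + j) * ‖w‖) *
            ((1 + |c| + j) ^ i * ‖w‖ ^ i * ‖Complex.Gamma (w + c)‖) := by gcongr
        _ = _ := by ring
  exact key j le_rfl

/-- Choose an integer `j` with `t = c + j - a ≥ 1`. Then `Γ(w+a)Γ(t)` is `Γ(w+c+j)` times a Beta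
integral of modulus at most `1`, and `Γ(w+c+j)` is `Γ(w+c)` times a polynomial in `w`. -/
theorem exists_norm_Gamma_div_Gamma_le (a c : ℝ) :
    ∃ (R M : ℝ) (N : ℕ), 1 ≤ R ∧ 0 ≤ M ∧ ∀ w : ℂ, R ≤ w.re →
      ‖Complex.Gamma (w + a) / Complex.Gamma (w + c)‖ ≤ M * ‖w‖ ^ N := by
  obtain ⟨j, hj⟩ := exists_nat_ge (1 + a - c)
  set t : ℝ := c + j - a with ht
  have ht1 : 1 ≤ t := by linarith
  have hΓt : Complex.Gamma t ≠ 0 := Complex.Gamma_ne_zero_of_re_pos (by simpa using by linarith)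
  refine ⟨1 + |a| + |c|, (1 + |c| + j) ^ j * ‖Complex.Gamma t‖⁻¹, j,
    by linarith [abs_nonneg a, abs_nonneg c], by positivity, fun w hw => ?_⟩
  have ha := neg_abs_le a
  have hc := neg_abs_le c
  have ha' := abs_nonneg a
  have hc' := abs_nonneg c
  have h1 := Complex.Gamma_mul_Gamma_eq_betaIntegral (s := w + a) (t := t)
    (by simp; linarith) (by simp; linarith)
  have h2 : w + a + t = w + c + j := by
    rw [ht]
    push_cast
    ring
  rw [h2] at h1
  have h3 := norm_betaIntegral_le_one (s := w + a) (t := t) (by simp; linarith) ht1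
  have h4 := norm_Gamma_add_natCast_le c j (w := w) (by linarith) (by linarith)
  have h5 : 0 < ‖Complex.Gamma (w + c)‖ :=
    norm_pos_iff.2 (Complex.Gamma_ne_zero_of_re_pos (by simp; linarith))
  have h6 : 0 < ‖Complex.Gamma t‖ := norm_pos_iff.2 hΓt
  have h7 := congrArg norm h1
  rw [norm_mul, norm_mul] at h7
  rw [norm_div, div_le_iff₀ h5, ← mul_le_mul_iff_left₀ h6, h7]
  calc _ ≤ (1 + |c| + j) ^ j * ‖w‖ ^ j * ‖Complex.Gamma (w + c)‖ * 1 := by gcongr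
    _ = _ := by field_simp

/-- The quotient `Γ((z+A)/d) Γ((z+B)/d) / (Γ((z+C)/d) Γ((z+D)/d))`. -/
def gammaQuotient (d A B C D : ℝ) (z : ℂ) : ℂ :=
  Complex.Gamma ((z + A) / d) * Complex.Gamma ((z + B) / d) /
    (Complex.Gamma ((z + C) / d) * Complex.Gamma ((z + D) / d))

/-- Each factor obeys `Γ(s+1) = sΓ(s)`. In the denominator the relation is used for the entire
function `1/Γ`, so it needs no condition on `C` and `D`. -/
theorem gammaQuotient_recurrence {d : ℝ} (hd : 0 < d) (A B C D : ℝ) {z : ℂ}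
    (hA : z + A ≠ 0) (hB : z + B ≠ 0) :
    (z + A) * (z + B) * gammaQuotient d A B C D z =
      (z + C) * (z + D) * gammaQuotient d A B C D (z + d) := by
  have hd' : (d : ℂ) ≠ 0 := Complex.ofReal_ne_zero.2 hd.ne'
  have hshift : ∀ E : ℝ, (z + d + E) / d = (z + E) / d + 1 := by
    intro E
    field_simp
    ring
  have hA' := Complex.Gamma_add_one ((z + A) / d) (div_ne_zero hA hd')
  have hB' := Complex.Gamma_add_one ((z + B) / d) (div_ne_zero hB hd')
  have hC' := Complex.one_div_Gamma_eq_self_mul_one_div_Gamma_add_one ((z + C) / d)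
  have hD' := Complex.one_div_Gamma_eq_self_mul_one_div_Gamma_add_one ((z + D) / d)
  simp only [gammaQuotient, hshift, div_eq_mul_inv _ (Complex.Gamma _ * Complex.Gamma _), mul_inv]
  rw [hA', hB', hC', hD']
  field_simp

theorem re_add_div_pos {d E : ℝ} (hd : 0 < d) {z : ℂ} (h : 0 < z.re + E) :
    0 < ((z + E) / d).re := by
  rw [Complex.div_ofReal_re]
  exact div_pos (by simpa using h) hd

theorem Gamma_add_div_ne_zero {d E : ℝ} (hd : 0 < d) {z : ℂ} (h : 0 < z.re + E) :
    Complex.Gamma ((z + E) / d) ≠ 0 :=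
  Complex.Gamma_ne_zero_of_re_pos (re_add_div_pos hd h)

theorem differentiableAt_Gamma_of_re_pos {s : ℂ} (hs : 0 < s.re) :
    DifferentiableAt ℂ Complex.Gamma s := by
  refine Complex.differentiableAt_Gamma s fun n h => ?_
  rw [h] at hs
  simp at hs
  linarith [(Nat.cast_nonneg n : (0 : ℝ) ≤ n)]

theorem differentiableAt_Gamma_add_div {d E : ℝ} (hd : 0 < d) {z : ℂ} (h : 0 < z.re + E) :
    DifferentiableAt ℂ (fun z : ℂ => Complex.Gamma ((z + E) / d)) z :=
  (differentiableAt_Gamma_of_re_pos (re_add_div_pos hd h)).comp z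
    (f := fun z : ℂ => (z + E) / d) (by fun_prop)

theorem differentiableAt_gammaQuotient {d A B C D : ℝ} (hd : 0 < d) {z : ℂ} (hA : 0 < z.re + A)
    (hB : 0 < z.re + B) (hC : 0 < z.re + C) (hD : 0 < z.re + D) :
    DifferentiableAt ℂ (gammaQuotient d A B C D) z :=
  ((differentiableAt_Gamma_add_div hd hA).mul (differentiableAt_Gamma_add_div hd hB)).div
    ((differentiableAt_Gamma_add_div hd hC).mul (differentiableAt_Gamma_add_div hd hD))
    (mul_ne_zero (Gamma_add_div_ne_zero hd hC) (Gamma_add_div_ne_zero hd hD))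

theorem gammaQuotient_ne_zero {d A B C D : ℝ} (hd : 0 < d) {z : ℂ} (hA : 0 < z.re + A)
    (hB : 0 < z.re + B) (hC : 0 < z.re + C) (hD : 0 < z.re + D) :
    gammaQuotient d A B C D z ≠ 0 :=
  div_ne_zero (mul_ne_zero (Gamma_add_div_ne_zero hd hA) (Gamma_add_div_ne_zero hd hB))
    (mul_ne_zero (Gamma_add_div_ne_zero hd hC) (Gamma_add_div_ne_zero hd hD))

theorem exists_norm_gammaQuotient_le {d : ℝ} (hd : 0 < d) (A B C D : ℝ) :
    ∃ (R M : ℝ) (N : ℕ), 0 ≤ M ∧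
      ∀ z : ℂ, R < z.re → ‖gammaQuotient d A B C D z‖ ≤ M * ‖z‖ ^ N := by
  obtain ⟨R₁, M₁, N₁, hR₁, hM₁, h₁⟩ := exists_norm_Gamma_div_Gamma_le (A / d) (C / d)
  obtain ⟨R₂, M₂, N₂, hR₂, hM₂, h₂⟩ := exists_norm_Gamma_div_Gamma_le (B / d) (D / d)
  refine ⟨d * max R₁ R₂, M₁ * d⁻¹ ^ N₁ * (M₂ * d⁻¹ ^ N₂), N₁ + N₂, by positivity, fun z hz => ?_⟩
  have hre : max R₁ R₂ ≤ (z / d).re := by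
    rw [Complex.div_ofReal_re, le_div_iff₀ hd]
    linarith
  have e : ∀ E : ℝ, (z + E) / d = z / d + ((E / d : ℝ) : ℂ) := by
    intro E
    push_cast
    ring
  have hn : ‖z / (d : ℂ)‖ = d⁻¹ * ‖z‖ := by
    rw [norm_div, Complex.norm_real, Real.norm_of_nonneg hd.le]
    ring
  have h3 := h₁ (z / d) ((le_max_left _ _).trans hre)
  have h4 := h₂ (z / d) ((le_max_right _ _).trans hre)
  rw [hn] at h3 h4
  simp only [gammaQuotient, e]
  rw [mul_div_mul_comm, norm_mul]
  calc _ ≤ (M₁ * (d⁻¹ * ‖z‖) ^ N₁) * (M₂ * (d⁻¹ * ‖z‖) ^ N₂) := by gcongr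
    _ = _ := by ring

/-! ### Solving the recurrence and continuing identities to `Re z ≥ 2` -/

/-- A Mellin transform which satisfies a first-order recurrence along an arithmetic progression is a
multiple of a quotient of Gamma functions. -/
theorem exists_mellinDisk_eq_gammaQuotient {φ : ℝ → ℂ} (hφ : IntegrableProfile φ) {d : ℝ}
    (hd : 0 < d) (A B C D x₀ : ℝ)
    (hrec : ∀ᶠ j : ℕ in atTop, ∀ z : ℂ, z = ((x₀ + d * j : ℝ) : ℂ) →
      (z + A) * (z + B) * mellinDisk φ z = (z + C) * (z + D) * mellinDisk φ (z + d)) :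
    ∃ (c : ℂ) (R : ℝ), ∀ z : ℂ, R < z.re → mellinDisk φ z = c * gammaQuotient d A B C D z := by
  obtain ⟨R₀, M, N, hM, hG⟩ := exists_norm_gammaQuotient_le hd A B C D
  -- To the right of `R` the transform is holomorphic, the Gamma bound holds, and all four linear
  -- factors are nonzero.
  set R : ℝ := 2 + |R₀| + |A| + |B| + |C| + |D| with hRdef
  have hR : 2 ≤ R := by simp only [hRdef]; linarith [abs_nonneg R₀, abs_nonneg A, abs_nonneg B, abs_nonneg C, abs_nonneg D]
  have hRR₀ : R₀ ≤ R := by simp only [hRdef]; linarith [le_abs_self R₀, abs_nonneg A, abs_nonneg B, abs_nonneg C, abs_nonneg D]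
  have hRE : ∀ x : ℝ, R < x → 0 < x + A ∧ 0 < x + B ∧ 0 < x + C ∧ 0 < x + D := by
    intro x hx
    simp only [hRdef] at hx
    refine ⟨?_, ?_, ?_, ?_⟩ <;>
      linarith [abs_nonneg R₀, neg_abs_le A, neg_abs_le B, neg_abs_le C, neg_abs_le D,
        abs_nonneg A, abs_nonneg B, abs_nonneg C, abs_nonneg D]
  have hlarge : ∀ᶠ j : ℕ in atTop, R < x₀ + d * j := by
    have : Tendsto (fun j : ℕ => x₀ + d * (j : ℝ)) atTop atTop :=
      tendsto_atTop_add_const_left _ _ (tendsto_natCast_atTop_atTop.const_mul_atTop hd)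
    exact this.eventually_gt_atTop R
  obtain ⟨J, hJ⟩ := eventually_atTop.1 (hrec.and hlarge)
  set b : ℝ := x₀ + d * J with hb
  have hbR : R < b := (hJ J le_rfl).2
  obtain ⟨hbA, hbB, hbC, hbD⟩ := hRE b hbR
  -- The constant is fixed by the single point `b`; the shared recurrence propagates the equality
  -- along `b + d j`.
  set c := mellinDisk φ b / gammaQuotient d A B C D b
  have hGb : gammaQuotient d A B C D b ≠ 0 :=
    gammaQuotient_ne_zero hd (by simpa using hbA) (by simpa using hbB) (by simpa using hbC)
      (by simpa using hbD)
  have hprog : ∀ j : ℕ, mellinDisk φ (b + d * j : ℝ) =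
      c * gammaQuotient d A B C D (b + d * j : ℝ) := by
    intro j
    induction j with
    | zero =>
      simp only [Nat.cast_zero, mul_zero, add_zero, c]
      field_simp
    | succ j ih =>
      have h1 := (hJ (J + j) (by omega)).1 ((b + d * j : ℝ) : ℂ) (by
        rw [hb]; push_cast; ring)
      have hbj : R < b + d * j := hbR.trans_le (le_add_of_nonneg_right (by positivity))
      obtain ⟨hA, hB, hC, hD⟩ := hRE _ hbj
      have hE : ∀ E : ℝ, 0 < b + d * j + E → ((b + d * j : ℝ) : ℂ) + E ≠ 0 := fun E hE =>
        add_ofReal_ne_zero (by simpa using hE)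
      have h2 := gammaQuotient_recurrence hd A B C D (hE A hA) (hE B hB)
      have h3 : ((b + d * (j + 1 : ℕ) : ℝ) : ℂ) = ((b + d * j : ℝ) : ℂ) + d := by
        push_cast
        ring
      rw [h3]
      rw [ih] at h1
      refine mul_left_cancel₀ (mul_ne_zero (hE C hC) (hE D hD)) ?_
      rw [← h1, mul_left_comm, h2]
      ring
  refine ⟨c, R, fun z hz => ?_⟩
  set I := ∫ r in Ioo (0 : ℝ) 1, ‖φ r * (r : ℂ)‖
  have hI : 0 ≤ I := integral_nonneg fun r => norm_nonneg _
  have := eq_zero_of_polynomial_growth_of_zeros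
    (f := fun z => mellinDisk φ z - c * gammaQuotient d A B C D z) (M := I + ‖c‖ * M) (N := N)
    (by linarith) hbR hd ?_ ?_ (fun j => by rw [hprog, sub_self]) hz
  · exact sub_eq_zero.1 this
  · refine DifferentiableOn.sub ((differentiableOn_mellinDisk hφ).mono fun z hz => ?_)
      (DifferentiableOn.const_mul (fun z hz => ?_) c)
    · exact hR.trans_lt hz
    · obtain ⟨hA, hB, hC, hD⟩ := hRE z.re hz
      exact (differentiableAt_gammaQuotient hd hA hB hC hD).differentiableWithinAt
  · intro z hz
    have hz1 : 1 ≤ ‖z‖ := by linarith [Complex.re_le_norm z]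
    have h1 := norm_mellinDisk_le hφ (z := z) (by linarith)
    have h2 := hG z (by linarith)
    calc _ ≤ ‖mellinDisk φ z‖ + ‖c * gammaQuotient d A B C D z‖ := norm_sub_le _ _
      _ ≤ I * ‖z‖ ^ N + ‖c‖ * (M * ‖z‖ ^ N) := by
        rw [norm_mul]
        gcongr
        exact h1.trans (le_mul_of_one_le_right hI (one_le_pow₀ hz1))
      _ = _ := by ring

/-- The identity theorem covers the open half-plane, and continuity adds the boundary line `Re z =
2`. That line matters because a Gamma factor may have a pole exactly there. -/
theorem eq_of_eq_near_infinity {f g : ℂ → ℂ} (hf : DifferentiableOn ℂ f {z | 2 < z.re})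
    (hf' : ContinuousOn f {z | 2 ≤ z.re}) (hg : DifferentiableOn ℂ g {z | 2 < z.re})
    (hg' : ContinuousOn g {z | 2 ≤ z.re}) {R : ℝ} (h : ∀ z : ℂ, R < z.re → f z = g z) {z : ℂ}
    (hz : 2 ≤ z.re) : f z = g z := by
  have hpre : IsPreconnected {z : ℂ | 2 < z.re} := (convex_halfSpace_re_gt 2).isPreconnected
  set w : ℂ := ((max R 2 + 1 : ℝ) : ℂ)
  have hw : R < w.re ∧ 2 < w.re := by
    simp only [w, Complex.ofReal_re]
    constructor <;> linarith [le_max_left R 2, le_max_right R 2]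
  have h1 : EqOn f g {z | 2 < z.re} :=
    (hf.analyticOnNhd (isOpen_re_gt 2)).eqOn_of_preconnected_of_eventuallyEq
      (hg.analyticOnNhd (isOpen_re_gt 2)) hpre (z₀ := w) hw.2
      (by filter_upwards [(isOpen_re_gt R).mem_nhds hw.1] with z hz using h z hz)
  have h2 : EqOn f g {z | 2 ≤ z.re} := by
    refine h1.of_subset_closure hf' hg' (fun z (hz : 2 < z.re) => hz.le) ?_
    rw [Complex.closure_setOfPred_lt_re]
  exact h2 hz

/-- The multiplier `u` clears denominators, so the identity extends across points where `g / u`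
would be singular. -/
theorem mellinDisk_mul_eq_of_eq_near_infinity {φ : ℝ → ℂ} (hφ : IntegrableProfile φ)
    {u g : ℂ → ℂ} (hu : ∀ z : ℂ, 2 ≤ z.re → DifferentiableAt ℂ u z)
    (hg : ∀ z : ℂ, 2 ≤ z.re → DifferentiableAt ℂ g z) {R : ℝ}
    (h : ∀ z : ℂ, R < z.re → mellinDisk φ z * u z = g z) {z : ℂ} (hz : 2 ≤ z.re) :
    mellinDisk φ z * u z = g z :=
  eq_of_eq_near_infinity (f := fun z => mellinDisk φ z * u z)
    ((differentiableOn_mellinDisk hφ).mul fun z hz =>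
      (hu z (le_of_lt hz)).differentiableWithinAt)
    ((continuousOn_mellinDisk hφ).mul fun z hz => (hu z hz).continuousAt.continuousWithinAt)
    (fun z hz => (hg z (le_of_lt hz)).differentiableWithinAt)
    (fun z hz => (hg z hz).continuousAt.continuousWithinAt) h hz

theorem mellinDisk_sub {φ ψ : ℝ → ℂ} (hφ : IntegrableProfile φ) (hψ : IntegrableProfile ψ) {z : ℂ}
    (hz : 2 ≤ z.re) : mellinDisk (fun r => φ r - ψ r) z = mellinDisk φ z - mellinDisk ψ z := by
  rw [mellinDisk, mellinDisk, mellinDisk,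
    ← integral_sub (hφ.mellin_integrable hz) (hψ.mellin_integrable hz)]
  simp only [sub_mul]

theorem integrableProfile_const_mul_rpow (C : ℂ) {b : ℝ} (hb : 0 ≤ b) :
    IntegrableProfile fun r => C * ((r ^ b : ℝ) : ℂ) := by
  refine ((integrableProfile_rpow (m := b) (by linarith)).const_mul C).congr
    (ae_of_all _ fun r => ?_)
  simp only
  ring

theorem mellinDisk_const_mul_rpow (C : ℂ) {b : ℝ} (hb : 0 ≤ b) {z : ℂ} (hz : 2 ≤ z.re) :
    mellinDisk (fun r => C * ((r ^ b : ℝ) : ℂ)) z = C / (z + b) := by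
  have := mellinDisk_rpow (m := b) (z := z) (by linarith)
  rw [mellinDisk] at this ⊢
  simp only [mul_assoc]
  rw [integral_const_mul, this]
  ring

theorem ae_eq_of_mellinDisk_eq {φ : ℝ → ℂ} (hφ : IntegrableProfile φ) (C : ℂ) {b R : ℝ}
    (hb : 0 ≤ b) (h : ∀ z : ℂ, R < z.re → mellinDisk φ z = C / (z + b)) :
    ∀ᵐ r ∂(volume.restrict (Ioo (0 : ℝ) 1)), φ r = C * ((r ^ b : ℝ) : ℂ) := by
  have hψ := integrableProfile_const_mul_rpow C hb
  have hsub : IntegrableProfile fun r => φ r - C * ((r ^ b : ℝ) : ℂ) := by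
    refine (Integrable.sub hφ hψ).congr (ae_of_all _ fun r => ?_)
    simp only [Pi.sub_apply]
    ring
  have h1 := ae_eq_zero_of_mellinDisk_eq_zero hsub (R := max R 2) fun z hz => by
    have hz1 := (le_max_left R 2).trans_lt hz
    have hz2 := (le_max_right R 2).trans_lt hz
    rw [mellinDisk_sub hφ hψ hz2.le, h z hz1, mellinDisk_const_mul_rpow C hb hz2.le, sub_self]
  filter_upwards [h1] with r hr using sub_eq_zero.1 hr

/-! ### Consequences of the recurrence for `φ` and `m` -/

/-- The recurrence for the Mellin transform of `φ` which expresses that a coefficient of the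
commutator vanishes. -/
def CommRecurrence (a β m : ℝ) (φ : ℝ → ℂ) (z : ℂ) : Prop :=
  (z + β) * (z + (m + a - β : ℝ)) * mellinDisk φ z =
    (z + (2 * a - β : ℝ)) * (z + (m + a + β : ℝ)) * mellinDisk φ (z + (2 * a : ℝ))

theorem exists_mellinDisk_eq_of_commRecurrence {φ : ℝ → ℂ} (hφ : IntegrableProfile φ)
    (hne : ¬ ∀ᵐ r ∂(volume.restrict (Ioo (0 : ℝ) 1)), φ r = 0) {a : ℝ} (ha : 0 < a)
    (β m x₀ : ℝ) (hrec : ∀ᶠ j : ℕ in atTop, CommRecurrence a β m φ ((x₀ + 2 * a * j : ℝ) : ℂ)) :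
    ∃ c : ℂ, c ≠ 0 ∧ ∃ R : ℝ, ∀ z : ℂ, R < z.re → mellinDisk φ z =
      c * gammaQuotient (2 * a) β (m + a - β) (2 * a - β) (m + a + β) z := by
  obtain ⟨c, R, h⟩ := exists_mellinDisk_eq_gammaQuotient hφ (d := 2 * a) (by positivity) β
    (m + a - β) (2 * a - β) (m + a + β) x₀ (by
      filter_upwards [hrec] with j hj z hz
      rw [hz]
      exact hj)
  refine ⟨c, ?_, R, h⟩
  rintro rfl
  exact hne (ae_eq_zero_of_mellinDisk_eq_zero hφ (R := R) fun z hz => by rw [h z hz, zero_mul])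

theorem differentiable_inv_Gamma_add_div (d E : ℝ) :
    Differentiable ℂ fun z : ℂ => (Complex.Gamma ((z + E) / d))⁻¹ :=
  Complex.differentiable_one_div_Gamma.comp (f := fun z : ℂ => (z + E) / (d : ℂ)) (by fun_prop)

theorem Gamma_add_natCast_eq (s : ℂ) (hs : 0 < s.re) (n : ℕ) :
    Complex.Gamma (s + n) = Complex.Gamma s * ∏ j ∈ Finset.range n, (s + j) := by
  induction n with
  | zero => simp
  | succ n ih =>
    have h : s + n ≠ 0 := by
      have := add_ofReal_ne_zero (z := s) (a := n) (by positivity)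
      simpa using this
    rw [Nat.cast_succ, ← add_assoc, Complex.Gamma_add_one _ h, ih, Finset.prod_range_succ]
    ring

/-- Multiplication by the entire function `1/Γ((z+B)/d)` removes the possible poles of one numerator
factor, and `A > -2` keeps the other one holomorphic. At a pole of `Γ((z+B)/d)` the left side is
zero, since `φ̂` is finite, so the right side must vanish too. -/
theorem pole_cancellation {φ : ℝ → ℂ} (hφ : IntegrableProfile φ) {d A B C D : ℝ} (hd : 0 < d)
    (hA : 0 < 2 + A) {c : ℂ} {R : ℝ}
    (h : ∀ z : ℂ, R < z.re → mellinDisk φ z = c * gammaQuotient d A B C D z) {z : ℂ}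
    (hz : 2 ≤ z.re) :
    mellinDisk φ z * (Complex.Gamma ((z + B) / d))⁻¹ = c * (Complex.Gamma ((z + A) / d) *
      ((Complex.Gamma ((z + C) / d))⁻¹ * (Complex.Gamma ((z + D) / d))⁻¹)) := by
  refine mellinDisk_mul_eq_of_eq_near_infinity hφ
    (u := fun z => (Complex.Gamma ((z + B) / d))⁻¹) (g := fun z => c * (Complex.Gamma ((z + A) / d) *
      ((Complex.Gamma ((z + C) / d))⁻¹ * (Complex.Gamma ((z + D) / d))⁻¹)))
    (R := max R (-B)) ?_ ?_ ?_ hz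
  · exact fun z _ => differentiable_inv_Gamma_add_div d B z
  · intro z hz
    exact ((differentiableAt_Gamma_add_div hd (by linarith)).mul
      ((differentiable_inv_Gamma_add_div d C z).mul (differentiable_inv_Gamma_add_div d D z))).const_mul c
  · intro z hz
    have h1 := h z ((le_max_left _ _).trans_lt hz)
    have h2 : Complex.Gamma ((z + B) / d) ≠ 0 :=
      Gamma_add_div_ne_zero hd (by linarith [(le_max_right R (-B)).trans_lt hz])
    rw [h1, gammaQuotient]
    field_simp

theorem mellinDisk_eq_gammaQuotient {φ : ℝ → ℂ} (hφ : IntegrableProfile φ) {d A B C D : ℝ}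
    (hd : 0 < d) (hA : 0 < 2 + A) (hB : 0 < 2 + B) {c : ℂ} {R : ℝ}
    (h : ∀ z : ℂ, R < z.re → mellinDisk φ z = c * gammaQuotient d A B C D z) {z : ℂ}
    (hz : 2 ≤ z.re) : mellinDisk φ z = c * gammaQuotient d A B C D z := by
  have h1 := pole_cancellation hφ hd hA h hz
  have h2 : Complex.Gamma ((z + B) / d) ≠ 0 := Gamma_add_div_ne_zero hd (by linarith)
  rw [← inv_mul_cancel_right₀ h2 (mellinDisk φ z), h1, gammaQuotient]
  ring

theorem gammaQuotient_comm (d A B C D : ℝ) (z : ℂ) :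
    gammaQuotient d A B C D z = gammaQuotient d B A C D z := by
  rw [gammaQuotient, gammaQuotient, mul_comm (Complex.Gamma ((z + A) / d))]

/-- The point `z = b - m - a` is a pole of the second numerator factor and satisfies `Re z ≥ 2`. The
only factor available to cancel it is `1/Γ((a-m)/(2a))`, so `(a-m)/(2a)` is a nonpositive integer.
Here `Complex.Gamma` takes the value `0` exactly at its poles. -/
theorem exists_eq_odd_mul_of_same_sign {φ : ℝ → ℂ} (hφ : IntegrableProfile φ)
    {a b m : ℝ} (ha : 0 < a) (hb : 0 < b) (hge : m + a + 2 ≤ b) {c : ℂ} (hc : c ≠ 0)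
    {R : ℝ} (h : ∀ z : ℂ, R < z.re → mellinDisk φ z =
      c * gammaQuotient (2 * a) b (m + a - b) (2 * a - b) (m + a + b) z) :
    ∃ n : ℕ, m = (2 * n + 1) * a := by
  have h1 := pole_cancellation hφ (by positivity) (by linarith) h
    (z := ((b - m - a : ℝ) : ℂ)) (by simp; linarith)
  have e1 : ((b - m - a : ℝ) : ℂ) + (m + a - b : ℝ) = 0 := by push_cast; ring
  have e2 : (((b - m - a : ℝ) : ℂ) + (2 * a - b : ℝ)) / (2 * a : ℝ) =
      (((a - m) / (2 * a) : ℝ) : ℂ) := by push_cast; ring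
  have h2 : Complex.Gamma ((((b - m - a : ℝ) : ℂ) + b) / (2 * a : ℝ)) ≠ 0 :=
    Gamma_add_div_ne_zero (by positivity) (by simp; linarith)
  have h3 : Complex.Gamma ((((b - m - a : ℝ) : ℂ) + (m + a + b : ℝ)) / (2 * a : ℝ)) ≠ 0 :=
    Gamma_add_div_ne_zero (by positivity) (by simp; linarith)
  rw [e1, zero_div, Complex.Gamma_zero, inv_zero, mul_zero, e2, eq_comm] at h1
  have h4 : Complex.Gamma (((a - m) / (2 * a) : ℝ) : ℂ) = 0 := by
    simp only [mul_eq_zero, inv_eq_zero] at h1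
    tauto
  obtain ⟨n, hn⟩ := Complex.Gamma_eq_zero_iff _ |>.1 h4
  refine ⟨n, ?_⟩
  have h5 : (a - m) / (2 * a) = -n := by exact_mod_cast hn
  rw [div_eq_iff (by positivity)] at h5
  linarith

/-- For `m = (2n+1)a` the Gamma arguments differ pairwise by the integers `n` and `n + 1`, so the
quotient is rational. -/
theorem gammaQuotient_eq_prod {a b : ℝ} (ha : 0 < a) (hb : 0 < b) (n : ℕ) {z : ℂ}
    (hzb : b < z.re) :
    gammaQuotient (2 * a) b ((2 * n + 1) * a + a - b) (2 * a - b) ((2 * n + 1) * a + a + b) z =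
      (∏ j ∈ Finset.Icc 1 n, ((z - b) / (2 * a) + j)) /
        ∏ j ∈ Finset.Icc 0 n, ((z + b) / (2 * a) + j) := by
  have ha' : (a : ℂ) ≠ 0 := Complex.ofReal_ne_zero.2 ha.ne'
  have hs : 0 < ((z + b) / (2 * a : ℝ)).re := re_add_div_pos (by positivity) (by linarith)
  have hs' : 0 < ((z - b) / (2 * a : ℝ) + 1).re := by
    have := re_add_div_pos (d := 2 * a) (E := -b) (z := z) (by positivity) (by linarith)
    push_cast at this ⊢
    rw [← sub_eq_add_neg] at this
    rw [Complex.add_re, Complex.one_re]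
    linarith
  have e1 : (z + ((2 * n + 1) * a + a - b : ℝ)) / (2 * a : ℝ) =
      (z - b) / (2 * a : ℝ) + 1 + n := by
    push_cast
    field_simp
    ring
  have e2 : (z + (2 * a - b : ℝ)) / (2 * a : ℝ) = (z - b) / (2 * a : ℝ) + 1 := by
    push_cast
    field_simp
    ring
  have e3 : (z + ((2 * n + 1) * a + a + b : ℝ)) / (2 * a : ℝ) =
      (z + b) / (2 * a : ℝ) + (n + 1 : ℕ) := by
    push_cast
    field_simp
    ring
  have e4 : ∏ j ∈ Finset.Icc 1 n, ((z - b) / (2 * a) + j) =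
      ∏ j ∈ Finset.range n, ((z - b) / (2 * a : ℝ) + 1 + j) := by
    rw [← Finset.Ico_succ_right_eq_Icc, Finset.prod_Ico_eq_prod_range]
    refine Finset.prod_congr (by simp) fun j _ => ?_
    push_cast
    ring
  have e5 : ∏ j ∈ Finset.Icc 0 n, ((z + b) / (2 * a) + j) =
      ∏ j ∈ Finset.range (n + 1), ((z + b) / (2 * a : ℝ) + j) := by
    rw [← Finset.Ico_succ_right_eq_Icc, ← Finset.range_eq_Ico]
    refine Finset.prod_congr (by simp) fun j _ => ?_
    push_cast
    ring
  rw [gammaQuotient, e1, e2, e3, Gamma_add_natCast_eq _ hs', Gamma_add_natCast_eq _ hs, e4, e5]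
  have h1 := Complex.Gamma_ne_zero_of_re_pos hs
  have h2 := Complex.Gamma_ne_zero_of_re_pos hs'
  rw [mul_left_comm, mul_div_mul_left _ _ h2, mul_div_mul_left _ _ h1]

theorem prod_add_ne_zero {a b : ℝ} (ha : 0 < a) (n : ℕ) {z : ℂ}
    (hz : 0 < z.re + b) : ∏ j ∈ Finset.Icc 0 n, ((z + b) / (2 * a) + j) ≠ 0 := by
  refine Finset.prod_ne_zero_iff.2 fun j _ => ?_
  have h1 := re_add_div_pos (d := 2 * a) (by positivity) hz
  have h2 := add_ofReal_ne_zero (z := (z + b) / (2 * a : ℝ)) (a := j) (by positivity)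
  simpa using h2

/-- To the left of `b` the Gamma factors may sit at poles. The rational identity, with its
denominator cleared, continues to the whole of `Re z ≥ 2`. -/
theorem mellinDisk_eq_prod_of_same_sign {φ : ℝ → ℂ} (hφ : IntegrableProfile φ)
    {a b : ℝ} (ha : 0 < a) (hb : 0 < b) (n : ℕ) {c : ℂ}
    {R : ℝ} (h : ∀ z : ℂ, R < z.re → mellinDisk φ z =
      c * gammaQuotient (2 * a) b ((2 * n + 1) * a + a - b) (2 * a - b)
        ((2 * n + 1) * a + a + b) z) {z : ℂ} (hz : 2 ≤ z.re) :
    mellinDisk φ z = c * (∏ j ∈ Finset.Icc 1 n, ((z - b) / (2 * a) + j)) /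
        ∏ j ∈ Finset.Icc 0 n, ((z + b) / (2 * a) + j) := by
  rw [eq_div_iff (prod_add_ne_zero ha n (by linarith))]
  refine mellinDisk_mul_eq_of_eq_near_infinity hφ
    (u := fun z => ∏ j ∈ Finset.Icc 0 n, ((z + b) / (2 * a) + j))
    (g := fun z => c * ∏ j ∈ Finset.Icc 1 n, ((z - b) / (2 * a) + j)) (R := max R b)
    (fun z _ => by fun_prop) (fun z _ => by fun_prop) ?_ hz
  intro z hz
  have h1 := (le_max_left _ _).trans_lt hz
  have h3 := (le_max_right _ _).trans_lt hz
  rw [h z h1, gammaQuotient_eq_prod ha hb n h3, mul_assoc,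
    div_mul_cancel₀ _ (prod_add_ne_zero ha n (by linarith))]

/-- Since `b ≥ 2`, the pole of `Γ((z-b)/(2a))` at `z = b` must be cancelled. All other arguments
there are positive except possibly `(m+a)/(2a)`, so `m + a` cannot be positive. The two numerator
parameters are swapped first to put the polar factor in the slot that `pole_cancellation` inverts.
-/
theorem add_eq_zero_of_opposite_sign {φ : ℝ → ℂ} (hφ : IntegrableProfile φ)
    {a b m : ℝ} (ha : 0 < a) (hb : 2 ≤ b) (hma : 0 ≤ m + a) {c : ℂ} (hc : c ≠ 0)
    {R : ℝ} (h : ∀ z : ℂ, R < z.re → mellinDisk φ z =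
      c * gammaQuotient (2 * a) (-b) (m + a - -b) (2 * a - -b) (m + a + -b) z) :
    m + a = 0 := by
  simp only [gammaQuotient_comm (2 * a) (-b)] at h
  have h1 := pole_cancellation hφ (by positivity) (by linarith) h (z := (b : ℂ)) (by simpa using hb)
  have e1 : (b : ℂ) + (-b : ℝ) = 0 := by push_cast; ring
  have h2 : Complex.Gamma (((b : ℂ) + (m + a - -b : ℝ)) / (2 * a : ℝ)) ≠ 0 :=
    Gamma_add_div_ne_zero (by positivity) (by simp; linarith)
  have h3 : Complex.Gamma (((b : ℂ) + (2 * a - -b : ℝ)) / (2 * a : ℝ)) ≠ 0 :=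
    Gamma_add_div_ne_zero (by positivity) (by simp; linarith)
  rw [e1, zero_div, Complex.Gamma_zero, inv_zero, mul_zero, eq_comm] at h1
  have h4 : Complex.Gamma (((b : ℂ) + (m + a + -b : ℝ)) / (2 * a : ℝ)) = 0 := by
    by_contra h5
    simp only [mul_eq_zero, inv_eq_zero] at h1
    tauto
  by_contra h5
  exact Gamma_add_div_ne_zero (by positivity)
    (by simp; exact lt_of_le_of_ne hma (Ne.symm h5)) h4

/-- With `m + a = 0` two Gamma factors cancel and the quotient is `2a/(z+b)`, the transform of a
multiple of `r^b`. -/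
theorem ae_eq_rpow_of_opposite_sign {φ : ℝ → ℂ} (hφ : IntegrableProfile φ)
    {a b : ℝ} (ha : 0 < a) (hb : 0 ≤ b) {c : ℂ}
    {R : ℝ} (h : ∀ z : ℂ, R < z.re → mellinDisk φ z =
      c * gammaQuotient (2 * a) (-b) (0 - -b) (2 * a - -b) (0 + -b) z) :
    ∀ᵐ r ∂(volume.restrict (Ioo (0 : ℝ) 1)), φ r = c * (2 * a) * ((r ^ b : ℝ) : ℂ) := by
  refine ae_eq_of_mellinDisk_eq hφ (c * (2 * a)) hb (R := max R b) fun z hz => ?_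
  have h1 := (le_max_left _ _).trans_lt hz
  have h2 := (le_max_right _ _).trans_lt hz
  have ha' : (a : ℂ) ≠ 0 := Complex.ofReal_ne_zero.2 ha.ne'
  have hzb : z + b ≠ 0 := add_ofReal_ne_zero (by linarith)
  have h3 : Complex.Gamma ((z + (-b : ℝ)) / (2 * a : ℝ)) ≠ 0 :=
    Gamma_add_div_ne_zero (by positivity) (by linarith)
  have h4 : Complex.Gamma ((z + b) / (2 * a : ℝ)) ≠ 0 :=
    Gamma_add_div_ne_zero (by positivity) (by linarith)
  have h5 : (z + b) / (2 * a : ℝ) ≠ 0 := div_ne_zero hzb (by push_cast; simp [ha'])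
  have e : (z + (2 * a - -b : ℝ)) / (2 * a : ℝ) = (z + b) / (2 * a : ℝ) + 1 := by
    push_cast
    field_simp
    ring
  rw [h z h1, gammaQuotient, e, Complex.Gamma_add_one _ h5, zero_sub, neg_neg, zero_add]
  push_cast at h3 h4 ⊢
  field_simp

theorem commRecurrence_of_mellinDisk_eq {φ : ℝ → ℂ} {a β m : ℝ} (ha : 0 < a) {c : ℂ}
    (h : ∀ z : ℂ, 2 ≤ z.re → mellinDisk φ z =
      c * gammaQuotient (2 * a) β (m + a - β) (2 * a - β) (m + a + β) z) {z : ℂ} (hz : 2 ≤ z.re)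
    (hβ : 0 < z.re + β) (hβ' : 0 < z.re + (m + a - β)) : CommRecurrence a β m φ z := by
  have h1 := gammaQuotient_recurrence (d := 2 * a) (by positivity) β (m + a - β) (2 * a - β)
    (m + a + β) (add_ofReal_ne_zero hβ) (add_ofReal_ne_zero hβ')
  rw [CommRecurrence, h z hz, h (z + (2 * a : ℝ)) (by simp; linarith), mul_left_comm, h1]
  ring

theorem commRecurrence_of_mellinDisk_eq_prod {φ : ℝ → ℂ} {a b : ℝ} (ha : 0 < a) (hb : 0 < b)
    (n : ℕ) {c : ℂ} (h : ∀ z : ℂ, 2 ≤ z.re → mellinDisk φ z =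
      c * (∏ j ∈ Finset.Icc 1 n, ((z - b) / (2 * a) + j)) /
        ∏ j ∈ Finset.Icc 0 n, ((z + b) / (2 * a) + j)) {z : ℂ} (hz : 2 ≤ z.re) (hzb : b < z.re) :
    CommRecurrence a b ((2 * n + 1) * a) φ z := by
  have hG : ∀ z : ℂ, 2 ≤ z.re → b < z.re → mellinDisk φ z = c * gammaQuotient (2 * a) b
      ((2 * n + 1) * a + a - b) (2 * a - b) ((2 * n + 1) * a + a + b) z := by
    intro z hz hzb
    rw [h z hz, gammaQuotient_eq_prod ha hb n hzb, mul_div_assoc]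
  have h1 := gammaQuotient_recurrence (d := 2 * a) (z := z) (by positivity) b
    ((2 * n + 1) * a + a - b) (2 * a - b) ((2 * n + 1) * a + a + b)
    (add_ofReal_ne_zero (by linarith)) (add_ofReal_ne_zero (by
      have : 0 ≤ (2 * (n : ℝ) + 1) * a := by positivity
      linarith))
  rw [CommRecurrence, hG z hz hzb, hG (z + (2 * a : ℝ)) (by simp; linarith) (by simp; linarith),
    mul_left_comm, h1]
  ring

/-! ### The commutator as a weighted shift, and its rank -/

/-- The coefficient of `z ^ (n + k₁ + k₂)` in the image of `z ^ n` under the commutator of two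
quasihomogeneous Toeplitz operators. -/
def commCoeff (k₁ k₂ : ℤ) (φ ψ : ℝ → ℂ) (n : ℕ) : ℂ :=
  toeplitzCoeff k₂ ψ n * toeplitzCoeff k₁ φ (n + k₂).toNat -
    toeplitzCoeff k₁ φ n * toeplitzCoeff k₂ ψ (n + k₁).toNat

/-- The two exponents can differ only when the intermediate degree is negative and truncated to `0`,
and then the coefficient vanishes. -/
theorem toeplitzCoeff_smul_bergmanPow (k l : ℤ) (φ : ℝ → ℂ) (c : ℕ → ℂ) (n : ℕ) :
    (toeplitzCoeff k φ n * c (n + k).toNat) • bergmanPow ((n + k).toNat + l).toNat =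
      (toeplitzCoeff k φ n * c (n + k).toNat) • bergmanPow (n + k + l).toNat := by
  by_cases h : 0 ≤ (n : ℤ) + k
  · rw [Int.toNat_of_nonneg h]
  · rw [toeplitzCoeff, if_neg h, zero_mul, zero_smul, zero_smul]

theorem commutator_bergmanPow {k₁ k₂ : ℤ} {φ ψ : ℝ → ℂ} {A B : bergmanSpace →L[ℂ] bergmanSpace}
    (hA : ∀ n, A (bergmanPow n) = toeplitzCoeff k₁ φ n • bergmanPow (n + k₁).toNat)
    (hB : ∀ n, B (bergmanPow n) = toeplitzCoeff k₂ ψ n • bergmanPow (n + k₂).toNat) (n : ℕ) :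
    commutator A B (bergmanPow n) =
      commCoeff k₁ k₂ φ ψ n • bergmanPow (n + k₁ + k₂).toNat := by
  have h1 : commutator A B (bergmanPow n) = A (B (bergmanPow n)) - B (A (bergmanPow n)) := rfl
  rw [h1, hB, hA, map_smul, map_smul, hA, hB, smul_smul, smul_smul,
    toeplitzCoeff_smul_bergmanPow, toeplitzCoeff_smul_bergmanPow, add_right_comm (n : ℤ) k₂ k₁,
    ← sub_smul]
  rfl

theorem bergmanPow_ne_zero (n : ℕ) : bergmanPow n ≠ 0 := by
  intro h0
  have h5 := inner_bergmanPow_bergmanPow n n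
  rw [h0, inner_zero_left, if_pos rfl, eq_comm, div_eq_zero_iff] at h5
  have : (n : ℂ) + 1 ≠ 0 := by exact_mod_cast Nat.succ_ne_zero n
  simp [this] at h5

theorem eventually_eq_zero_of_isFiniteRank {K : bergmanSpace →L[ℂ] bergmanSpace} {κ : ℕ → ℂ}
    {k : ℤ} (hK : ∀ n, K (bergmanPow n) = κ n • bergmanPow (n + k).toNat) (h : IsFiniteRank K) :
    ∀ᶠ n in atTop, κ n = 0 := by
  set V := LinearMap.range (K : bergmanSpace →ₗ[ℂ] bergmanSpace)
  have hfin : FiniteDimensional ℂ V := by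
    have : FiniteDimensional ℂ V.topologicalClosure := h
    exact Submodule.finiteDimensional_of_le V.le_topologicalClosure
  -- The condition `0 ≤ n + k` makes `n ↦ (n + k).toNat` injective on `S`, so the images are
  -- multiples of distinct basis vectors.
  set S : Set ℕ := {n | 0 ≤ (n : ℤ) + k ∧ κ n ≠ 0}
  have hmem : ∀ n : S, bergmanUnit ((n : ℕ) + k).toNat ∈ V := by
    rintro ⟨n, hn⟩
    refine ⟨((√(((n + k).toNat : ℕ) + 1 : ℝ) : ℂ) * (κ n)⁻¹) • bergmanPow n, ?_⟩
    change K _ = _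
    rw [map_smul, hK, smul_smul, mul_assoc, inv_mul_cancel₀ hn.2, mul_one]
    rfl
  have hli : LinearIndependent ℂ fun n : S => (⟨bergmanUnit ((n : ℕ) + k).toNat, hmem n⟩ : V) := by
    refine LinearIndependent.of_comp V.subtype ?_
    refine (orthonormal_bergmanUnit.comp (fun n : S => ((n : ℕ) + k).toNat) ?_).linearIndependent
    rintro ⟨i, hi⟩ ⟨j, hj⟩ hij
    have h1 := hi.1
    have h2 := hj.1
    simp only at hij
    exact Subtype.ext (by simp only; omega)
  have hS : S.Finite := Cardinal.lt_aleph0_iff_set_finite.mp hli.lt_aleph0_of_finite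
  obtain ⟨N, hN⟩ := hS.bddAbove
  -- Beyond `|k|` the degree is nonnegative, so a nonzero weight would put `n` in `S`, against the
  -- bound `N`.
  filter_upwards [eventually_gt_atTop (max N k.natAbs)] with n hn
  by_contra hκ
  have h1 := hN (show n ∈ S from ⟨by omega, hκ⟩)
  omega

theorem eq_zero_of_coeff_eq_zero {K : bergmanSpace →L[ℂ] bergmanSpace} {κ : ℕ → ℂ}
    {k : ℤ} (hK : ∀ n, K (bergmanPow n) = κ n • bergmanPow (n + k).toNat) (h : ∀ n, κ n = 0) :
    K = 0 :=
  bergman_clm_ext fun n => by rw [hK, h, zero_smul, zero_apply]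

theorem isFiniteRank_zero : IsFiniteRank 0 := by
  have h : LinearMap.range ((0 : bergmanSpace →L[ℂ] bergmanSpace) :
      bergmanSpace →ₗ[ℂ] bergmanSpace) = ⊥ := LinearMap.range_zero
  rw [IsFiniteRank, h, (Submodule.closed_of_finiteDimensional ⊥).submodule_topologicalClosure_eq]
  infer_instance

/-- The factor `N + 1` compensates for the squared norm `1/(N+1)` of `z^N`. -/
theorem eq_smul_rankOne_of_coeff {K : bergmanSpace →L[ℂ] bergmanSpace} {κ : ℕ → ℂ}
    {k : ℤ} (hK : ∀ n, K (bergmanPow n) = κ n • bergmanPow (n + k).toNat) (N : ℕ)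
    (h : ∀ n ≠ N, κ n = 0) :
    K = (κ N * (N + 1)) • InnerProductSpace.rankOne ℂ (bergmanPow (N + k).toNat) (bergmanPow N) := by
  refine bergman_clm_ext fun n => ?_
  rw [smul_apply, InnerProductSpace.rankOne_apply, inner_bergmanPow_bergmanPow,
    hK]
  by_cases hn : N = n
  · subst hn
    have : (N : ℂ) + 1 ≠ 0 := by exact_mod_cast Nat.succ_ne_zero N
    rw [if_pos rfl, smul_smul]
    congr 1
    field_simp
  · rw [if_neg hn, h n (Ne.symm hn), zero_smul, zero_smul, smul_zero]

theorem range_smul_rankOne {C : ℂ} (hC : C ≠ 0) (n N : ℕ) :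
    LinearMap.range ((C • InnerProductSpace.rankOne ℂ (bergmanPow n) (bergmanPow N) :
      bergmanSpace →L[ℂ] bergmanSpace) : bergmanSpace →ₗ[ℂ] bergmanSpace) =
      Submodule.span ℂ {bergmanPow n} := by
  refine le_antisymm ?_ ?_
  · rintro _ ⟨f, rfl⟩
    change C • InnerProductSpace.rankOne ℂ (bergmanPow n) (bergmanPow N) f ∈ _
    rw [InnerProductSpace.rankOne_apply]
    exact Submodule.smul_mem _ _ (Submodule.smul_mem _ _ (Submodule.mem_span_singleton_self _))
  · rw [Submodule.span_singleton_le_iff_mem]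
    refine ⟨(C⁻¹ * (N + 1)) • bergmanPow N, ?_⟩
    change C • InnerProductSpace.rankOne ℂ (bergmanPow n) (bergmanPow N)
      ((C⁻¹ * (N + 1)) • bergmanPow N) = _
    have : (N : ℂ) + 1 ≠ 0 := by exact_mod_cast Nat.succ_ne_zero N
    rw [map_smul, InnerProductSpace.rankOne_apply, inner_bergmanPow_bergmanPow, if_pos rfl,
      smul_smul, smul_smul]
    have h : C * (C⁻¹ * (N + 1)) * (1 / ((N : ℂ) + 1)) = 1 := by field_simp
    rw [h, one_smul]

theorem isFiniteRank_of_range_eq_span {K : bergmanSpace →L[ℂ] bergmanSpace} {f : bergmanSpace}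
    (h : LinearMap.range (K : bergmanSpace →ₗ[ℂ] bergmanSpace) = Submodule.span ℂ {f}) :
    IsFiniteRank K := by
  rw [IsFiniteRank, h,
    (Submodule.closed_of_finiteDimensional (Submodule.span ℂ {f})).submodule_topologicalClosure_eq]
  infer_instance

theorem rank_eq_one_of_range_eq_span {K : bergmanSpace →L[ℂ] bergmanSpace} {f : bergmanSpace}
    (hf : f ≠ 0)
    (h : LinearMap.range (K : bergmanSpace →ₗ[ℂ] bergmanSpace) = Submodule.span ℂ {f}) :
    LinearMap.rank (K : bergmanSpace →ₗ[ℂ] bergmanSpace) = 1 := by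
  rw [LinearMap.rank, h, ← Module.finrank_eq_rank, finrank_span_singleton hf, Nat.cast_one]

/-! ### Vanishing of the commutator weights -/

theorem toeplitzCoeff_rpow {k : ℤ} {m : ℝ} (hm : -1 ≤ m) {n : ℕ} (h : 0 ≤ n + k) :
    toeplitzCoeff k (fun r => ((r ^ m : ℝ) : ℂ)) n =
      ((2 * (n + k + 1) / (2 * n + k + 2 + m) : ℝ) : ℂ) := by
  have h' : (0 : ℝ) ≤ n + k := by exact_mod_cast h
  have hn : (0 : ℝ) ≤ n := Nat.cast_nonneg n
  have h2 : (2 * n + k + 2 : ℂ) = ((2 * n + k + 2 : ℝ) : ℂ) := by push_cast; ring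
  rw [toeplitzCoeff, if_pos h, h2, mellinDisk_rpow (by rw [Complex.ofReal_re]; linarith)]
  push_cast
  ring

theorem toeplitzCoeff_of_neg {k : ℤ} (φ : ℝ → ℂ) {n : ℕ} (h : (n : ℤ) + k < 0) :
    toeplitzCoeff k φ n = 0 := if_neg (by omega)

theorem toeplitzCoeff_rpow_ne_zero {k : ℤ} {m : ℝ} (hm : -1 ≤ m) {n : ℕ} (h : 0 ≤ n + k) :
    toeplitzCoeff k (fun r => ((r ^ m : ℝ) : ℂ)) n ≠ 0 := by
  have h' : (0 : ℝ) ≤ n + k := by exact_mod_cast h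
  have hn : (0 : ℝ) ≤ n := Nat.cast_nonneg n
  rw [toeplitzCoeff_rpow hm h, Complex.ofReal_ne_zero]
  exact div_ne_zero (by linarith) (by linarith)

theorem commCoeff_of_neg {k₁ k₂ : ℤ} (φ ψ : ℝ → ℂ) {n : ℕ} (h : (n : ℤ) + k₁ + k₂ < 0) :
    commCoeff k₁ k₂ φ ψ n = 0 := by
  have h1 : toeplitzCoeff k₂ ψ n * toeplitzCoeff k₁ φ (n + k₂).toNat = 0 := by
    by_cases hn : (n : ℤ) + k₂ < 0
    · rw [toeplitzCoeff_of_neg ψ hn, zero_mul]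
    · rw [toeplitzCoeff_of_neg φ (n := (n + k₂).toNat) (by omega), mul_zero]
  have h2 : toeplitzCoeff k₁ φ n * toeplitzCoeff k₂ ψ (n + k₁).toNat = 0 := by
    by_cases hn : (n : ℤ) + k₁ < 0
    · rw [toeplitzCoeff_of_neg φ hn, zero_mul]
    · rw [toeplitzCoeff_of_neg ψ (n := (n + k₁).toNat) (by omega), mul_zero]
  rw [commCoeff, h1, h2, sub_zero]

theorem intCast_toNat_complex {a : ℤ} (h : 0 ≤ a) : ((a.toNat : ℕ) : ℂ) = a := by
  exact_mod_cast congrArg (Int.cast : ℤ → ℂ) (Int.toNat_of_nonneg h)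

theorem intCast_toNat_real {a : ℤ} (h : 0 ≤ a) : ((a.toNat : ℕ) : ℝ) = a := by
  exact_mod_cast congrArg (Int.cast : ℤ → ℝ) (Int.toNat_of_nonneg h)

theorem commCoeff_eq {k₁ k₂ : ℤ} {m : ℝ} (hm : -1 ≤ m) (φ : ℝ → ℂ) {n : ℕ} (h₁ : 0 ≤ n + k₁)
    (h₂ : 0 ≤ n + k₂) (h₃ : 0 ≤ n + k₁ + k₂) :
    commCoeff k₁ k₂ (fun r => ((r ^ m : ℝ) : ℂ)) φ n =
      4 * (n + k₁ + k₂ + 1) / (((2 * n + 2 * k₂ + k₁ + 2 + m : ℝ) : ℂ) *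
        ((2 * n + k₁ + 2 + m : ℝ) : ℂ)) *
      ((n + k₂ + 1) * (2 * n + k₁ + 2 + m) * mellinDisk φ (2 * n + k₂ + 2) -
        (n + k₁ + 1) * (2 * n + 2 * k₂ + k₁ + 2 + m) *
          mellinDisk φ (2 * n + 2 * k₁ + k₂ + 2)) := by
  have h₁' : (0 : ℝ) ≤ n + k₁ := by exact_mod_cast h₁
  have h₂' : (0 : ℝ) ≤ n + k₂ := by exact_mod_cast h₂
  have h₃' : (0 : ℝ) ≤ n + k₁ + k₂ := by exact_mod_cast h₃
  have hn : (0 : ℝ) ≤ n := Nat.cast_nonneg n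
  have hd1 : ((2 * n + 2 * k₂ + k₁ + 2 + m : ℝ) : ℂ) ≠ 0 := by
    rw [Complex.ofReal_ne_zero]
    linarith
  have hd2 : ((2 * n + k₁ + 2 + m : ℝ) : ℂ) ≠ 0 := by
    rw [Complex.ofReal_ne_zero]
    linarith
  rw [commCoeff, toeplitzCoeff_rpow hm h₁, toeplitzCoeff_rpow hm (n := (n + k₂).toNat) (by omega),
    toeplitzCoeff, if_pos h₂, toeplitzCoeff, if_pos (by omega), intCast_toNat_real h₂,
    intCast_toNat_complex h₁]
  have e1 : (2 * ((n + k₁ : ℤ) : ℂ) + k₂ + 2) = 2 * n + 2 * k₁ + k₂ + 2 := by push_cast; ring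
  have e2 : (2 * ((n + k₂ : ℤ) : ℝ) + k₁ + 2 + m) = 2 * n + 2 * k₂ + k₁ + 2 + m := by
    push_cast; ring
  have e3 : (2 * n + 2 * k₂ + k₁ + 2 + m : ℂ) = ((2 * n + 2 * k₂ + k₁ + 2 + m : ℝ) : ℂ) := by
    push_cast; ring
  have e4 : (2 * n + k₁ + 2 + m : ℂ) = ((2 * n + k₁ + 2 + m : ℝ) : ℂ) := by push_cast; ring
  rw [e1, e2, e3, e4, Complex.ofReal_div, Complex.ofReal_div]
  generalize ((2 * n + 2 * k₂ + k₁ + 2 + m : ℝ) : ℂ) = D₁ at *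
  generalize ((2 * n + k₁ + 2 + m : ℝ) : ℂ) = D₂ at *
  push_cast
  field_simp
  ring

theorem commCoeff_prefactor_ne_zero {k₁ k₂ : ℤ} {m : ℝ} (hm : -1 ≤ m) {n : ℕ} (h₁ : 0 ≤ n + k₁)
    (h₂ : 0 ≤ n + k₂) (h₃ : 0 ≤ n + k₁ + k₂) :
    (4 * (n + k₁ + k₂ + 1) / (((2 * n + 2 * k₂ + k₁ + 2 + m : ℝ) : ℂ) *
        ((2 * n + k₁ + 2 + m : ℝ) : ℂ))) ≠ 0 := by
  have h₁' : (0 : ℝ) ≤ n + k₁ := by exact_mod_cast h₁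
  have h₂' : (0 : ℝ) ≤ n + k₂ := by exact_mod_cast h₂
  have h₃' : (0 : ℝ) ≤ n + k₁ + k₂ := by exact_mod_cast h₃
  have hn : (0 : ℝ) ≤ n := Nat.cast_nonneg n
  have e : (n + k₁ + k₂ + 1 : ℂ) = ((n + k₁ + k₂ + 1 : ℝ) : ℂ) := by push_cast; ring
  refine div_ne_zero (mul_ne_zero (by norm_num) ?_) (mul_ne_zero ?_ ?_)
  · rw [e, Complex.ofReal_ne_zero]
    linarith
  all_goals
    rw [Complex.ofReal_ne_zero]
    linarith

theorem commCoeff_eq_zero_iff {k₁ k₂ : ℤ} {m : ℝ} (hm : -1 ≤ m) (φ : ℝ → ℂ) {n : ℕ}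
    (h₁ : 0 ≤ n + k₁) (h₂ : 0 ≤ n + k₂) (h₃ : 0 ≤ n + k₁ + k₂) :
    commCoeff k₁ k₂ (fun r => ((r ^ m : ℝ) : ℂ)) φ n = 0 ↔
      CommRecurrence k₁ k₂ m φ ((2 * n + k₂ + 2 : ℝ) : ℂ) := by
  rw [commCoeff_eq hm φ h₁ h₂ h₃, mul_eq_zero,
    or_iff_right (commCoeff_prefactor_ne_zero hm h₁ h₂ h₃), sub_eq_zero, CommRecurrence]
  have e1 : ((2 * n + k₂ + 2 : ℝ) : ℂ) + (2 * k₁ : ℝ) = 2 * n + 2 * k₁ + k₂ + 2 := by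
    push_cast; ring
  rw [e1]
  push_cast
  constructor <;> intro h
  · linear_combination 2 * h
  · linear_combination h / 2

/-- For `k₁ < 0` the identity is read from its other Mellin argument, so that the step `-2k₁` is
positive. -/
theorem commCoeff_eq_zero_iff_neg {k₁ k₂ : ℤ} {m : ℝ} (hm : -1 ≤ m) (φ : ℝ → ℂ) {n : ℕ}
    (h₁ : 0 ≤ n + k₁) (h₂ : 0 ≤ n + k₂) (h₃ : 0 ≤ n + k₁ + k₂) :
    commCoeff k₁ k₂ (fun r => ((r ^ m : ℝ) : ℂ)) φ n = 0 ↔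
      CommRecurrence (-k₁) (-k₂) m φ ((2 * n + 2 * k₁ + k₂ + 2 : ℝ) : ℂ) := by
  rw [commCoeff_eq hm φ h₁ h₂ h₃, mul_eq_zero,
    or_iff_right (commCoeff_prefactor_ne_zero hm h₁ h₂ h₃), sub_eq_zero, CommRecurrence]
  have e1 : ((2 * n + 2 * k₁ + k₂ + 2 : ℝ) : ℂ) + (2 * -k₁ : ℝ) = 2 * n + k₂ + 2 := by
    push_cast; ring
  rw [e1]
  push_cast
  constructor <;> intro h
  · linear_combination -2 * h
  · linear_combination -h / 2

/-- For equal signs a nonnegative final degree forces nonnegative intermediate degrees, so no weight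
is exceptional. The argument of the recurrence is then at least `|k₂| + 2` for either sign. -/
theorem commCoeff_eq_zero_of_same_sign {k₁ k₂ : ℤ} (hk : 0 < k₁ * k₂) {m : ℝ} (hm : -1 ≤ m)
    {φ : ℝ → ℂ} (h : ∀ x : ℝ, ((|k₂| : ℤ) : ℝ) + 2 ≤ x →
      CommRecurrence ((|k₁| : ℤ) : ℝ) ((|k₂| : ℤ) : ℝ) m φ x) (n : ℕ) :
    commCoeff k₁ k₂ (fun r => ((r ^ m : ℝ) : ℂ)) φ n = 0 := by
  by_cases hn : (n : ℤ) + k₁ + k₂ < 0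
  · exact commCoeff_of_neg _ _ hn
  have hnr : (0 : ℝ) ≤ n := Nat.cast_nonneg n
  rcases mul_pos_iff.1 hk with ⟨h1, h2⟩ | ⟨h1, h2⟩
  · rw [abs_of_pos h1, abs_of_pos h2] at h
    exact (commCoeff_eq_zero_iff hm φ (by omega) (by omega) (by omega)).2 (h _ (by linarith))
  · rw [abs_of_neg h1, abs_of_neg h2] at h
    have h3 : (0 : ℝ) ≤ n + k₁ + k₂ := by exact_mod_cast not_lt.1 hn
    have h4 := h (2 * n + 2 * k₁ + k₂ + 2) (by push_cast; linarith)
    push_cast at h4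
    refine (commCoeff_eq_zero_iff_neg hm φ (by omega) (by omega) (by omega)).2 ?_
    push_cast
    exact h4

/-- The exceptional `n`, with nonnegative final degree but a negative intermediate one, number
`min(|k₁|, |k₂|)`, and the largest is `max(-k₁, -k₂) - 1`. If one degree is `±1` there is no other.
-/
theorem commCoeff_eq_zero_of_opposite_sign {k₁ k₂ : ℤ} (hk : k₁ * k₂ < 0) {m : ℝ} (hm : -1 ≤ m)
    {φ : ℝ → ℂ} (h : ∀ x : ℝ, ((|k₂| : ℤ) : ℝ) + 2 ≤ x →
      CommRecurrence ((|k₁| : ℤ) : ℝ) (-((|k₂| : ℤ) : ℝ)) m φ x) (h1 : |k₁| = 1 ∨ |k₂| = 1) (n : ℕ)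
    (hn : n ≠ (max (-k₁) (-k₂) - 1).toNat) :
    commCoeff k₁ k₂ (fun r => ((r ^ m : ℝ) : ℂ)) φ n = 0 := by
  by_cases hn' : (n : ℤ) + k₁ + k₂ < 0
  · exact commCoeff_of_neg _ _ hn'
  rcases mul_neg_iff.1 hk with ⟨h2, h3⟩ | ⟨h2, h3⟩
  · rw [abs_of_pos h2, abs_of_neg h3] at h h1
    rw [max_eq_right (by omega)] at hn
    have h4 : 0 ≤ n + k₂ := by omega
    have h5 : (0 : ℝ) ≤ n + k₂ := by exact_mod_cast h4
    refine (commCoeff_eq_zero_iff hm φ (by omega) (by omega) (by omega)).2 ?_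
    have h6 := h (2 * n + k₂ + 2) (by push_cast; linarith)
    push_cast at h6 ⊢
    rwa [neg_neg] at h6
  · rw [abs_of_neg h2, abs_of_pos h3] at h h1
    rw [max_eq_left (by omega)] at hn
    have h4 : 0 ≤ n + k₁ := by omega
    have h5 : (0 : ℝ) ≤ n + k₁ := by exact_mod_cast h4
    refine (commCoeff_eq_zero_iff_neg hm φ (by omega) (by omega) (by omega)).2 ?_
    have h6 := h (2 * n + 2 * k₁ + k₂ + 2) (by linarith)
    push_cast at h6 ⊢
    exact h6

/-- At this index one order of the operators passes through degree `-1` and contributes zero. The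
surviving product contains `φ̂(2|k₁| + |k₂|)` for both sign patterns. -/
theorem commCoeff_ne_zero_of_opposite_sign {k₁ k₂ : ℤ} (hk : k₁ * k₂ < 0) {m : ℝ} (hm : -1 ≤ m)
    {φ : ℝ → ℂ} (h : mellinDisk φ (2 * |k₁| + |k₂|) ≠ 0) :
    commCoeff k₁ k₂ (fun r => ((r ^ m : ℝ) : ℂ)) φ (max (-k₁) (-k₂) - 1).toNat ≠ 0 := by
  rcases mul_neg_iff.1 hk with ⟨h2, h3⟩ | ⟨h2, h3⟩
  · rw [abs_of_pos h2, abs_of_neg h3] at h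
    rw [max_eq_right (by omega)]
    set N := (-k₂ - 1).toNat
    have hN : (N : ℤ) = -k₂ - 1 := by omega
    rw [commCoeff, toeplitzCoeff_of_neg (k := k₂) (n := N) φ (by omega), zero_mul, zero_sub, neg_ne_zero]
    refine mul_ne_zero (toeplitzCoeff_rpow_ne_zero hm (by omega)) ?_
    rw [hN, toeplitzCoeff, if_pos (by omega), intCast_toNat_complex (by omega)]
    have e1 : (2 * ((-k₂ - 1 + k₁ : ℤ) : ℂ) + k₂ + 2) = 2 * k₁ + (-k₂ : ℤ) := by push_cast; ring
    have e2 : (((-k₂ - 1 + k₁ : ℤ) : ℂ) + k₂ + 1) = k₁ := by push_cast; ring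
    rw [e1, e2]
    have : (k₁ : ℂ) ≠ 0 := by exact_mod_cast h2.ne'
    exact mul_ne_zero (mul_ne_zero two_ne_zero this) h
  · rw [abs_of_neg h2, abs_of_pos h3] at h
    rw [max_eq_left (by omega)]
    set N := (-k₁ - 1).toNat
    have hN : (N : ℤ) = -k₁ - 1 := by omega
    have hNc : (N : ℂ) = -k₁ - 1 := by exact_mod_cast congrArg (Int.cast : ℤ → ℂ) hN
    rw [commCoeff, toeplitzCoeff_of_neg (k := k₁) (n := N) _ (by omega), zero_mul, sub_zero]
    refine mul_ne_zero ?_ (toeplitzCoeff_rpow_ne_zero hm (by omega))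
    rw [toeplitzCoeff, if_pos (by omega), hNc]
    have e1 : (2 * (-k₁ - 1) + k₂ + 2 : ℂ) = 2 * (-k₁ : ℤ) + k₂ := by push_cast; ring
    have e2 : (-k₁ - 1 + k₂ + 1 : ℂ) = ((-k₁ + k₂ : ℤ) : ℂ) := by push_cast; ring
    rw [e1, e2]
    have : ((-k₁ + k₂ : ℤ) : ℂ) ≠ 0 := by
      rw [Int.cast_ne_zero]
      omega
    exact mul_ne_zero (mul_ne_zero two_ne_zero this) h

theorem exists_eventually_commRecurrence {k₁ k₂ : ℤ} (hk : k₁ ≠ 0) {m : ℝ} (hm : -1 ≤ m)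
    {φ : ℝ → ℂ} (h : ∀ᶠ n in atTop, commCoeff k₁ k₂ (fun r => ((r ^ m : ℝ) : ℂ)) φ n = 0) :
    ∃ x₀ : ℝ, ∀ᶠ j : ℕ in atTop, CommRecurrence ((|k₁| : ℤ) : ℝ) ((k₁.sign * k₂ : ℤ) : ℝ) m φ
      ((x₀ + 2 * ((|k₁| : ℤ) : ℝ) * j : ℝ) : ℂ) := by
  have hpos : 0 < k₁.natAbs := Int.natAbs_pos.2 hk
  have htend : Tendsto (fun j : ℕ => k₁.natAbs * j) atTop atTop :=
    tendsto_id.const_mul_atTop' hpos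
  -- Along `n = |k₁| j` the Mellin argument advances by exactly `2|k₁|`, and `n ≥ |k₁| + |k₂|` keeps
  -- every degree nonnegative.
  have h1 := htend.eventually
    (h.and (eventually_ge_atTop (k₁.natAbs + k₂.natAbs)))
  rcases lt_or_gt_of_ne hk with hneg | hpos'
  · refine ⟨2 * k₁ + k₂ + 2, ?_⟩
    filter_upwards [h1] with j hj
    have h2 := (commCoeff_eq_zero_iff_neg hm φ (by omega) (by omega) (by omega)).1 hj.1
    rw [Int.sign_eq_neg_one_of_neg hneg, abs_of_neg hneg]
    have e : ((k₁.natAbs : ℕ) : ℝ) = -k₁ := by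
      rw [Nat.cast_natAbs, abs_of_neg hneg, Int.cast_neg]
    rw [Nat.cast_mul, e] at h2
    push_cast at h2 ⊢
    convert h2 using 1 <;> ring
  · refine ⟨k₂ + 2, ?_⟩
    filter_upwards [h1] with j hj
    have h2 := (commCoeff_eq_zero_iff hm φ (by omega) (by omega) (by omega)).1 hj.1
    rw [Int.sign_eq_one_of_pos hpos', abs_of_pos hpos', one_mul]
    have e : ((k₁.natAbs : ℕ) : ℝ) = k₁ := by
      rw [Nat.cast_natAbs, abs_of_pos hpos']
    rw [Nat.cast_mul, e] at h2
    push_cast at h2 ⊢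
    convert h2 using 1; ring

/-! ### The conditions are sufficient -/

theorem gammaQuotient_int (a b : ℤ) (m : ℝ) (z : ℂ) :
    gammaQuotient (2 * (a : ℝ)) b (m + a - b) (2 * a - b) (m + a + b) z =
      Complex.Gamma ((z + b) / (2 * a)) * Complex.Gamma ((z + m + a - b) / (2 * a)) /
        (Complex.Gamma ((z + 2 * a - b) / (2 * a)) *
          Complex.Gamma ((z + m + a + b) / (2 * a))) := by
  simp only [gammaQuotient]
  push_cast
  simp only [← add_assoc, ← add_sub_assoc]

theorem gammaQuotient_int_neg_one (a : ℤ) (m : ℝ) (z : ℂ) :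
    gammaQuotient (2 * (a : ℝ)) (-1) (m + a - -1) (2 * a - -1) (m + a + -1) z =
      Complex.Gamma ((z - 1) / (2 * a)) * Complex.Gamma ((z + m + a + 1) / (2 * a)) /
        (Complex.Gamma ((z + 2 * a + 1) / (2 * a)) *
          Complex.Gamma ((z + m + a - 1) / (2 * a))) := by
  simp only [gammaQuotient]
  push_cast
  simp only [sub_neg_eq_add, ← sub_eq_add_neg, ← add_assoc, ← add_sub_assoc]

theorem one_le_abs_cast {k : ℤ} (hk : k ≠ 0) : (1 : ℝ) ≤ ((|k| : ℤ) : ℝ) := by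
  exact_mod_cast Int.one_le_abs hk

theorem mellinDisk_congr_ae {φ ψ : ℝ → ℂ}
    (h : ∀ᵐ r ∂(volume.restrict (Ioo (0 : ℝ) 1)), φ r = ψ r) (z : ℂ) :
    mellinDisk φ z = mellinDisk ψ z := by
  refine integral_congr_ae ?_
  filter_upwards [h] with r hr
  rw [hr]

/-- In the degenerate conditions one operator is scalar or both are diagonal; the two formulas for
`φ̂` give the recurrence, which covers every index. -/
theorem commCoeff_eq_zero_of_zeroCondition {k₁ k₂ : ℤ} {m : ℝ} (hm : -1 ≤ m) {φ : ℝ → ℂ}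
    (h : ZeroCondition k₁ k₂ m φ) (n : ℕ) :
    commCoeff k₁ k₂ (fun r => ((r ^ m : ℝ) : ℂ)) φ n = 0 := by
  rcases h with ⟨rfl, rfl⟩ | ⟨rfl, C, hC⟩ | ⟨rfl, rfl⟩ | ⟨hk, hlt, C, hC⟩ | ⟨hk, hge, N, hN, C, hC⟩
  · have h1 : ∀ j : ℕ, toeplitzCoeff 0 (fun r => ((r ^ (0 : ℝ) : ℝ) : ℂ)) j = 1 := by
      intro j
      have : (2 * ((j : ℝ) + 1)) ≠ 0 := by positivity
      rw [toeplitzCoeff_rpow (by norm_num) (by omega), Complex.ofReal_eq_one, div_eq_one_iff_eq]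
      · push_cast; ring
      · push_cast
        rwa [show 2 * (j : ℝ) + 0 + 2 + 0 = 2 * (j + 1) by ring]
    rw [commCoeff, h1, h1, add_zero, Int.toNat_natCast]
    ring
  · have h1 : ∀ j : ℕ, toeplitzCoeff 0 φ j = C := by
      intro j
      have e : mellinDisk φ (2 * j + (0 : ℤ) + 2) = C / (2 * j + 2) := by
        rw [mellinDisk_congr_ae (ψ := fun r => C * ((r ^ (0 : ℝ) : ℝ) : ℂ)) (by simpa using hC),
          mellinDisk_const_mul_rpow C le_rfl (by simp)]
        simp
      have : (j : ℂ) + 1 ≠ 0 := by exact_mod_cast Nat.succ_ne_zero j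
      rw [toeplitzCoeff, if_pos (by omega), e, show (2 * j + 2 : ℂ) = 2 * (j + 1) by ring]
      push_cast
      rw [add_zero]
      field_simp
    rw [commCoeff, h1, h1, add_zero, Int.toNat_natCast]
    ring
  · rw [commCoeff, add_zero, Int.toNat_natCast]
    ring
  · have h1 := one_le_abs_cast (left_ne_zero_of_mul hk.ne')
    have h2 := one_le_abs_cast (right_ne_zero_of_mul hk.ne')
    refine commCoeff_eq_zero_of_same_sign hk hm (fun x hx => ?_) n
    refine commRecurrence_of_mellinDisk_eq (c := C) (by linarith) (fun z hz => ?_)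
      (by rw [Complex.ofReal_re]; linarith) (by rw [Complex.ofReal_re]; linarith)
      (by rw [Complex.ofReal_re]; linarith)
    rw [hC z hz, gammaQuotient_int, mul_div_assoc]
  · have h1 := one_le_abs_cast (left_ne_zero_of_mul hk.ne')
    have h2 := one_le_abs_cast (right_ne_zero_of_mul hk.ne')
    refine commCoeff_eq_zero_of_same_sign hk hm (fun x hx => ?_) n
    have h3 := commRecurrence_of_mellinDisk_eq_prod (φ := φ) (a := ((|k₁| : ℤ) : ℝ))
      (b := ((|k₂| : ℤ) : ℝ)) (by linarith) (by linarith) N (c := C) (fun z hz => by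
        rw [hC z hz]; simp only [Complex.ofReal_intCast]) (z := (x : ℂ))
      (by rw [Complex.ofReal_re]; linarith) (by rw [Complex.ofReal_re]; linarith)
    have hN' : m = (2 * N + 1) * ((|k₁| : ℤ) : ℝ) := by simpa using hN
    rw [hN']
    exact h3

theorem toNat_max_eq_of_opposite_sign {k₁ k₂ : ℤ} (hk : k₁ * k₂ < 0) :
    ((max (-k₁) (-k₂) - 1).toNat + (k₁ + k₂)).toNat = (max k₁ k₂ - 1).toNat := by
  rcases mul_neg_iff.1 hk with ⟨h1, h2⟩ | ⟨h1, h2⟩ <;> omega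

theorem commCoeff_of_rankOneCondition {k₁ k₂ : ℤ} {m : ℝ} (hm : -1 ≤ m) {φ : ℝ → ℂ}
    (hφ : IntegrableProfile φ)
    (hne : ¬ ∀ᵐ r ∂(volume.restrict (Ioo (0 : ℝ) 1)), φ r = 0) (h : RankOneCondition k₁ k₂ m φ) :
    k₁ * k₂ < 0 ∧
    (∀ n ≠ (max (-k₁) (-k₂) - 1).toNat,
      commCoeff k₁ k₂ (fun r => ((r ^ m : ℝ) : ℂ)) φ n = 0) ∧
    commCoeff k₁ k₂ (fun r => ((r ^ m : ℝ) : ℂ)) φ (max (-k₁) (-k₂) - 1).toNat ≠ 0 := by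
  rcases h with ⟨hk, hk₂, hma, C, hC⟩ | ⟨hk, hk₂, C, hC⟩
  · have h1 := one_le_abs_cast (left_ne_zero_of_mul hk.ne)
    have h2 := one_le_abs_cast (right_ne_zero_of_mul hk.ne)
    have hma' : m + ((|k₁| : ℤ) : ℝ) = 0 := by simpa using hma
    -- Together `m ≥ -1` and `m + |k₁| = 0` leave only `|k₁| = 1`, which makes the exceptional index
    -- unique.
    have hk₁ : |k₁| = 1 := by
      have h3 : ((|k₁| : ℤ) : ℝ) = 1 := le_antisymm (by linarith) h1
      exact_mod_cast h3
    have hmel : ∀ z : ℂ, 2 ≤ z.re → mellinDisk φ z = C / (z + ((|k₂| : ℤ) : ℝ)) := by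
      intro z hz
      rw [mellinDisk_congr_ae (ψ := fun r => C * ((r ^ (((|k₂| : ℤ) : ℝ)) : ℝ) : ℂ)),
        mellinDisk_const_mul_rpow C (by linarith) hz]
      filter_upwards [hC] with r hr
      rw [hr, Real.rpow_intCast]
      push_cast
      rfl
    have hC0 : C ≠ 0 := by
      rintro rfl
      refine hne ?_
      filter_upwards [hC] with r hr
      rw [hr, zero_mul]
    refine ⟨hk, commCoeff_eq_zero_of_opposite_sign hk hm (fun x hx => ?_) (Or.inl hk₁),
      commCoeff_ne_zero_of_opposite_sign hk hm ?_⟩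
    · rw [CommRecurrence, hma', hmel x (by rw [Complex.ofReal_re]; linarith),
        hmel _ (by simp only [Complex.add_re, Complex.ofReal_re]; linarith)]
      have h3 : (x : ℂ) + ((|k₂| : ℤ) : ℝ) ≠ 0 :=
        add_ofReal_ne_zero (by rw [Complex.ofReal_re]; linarith)
      have h4 : (x : ℂ) + (2 * ((|k₁| : ℤ) : ℝ) : ℝ) + ((|k₂| : ℤ) : ℝ) ≠ 0 :=
        add_ofReal_ne_zero (by simp only [Complex.add_re, Complex.ofReal_re]; linarith)
      rw [mul_div_assoc', mul_div_assoc', div_eq_div_iff h3 h4]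
      push_cast
      ring
    · have h5 : 2 * ((|k₁| : ℤ) : ℂ) + ((|k₂| : ℤ) : ℂ) =
          ((2 * ((|k₁| : ℤ) : ℝ) + ((|k₂| : ℤ) : ℝ) : ℝ) : ℂ) := by
        simp only [Complex.ofReal_add, Complex.ofReal_mul, Complex.ofReal_ofNat,
          Complex.ofReal_intCast]
      rw [h5, hmel _ (by rw [Complex.ofReal_re]; linarith)]
      exact div_ne_zero hC0 (add_ofReal_ne_zero (by rw [Complex.ofReal_re]; linarith))
  · have h1 := one_le_abs_cast (left_ne_zero_of_mul hk.ne)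
    have hmel : ∀ z : ℂ, 2 ≤ z.re → mellinDisk φ z = C * gammaQuotient (2 * ((|k₁| : ℤ) : ℝ)) (-1)
        (m + ((|k₁| : ℤ) : ℝ) - -1) (2 * ((|k₁| : ℤ) : ℝ) - -1) (m + ((|k₁| : ℤ) : ℝ) + -1) z := by
      intro z hz
      rw [hC z hz, gammaQuotient_int_neg_one, mul_div_assoc]
    have hC0 : C ≠ 0 := by
      rintro rfl
      exact hne (ae_eq_zero_of_mellinDisk_eq_zero hφ (R := 2) fun z hz => by
        rw [hmel z hz.le, zero_mul])
    refine ⟨hk, commCoeff_eq_zero_of_opposite_sign hk hm (fun x hx => ?_) (Or.inr hk₂),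
      commCoeff_ne_zero_of_opposite_sign hk hm ?_⟩
    · rw [hk₂] at hx ⊢
      push_cast at hx ⊢
      have h1' : (1 : ℝ) ≤ |(k₁ : ℝ)| := by simpa using h1
      push_cast at hmel
      exact commRecurrence_of_mellinDisk_eq (c := C) (by linarith) hmel
        (by rw [Complex.ofReal_re]; linarith) (by rw [Complex.ofReal_re]; linarith)
        (by rw [Complex.ofReal_re]; linarith)
    · have h5 : 2 * ((|k₁| : ℤ) : ℂ) + ((|k₂| : ℤ) : ℂ) =
          ((2 * ((|k₁| : ℤ) : ℝ) + 1 : ℝ) : ℂ) := by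
        rw [hk₂]
        simp only [Complex.ofReal_add, Complex.ofReal_mul, Complex.ofReal_ofNat,
          Complex.ofReal_intCast, Complex.ofReal_one, Int.cast_one]
      rw [h5, hmel _ (by rw [Complex.ofReal_re]; linarith)]
      refine mul_ne_zero hC0 (gammaQuotient_ne_zero (by linarith) ?_ ?_ ?_ ?_) <;>
        · rw [Complex.ofReal_re]
          linarith

/-! ### The conditions are necessary -/

theorem mellinDisk_eq_zero_of_eventually {φ : ℝ → ℂ} (hφ : IntegrableProfile φ) (x₀ : ℝ)
    (h : ∀ᶠ n : ℕ in atTop, mellinDisk φ ((x₀ + 2 * n : ℝ) : ℂ) = 0) {z : ℂ} (hz : 2 < z.re) :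
    mellinDisk φ z = 0 := by
  have hlarge : ∀ᶠ n : ℕ in atTop, 2 < x₀ + 2 * n := by
    have : Tendsto (fun n : ℕ => x₀ + 2 * (n : ℝ)) atTop atTop :=
      tendsto_atTop_add_const_left _ _ (tendsto_natCast_atTop_atTop.const_mul_atTop two_pos)
    exact this.eventually_gt_atTop 2
  obtain ⟨N, hN⟩ := eventually_atTop.1 (h.and hlarge)
  refine eq_zero_of_polynomial_growth_of_zeros (R := 2) (N := 0)
    (M := ∫ r in Ioo (0 : ℝ) 1, ‖φ r * (r : ℂ)‖) two_pos (hN N le_rfl).2 two_pos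
    (differentiableOn_mellinDisk hφ) (fun z hz => ?_) (fun j => ?_) hz
  · rw [pow_zero, mul_one]
    exact norm_mellinDisk_le hφ (le_of_lt hz)
  · have := (hN (N + j) (by omega)).1
    rw [← this]
    push_cast
    ring_nf

/-- For `k₁ = 0` the bracket in `commCoeff_eq` collapses to `m k₂ φ̂(2n+k₂+2)`. If `m k₂ ≠ 0`, then
`φ̂` vanishes along an arithmetic progression and hence everywhere. -/
theorem conditions_of_left_degree_zero {k₂ : ℤ} {m : ℝ} (hm : -1 ≤ m) {φ : ℝ → ℂ}
    (hφ : IntegrableProfile φ)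
    (hne : ¬ ∀ᵐ r ∂(volume.restrict (Ioo (0 : ℝ) 1)), φ r = 0)
    (h : ∀ᶠ n in atTop, commCoeff 0 k₂ (fun r => ((r ^ m : ℝ) : ℂ)) φ n = 0) :
    m = 0 ∨ k₂ = 0 := by
  by_contra! hcon
  refine hne (ae_eq_zero_of_mellinDisk_eq_zero hφ (R := 2) fun z hz =>
    mellinDisk_eq_zero_of_eventually hφ (k₂ + 2) ?_ hz)
  filter_upwards [h, eventually_ge_atTop k₂.natAbs] with n hn hn'
  rw [commCoeff_eq hm φ (by omega) (by omega) (by omega), mul_eq_zero,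
    or_iff_right (commCoeff_prefactor_ne_zero hm (by omega) (by omega) (by omega))] at hn
  have e : ((k₂ + 2 + 2 * n : ℝ) : ℂ) = 2 * n + k₂ + 2 := by push_cast; ring
  rw [e]
  have h1 : (m * k₂ : ℂ) ≠ 0 :=
    mul_ne_zero (Complex.ofReal_ne_zero.2 hcon.1) (Int.cast_ne_zero.2 hcon.2)
  simp only [Int.cast_zero, mul_zero, add_zero] at hn
  refine (mul_eq_zero.1 ?_).resolve_left h1
  linear_combination hn

/-- With zero shift the quotient collapses to `2a/z`, the transform of a constant. -/
theorem ae_eq_const_of_mellinDisk_eq {φ : ℝ → ℂ} (hφ : IntegrableProfile φ)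
    {a m : ℝ} (ha : 0 < a) {c : ℂ} {R : ℝ} (h : ∀ z : ℂ, R < z.re → mellinDisk φ z =
      c * gammaQuotient (2 * a) 0 (m + a - 0) (2 * a - 0) (m + a + 0) z) :
    ∀ᵐ r ∂(volume.restrict (Ioo (0 : ℝ) 1)), φ r = c * (2 * a) := by
  have key := ae_eq_of_mellinDisk_eq hφ (c * (2 * a)) (b := 0) (R := max R |m|) le_rfl
    fun z hz => ?_
  · simpa using key
  have h1 := (le_max_left _ _).trans_lt hz
  have h2 := (le_max_right _ _).trans_lt hz
  have h2' := neg_abs_le m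
  have h2'' := abs_nonneg m
  have ha' : (a : ℂ) ≠ 0 := Complex.ofReal_ne_zero.2 ha.ne'
  have hz0 : z ≠ 0 := fun h0 => by simp [h0] at h2; linarith
  have h3 : Complex.Gamma ((z + (m + a : ℝ)) / (2 * a : ℝ)) ≠ 0 :=
    Gamma_add_div_ne_zero (by positivity) (by linarith)
  have h4 : Complex.Gamma ((z + (0 : ℝ)) / (2 * a : ℝ)) ≠ 0 :=
    Gamma_add_div_ne_zero (by positivity) (by linarith)
  have h5 : z / (2 * a : ℝ) ≠ 0 := div_ne_zero hz0 (by push_cast; simp [ha'])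
  have e : (z + (2 * a : ℝ)) / (2 * a : ℝ) = z / (2 * a : ℝ) + 1 := by
    push_cast
    field_simp
  rw [Complex.ofReal_zero, add_zero] at h4
  rw [h z h1, gammaQuotient, sub_zero, sub_zero, add_zero, Complex.ofReal_zero, add_zero, e,
    Complex.Gamma_add_one _ h5]
  push_cast at h3 h4 ⊢
  field_simp

theorem eventually_zero_imp {k₁ k₂ : ℤ} {m : ℝ} (hm : -1 ≤ m) {φ : ℝ → ℂ}
    (hφ : IntegrableProfile φ)
    (hne : ¬ ∀ᵐ r ∂(volume.restrict (Ioo (0 : ℝ) 1)), φ r = 0)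
    (h : ∀ᶠ n in atTop, commCoeff k₁ k₂ (fun r => ((r ^ m : ℝ) : ℂ)) φ n = 0) :
    ZeroCondition k₁ k₂ m φ ∨ RankOneCondition k₁ k₂ m φ := by
  rcases eq_or_ne k₁ 0 with rfl | hk₁
  · rcases conditions_of_left_degree_zero hm hφ hne h with h0 | h0
    · exact Or.inl (Or.inl ⟨rfl, h0⟩)
    · exact Or.inl (Or.inr (Or.inr (Or.inl ⟨rfl, h0⟩)))
  have ha1 := one_le_abs_cast hk₁
  obtain ⟨x₀, hrec⟩ := exists_eventually_commRecurrence hk₁ hm h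
  obtain ⟨c, hc, R, hR⟩ := exists_mellinDisk_eq_of_commRecurrence hφ hne (by linarith) _ _ _ hrec
  rcases lt_trichotomy (k₁ * k₂) 0 with hk | hk | hk
  · have hb1 := one_le_abs_cast (right_ne_zero_of_mul hk.ne)
    have hβ : k₁.sign * k₂ = -|k₂| := by
      rcases mul_neg_iff.1 hk with ⟨h1, h2⟩ | ⟨h1, h2⟩
      · rw [Int.sign_eq_one_of_pos h1, abs_of_neg h2]; ring
      · rw [Int.sign_eq_neg_one_of_neg h1, abs_of_pos h2]; ring
    rw [hβ, Int.cast_neg] at hR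
    right
    -- The pole of `Γ((z-|k₂|)/(2|k₁|))` at `z = |k₂|` lies outside `Re z ≥ 2` exactly when `|k₂| =
    -- 1`.
    rcases eq_or_ne |k₂| 1 with hk₂ | hk₂
    · right
      refine ⟨hk, hk₂, c, fun z hz => ?_⟩
      rw [hk₂, Int.cast_one] at hR
      rw [mellinDisk_eq_gammaQuotient hφ (by linarith) (by linarith) (by linarith) hR hz,
        gammaQuotient_int_neg_one, ← mul_div_assoc]
    · left
      have hk₂' : 2 ≤ |k₂| := by
        have := Int.one_le_abs (right_ne_zero_of_mul hk.ne)
        omega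
      have hb2 : (2 : ℝ) ≤ ((|k₂| : ℤ) : ℝ) := by exact_mod_cast hk₂'
      have hma := add_eq_zero_of_opposite_sign hφ (by linarith) hb2 (by linarith) hc hR
      rw [hma] at hR
      have h1 := ae_eq_rpow_of_opposite_sign hφ (by linarith) (by linarith) hR
      refine ⟨hk, hk₂', by simpa using hma, c * (2 * (((|k₁| : ℤ) : ℝ) : ℂ)), ?_⟩
      filter_upwards [h1] with r hr
      rw [hr, Real.rpow_intCast]
      push_cast
      rfl
  · have hk₂ : k₂ = 0 := (mul_eq_zero.1 hk).resolve_left hk₁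
    subst hk₂
    left; right; left
    rw [mul_zero, Int.cast_zero] at hR
    exact ⟨rfl, _, ae_eq_const_of_mellinDisk_eq hφ (by linarith) hR⟩
  · have hb1 := one_le_abs_cast (right_ne_zero_of_mul hk.ne')
    have hβ : k₁.sign * k₂ = |k₂| := by
      rcases mul_pos_iff.1 hk with ⟨h1, h2⟩ | ⟨h1, h2⟩
      · rw [Int.sign_eq_one_of_pos h1, abs_of_pos h2]; ring
      · rw [Int.sign_eq_neg_one_of_neg h1, abs_of_neg h2]; ring
    rw [hβ] at hR
    left; right; right; right
    -- The threshold decides whether the pole at `z = |k₂| - m - |k₁|` lies in `Re z ≥ 2`.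
    rcases lt_or_ge ((|k₂| : ℤ) : ℝ) (m + ((|k₁| : ℤ) : ℝ) + 2) with hlt | hge
    · left
      refine ⟨hk, by simpa using hlt, c, fun z hz => ?_⟩
      rw [mellinDisk_eq_gammaQuotient hφ (by linarith) (by linarith) (by linarith) hR hz,
        gammaQuotient_int, ← mul_div_assoc]
    · right
      obtain ⟨n, hn⟩ := exists_eq_odd_mul_of_same_sign hφ (by linarith) (by linarith) hge hc hR
      refine ⟨hk, by simpa using hge, n, by simpa using hn, c, fun z hz => ?_⟩
      rw [hn] at hR
      rw [mellinDisk_eq_prod_of_same_sign hφ (by linarith) (by linarith) n hR hz]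
      simp only [Complex.ofReal_intCast]

end BergmanToeplitz

end

/-! ### The characterization of finite rank -/

theorem mainTheorem7 (k₁ k₂ : ℤ) (m : ℝ) (hm : -1 ≤ m) (φ : ℝ → ℂ)
    (hT : IsTFunction (radial φ)) (hne : ¬ (radial φ =ᵐ[diskMeasure] 0)) :
    -- both symbols define a unique bounded Toeplitz operator on the Bergman space
    (∃! T, IsBergmanToeplitz (quasihomogeneous k₁ fun r => ((r ^ m : ℝ) : ℂ)) T) ∧
    (∃! T, IsBergmanToeplitz (quasihomogeneous k₂ φ) T) ∧
    -- characterization of finite rank, and the canonical forms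
    (let K := BergmanToeplitz.commutator
        (bergmanToeplitz (quasihomogeneous k₁ fun r => ((r ^ m : ℝ) : ℂ)))
        (bergmanToeplitz (quasihomogeneous k₂ φ))
     let f := bergmanPow (max k₁ k₂ - 1).toNat
     let g := bergmanPow (max (-k₁) (-k₂) - 1).toNat
     (IsFiniteRank K ↔ ZeroCondition k₁ k₂ m φ ∨ RankOneCondition k₁ k₂ m φ) ∧
     (ZeroCondition k₁ k₂ m φ → K = 0 ∧ LinearMap.rank (K : bergmanSpace →ₗ[ℂ] bergmanSpace) = 0) ∧
     (RankOneCondition k₁ k₂ m φ →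
       LinearMap.range (K : bergmanSpace →ₗ[ℂ] bergmanSpace) = Submodule.span ℂ {f} ∧
       (∃ C : ℂ, C ≠ 0 ∧ K = C • InnerProductSpace.rankOne ℂ f g) ∧
       LinearMap.rank (K : bergmanSpace →ₗ[ℂ] bergmanSpace) = 1)) := by
  have hφ := hT.integrableProfile
  have hne' : ¬ ∀ᵐ r ∂(volume.restrict (Ioo (0 : ℝ) 1)), φ r = 0 :=
    fun h => hne (radial_ae_eq_zero h)
  obtain ⟨C, hC⟩ := hT.exists_norm_moment_le
  have hψ : IntegrableProfile fun r => ((r ^ m : ℝ) : ℂ) := integrableProfile_rpow (by linarith)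
  have hu₁ := existsUnique_isBergmanToeplitz hψ k₁ (norm_moment_rpow_le hm)
  have hu₂ := existsUnique_isBergmanToeplitz hφ k₂ hC
  refine ⟨hu₁, hu₂, ?_⟩
  intro K f g
  have hK : ∀ n, K (bergmanPow n) =
      commCoeff k₁ k₂ (fun r => ((r ^ m : ℝ) : ℂ)) φ n • bergmanPow (n + (k₁ + k₂)).toNat := by
    intro n
    rw [← add_assoc]
    exact commutator_bergmanPow (bergmanToeplitz_bergmanPow hψ hu₁)
      (bergmanToeplitz_bergmanPow hφ hu₂) n
  have hzero : ZeroCondition k₁ k₂ m φ → K = 0 := fun h =>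
    eq_zero_of_coeff_eq_zero hK (commCoeff_eq_zero_of_zeroCondition hm h)
  have hone : RankOneCondition k₁ k₂ m φ →
      ∃ C : ℂ, C ≠ 0 ∧ K = C • InnerProductSpace.rankOne ℂ f g := by
    intro h
    obtain ⟨hk, h1, h2⟩ := commCoeff_of_rankOneCondition hm hφ hne' h
    have h3 := eq_smul_rankOne_of_coeff hK _ h1
    rw [toNat_max_eq_of_opposite_sign hk] at h3
    exact ⟨_, mul_ne_zero h2 (Nat.cast_add_one_ne_zero _), h3⟩
  have hrange : RankOneCondition k₁ k₂ m φ →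
      LinearMap.range (K : bergmanSpace →ₗ[ℂ] bergmanSpace) = Submodule.span ℂ {f} := by
    intro h
    obtain ⟨C, hC, hKC⟩ := hone h
    rw [hKC]
    exact range_smul_rankOne hC _ _
  refine ⟨⟨fun h => ?_, ?_⟩, fun h => ⟨hzero h, ?_⟩, fun h => ⟨hrange h, hone h, ?_⟩⟩
  · exact eventually_zero_imp hm hφ hne' (eventually_eq_zero_of_isFiniteRank hK h)
  · rintro (h | h)
    · rw [hzero h]
      exact isFiniteRank_zero
    · exact isFiniteRank_of_range_eq_span (hrange h)
  · rw [hzero h]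
    exact LinearMap.rank_zero
  · exact rank_eq_one_of_range_eq_span (bergmanPow_ne_zero _) (hrange h)
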